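/- **Setting.** Let $\mathcal W_1$ be a countable alphabet with a $0$–$1$ transition matrix, $\Sigma^+$ the associated one-sided Markov shift with left shift $\sigma$, assumed topologically mixing. A word is admissible if its consecutive letters are allowed transitions; $[w]\subset\Sigma^+$ is the cylinder of a word $w$, $|w|$ its length, and $\mathcal W^{B,b}_n$ is the set of admissible words of length $n$ with first letter $B$ and last letter $b$. Let $R:\Sigma^+\to(0,\infty)$ with $\log R$ locally Hölder continuous (there are $C>0$, $\theta\in(0,1)$ with $|\log R(y)-\log R(z)|\le C\theta^n$ whenever $n\ge 2$ and $y,z$ share their first $n$ letters), and write $R_n(z)=R(z)R(\sigma z)\cdots R(\sigma^{n-1}z)$. Assume that the Gurevič pressure of $\log R$ is $0$ and that $R$ is strongly positively recurrent: for every letter $B$ the sums $\sum_{\sigma^nz=z,\,z_0=B}R_n(z)$ are bounded above and away from $0$ for all large $n$, and $$\gamma_B(\mathrm{SPR})=\limsup_{n\to\infty}\Big(\sum_{\sigma^nz=z,\;z_0=B,\;z_i\ne B\,(0<i<n)}R_n(z)\Big)^{1/n}<1 .$$ Let $G$ be a countable discrete group, $\mathfrak s:\mathcal W_1\to G$ a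 map, $\underline{\mathfrak s}(w_1\cdots w_n)=\mathfrak s(w_1)\cdots\mathfrak s(w_n)$, and $T_{\mathfrak s}(z,g)=(\sigma z,\mathfrak s(z_0)^{-1}g)$ the skew product. Let $\rho$ on $\mathcal H$ be a countable direct sum of quotient representations $\ell^2(G/H_j)$, $[\rho(g)f](yH_j)=f(g^{-1}yH_j)$, and $\mathcal H_+$ the cone of non-negative functions. For $\varphi:G\to\mathbb R$ put $\varphi*_\rho f=\sum_{g}\varphi(g)\rho(g)f$. Fix letters $A,a$ and $x\in\Sigma^+$ such that $ax$ is admissible. For $c:\mathbb N\to(0,\infty)$ and $t>0$ put $$\phi_{c;\le N}[t](g)=\sum_{n=1}^{N}t^{-n}c_n\sum_{w\in\mathcal W_n^{A,a},\ \underline{\mathfrak s}(w)=g}R_n(wx),\qquad \phi_c[t]=\lim_{N\to\infty}\phi_{c;\le N}[t],$$ $\phi_{\le N}[t]=\phi_{1;\le N}[t]$, and $\gamma=\gamma(\phi*_\rho f)=\inf\{t>0:\sup_N\|\phi_{\le N}[t]*_\rho f\|<\infty\}$. A function $c:\mathbb N\to(0,\infty)$ is slowly increasing if it is non-decreasing,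 $c_n\to\infty$, and $c_{n+k}/c_n\to1$ as $n\to\infty$ for each $k$. **Lemma.** Let $0\ne f\in\mathcal H_+$. Assume that $\Sigma^+$ is compact, or that $x_0=A$ and $\gamma>\gamma_B(\mathrm{SPR})$ for some letter $B$. Then there are a slowly increasing $c$ and a sequence $t_k>\gamma$, $t_k\to\gamma$, such that the vectors $Q_k=\phi_c[t_k]*_\rho f\in\mathcal H$ are well defined and nonzero, the limit $$\Upsilon_c(g)=\lim_{k\to\infty}\frac{\langle\rho(g)Q_k,Q_k\rangle}{\langle Q_k,Q_k\rangle}$$ exists for every $g\in G$, and there is a Borel measure $\nu_c$ on $\Sigma^+$, finite on the cylinders of nonempty words, such that $$\gamma^{n}\int_{[wA]}R_n^{-1}\,d\nu_c=\Upsilon_c(\underline{\mathfrak s}(w))$$ for every $n\ge0$ and every word $w$ of length $n$ with $wA$ admissible. The measure $\nu_c$ is a twisted measure in the following sense. For every $g\in G$ the measures $$\nu^{g}_{k}=\sum_{v}t_k^{-|v|}c_{|v|}R_{|v|}(vx)\,\frac{\langle\rho(\underline{\mathfrak s}(v))f,\rho(g)^{-1}Q_k\rangle}{\langle Q_k,Q_k\rangle}\,\delta_{vx}$$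 (sum over all admissible words $v$ with last letter $a$) are finite on cylinders of nonempty words and converge as $k\to\infty$, on every one-letter cylinder against bounded continuous functions, to a measure finite on cylinders of nonempty words, and $\nu_c$ is the limit for $g=e$. If moreover $T_{\mathfrak s}$ is topologically transitive, then there is $h:G\times\Sigma^+\to[0,\infty)$, measurable in the second variable, such that for every nonempty admissible word $w$ of length $n$ the push-forward of $\nu_c|_{\sigma^n[w]}$ under $z\mapsto wz$ is absolutely continuous with respect to $\nu_c|_{[w]}$ with density $z\mapsto\gamma^{n}R_n(z)^{-1}h(\underline{\mathfrak s}(w),z)$. -/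

import Mathlib

open Set Filter Topology MeasureTheory
open scoped ENNReal BoundedContinuousFunction

noncomputable section

/-! ### One-sided countable Markov shifts -/

/-- The one-sided Markov shift `Σ⁺` with alphabet `W` and transitions `τ`. -/
structure MarkovShift {W : Type*} (τ : W → W → Prop) where
  /-- the sequence of letters -/
  seq : ℕ → W
  /-- consecutive letters are allowed transitions -/
  adm : ∀ i, τ (seq i) (seq (i + 1))

namespace MarkovShift

variable {W : Type*} {τ : W → W → Prop}

/-- The topology induced by the product topology. -/
instance [TopologicalSpace W] : TopologicalSpace (MarkovShift τ) :=
  TopologicalSpace.induced MarkovShift.seq inferInstance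

/-- The Borel `σ`-algebra. -/
instance [TopologicalSpace W] : MeasurableSpace (MarkovShift τ) := borel _

instance [TopologicalSpace W] : BorelSpace (MarkovShift τ) := ⟨rfl⟩

/-- The left shift `σ`. -/
def shift (x : MarkovShift τ) : MarkovShift τ :=
  ⟨fun i => x.seq (i + 1), fun i => x.adm (i + 1)⟩

/-- The cylinder `[w]` of points whose first `|w|` letters spell `w`. -/
def cylinder (τ : W → W → Prop) (w : List W) : Set (MarkovShift τ) :=
  {x | ∀ i : ℕ, ∀ b : W, w[i]? = some b → x.seq i = b}

/-- The sequence `wz`, the word `w` followed by the sequence `z`. -/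
def concat (w : List W) (z : ℕ → W) : ℕ → W :=
  fun i => w.getD i (z (i - w.length))

open Classical in
/-- The point `wz` of the shift. If `wz` is not admissible the value is the irrelevant `z`. -/
def prepend (w : List W) (z : MarkovShift τ) : MarkovShift τ :=
  if h : ∀ i, τ (concat w z.seq i) (concat w z.seq (i + 1)) then ⟨concat w z.seq, h⟩ else z

/-- `𝓦ₙ^{B,b}`: admissible words of length `n` with first letter `B` and last letter `b`. -/
def IsWord (τ : W → W → Prop) (B b : W) (n : ℕ) (w : List W) : Prop :=
  w.length = n ∧ w.IsChain τ ∧ w.head? = some B ∧ w.getLast? = some b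

/-- Topological mixing of the shift, expressed with one-letter cylinders. -/
def IsMixing (τ : W → W → Prop) : Prop :=
  ∀ b d : W, ∃ N : ℕ, ∀ n ≥ N, ∃ x : MarkovShift τ, x.seq 0 = b ∧ x.seq n = d

/-! ### The potential -/

/-- `Rₙ(x) = R(x) R(σ x) ⋯ R(σ^{n-1} x)`. -/
def birkhoffProd (R : MarkovShift τ → ℝ) (n : ℕ) (x : MarkovShift τ) : ℝ :=
  ∏ i ∈ Finset.range n, R (shift^[i] x)

/-- `log R` is locally Hölder: its variation over points sharing the first `n ≥ 2` letters is at
most `C θⁿ`. -/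
def IsLocallyHolder (R : MarkovShift τ → ℝ) : Prop :=
  ∃ C θ : ℝ, 0 < θ ∧ θ < 1 ∧ ∀ n : ℕ, 2 ≤ n → ∀ x y : MarkovShift τ,
    (∀ i < n, x.seq i = y.seq i) → |Real.log (R x) - Real.log (R y)| ≤ C * θ ^ n

/-- `∑ Rₙ(x)` over the points of `[B]` with `σⁿ x = x`. -/
def periodicSum (R : MarkovShift τ → ℝ) (B : W) (n : ℕ) : ℝ≥0∞ :=
  ∑' x : {x : MarkovShift τ // shift^[n] x = x ∧ x.seq 0 = B},
    ENNReal.ofReal (birkhoffProd R n x.1)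

/-- `∑ Rₙ(x)` over the points of `[B]` with `σⁿ x = x` and first return time `n` to `[B]`. -/
def firstReturnSum (R : MarkovShift τ → ℝ) (B : W) (n : ℕ) : ℝ≥0∞ :=
  ∑' x : {x : MarkovShift τ // shift^[n] x = x ∧ x.seq 0 = B ∧ ∀ i, 0 < i → i < n → x.seq i ≠ B},
    ENNReal.ofReal (birkhoffProd R n x.1)

/-- The Gurevič pressure `P(log R, σ)`, computed at the letter `B`. -/
def gurevicPressure (R : MarkovShift τ → ℝ) (B : W) : EReal :=
  limsup (fun n : ℕ => (((n : ℝ)⁻¹ : ℝ) : EReal) * ENNReal.log (periodicSum R B n)) atTop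

/-- Positive recurrence (for a potential of zero pressure). -/
def IsPositiveRecurrent (R : MarkovShift τ → ℝ) : Prop :=
  ∀ B : W, ∃ M : ℝ, 0 < M ∧ ∀ᶠ n : ℕ in atTop,
    ENNReal.ofReal M⁻¹ ≤ periodicSum R B n ∧ periodicSum R B n ≤ ENNReal.ofReal M

/-- `γ(SPR)`: the exponential growth rate of the first returns to the letter `B`. -/
def gammaSPR (R : MarkovShift τ → ℝ) (B : W) : ℝ≥0∞ :=
  limsup (fun n : ℕ => firstReturnSum R B n ^ ((n : ℝ)⁻¹)) atTop

/-- Strong positive recurrence (for a potential of zero pressure). -/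
def IsStronglyPositiveRecurrent (R : MarkovShift τ → ℝ) : Prop :=
  IsPositiveRecurrent R ∧ ∀ B : W, gammaSPR R B < 1

/-! ### Group extensions -/

/-- `𝔰(w) = 𝔰(w₁) ⋯ 𝔰(wₙ)`. -/
def wordProd {G : Type*} [Group G] (s : W → G) (w : List W) : G := (w.map s).prod

/-- The skew product `T_𝔰(x, g) = (σ x, 𝔰(x₀)⁻¹ g)`. -/
def skewProduct {G : Type*} [Group G] (s : W → G) (p : MarkovShift τ × G) : MarkovShift τ × G :=
  (shift p.1, (s (p.1.seq 0))⁻¹ * p.2)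

/-- Topological transitivity of `T_𝔰`, where `G` is discrete. -/
def IsTransitiveExtension [TopologicalSpace W] (τ : W → W → Prop) {G : Type*} [Group G]
    (s : W → G) : Prop :=
  ∀ U V : Set (MarkovShift τ), IsOpen U → IsOpen V → U.Nonempty → V.Nonempty → ∀ g h : G,
    ∃ n : ℕ, ∃ x ∈ U, ((skewProduct s)^[n] (x, g)).1 ∈ V ∧ ((skewProduct s)^[n] (x, g)).2 = h

end MarkovShift

/-! ### Countable sums of quotient representations -/

section Representation

variable {G ι : Type*} [Group G]

/-- The Hilbert sum `⨁ⱼ ℓ²(G/Hⱼ)`, realised as `ℓ²` of the disjoint union of the `G/Hⱼ`. -/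
abbrev QuotSum (H : ι → Subgroup G) : Type _ := lp (fun _ : (Σ j : ι, G ⧸ H j) => ℝ) 2

lemma memlp_translate (H : ι → Subgroup G) (g : G) (f : QuotSum H) :
    Memℓp (E := fun _ : (Σ j : ι, G ⧸ H j) => ℝ) (fun y => f (g⁻¹ • y)) 2 := by
  have h2 : (0 : ℝ) < (2 : ℝ≥0∞).toReal := by norm_num
  refine memℓp_gen ?_
  exact ((MulAction.toPerm (g⁻¹ : G)).summable_iff (f := fun y => ‖f y‖ ^ (2 : ℝ≥0∞).toReal)).2
    ((lp.memℓp f).summable h2)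

/-- The unitary operator `[ρ(g) f](y) = f(g⁻¹ y)`. -/
def quotRepOp (H : ι → Subgroup G) (g : G) : QuotSum H ≃ₗᵢ[ℝ] QuotSum H where
  toFun f := ⟨fun y => f (g⁻¹ • y), memlp_translate H g f⟩
  invFun f := ⟨fun y => f (g⁻¹⁻¹ • y), memlp_translate H g⁻¹ f⟩
  map_add' f₁ f₂ := by ext y; rfl
  map_smul' r f := by ext y; rfl
  left_inv f := by ext y; simp
  right_inv f := by ext y; simp
  norm_map' f := by
    have h2 : (0 : ℝ) < (2 : ℝ≥0∞).toReal := by norm_num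
    rw [lp.norm_eq_tsum_rpow h2, lp.norm_eq_tsum_rpow h2]
    congr 1
    exact (MulAction.toPerm (g⁻¹ : G)).tsum_eq (fun y => ‖f y‖ ^ (2 : ℝ≥0∞).toReal)

/-- The representation `ρ = ⨁ⱼ λ_{Hⱼ}` of `G`, a sum of quotient representations. -/
def quotRep (H : ι → Subgroup G) : G →* (QuotSum H ≃ₗᵢ[ℝ] QuotSum H) where
  toFun := quotRepOp H
  map_one' := by
    ext f y
    simp [quotRepOp]
  map_mul' g₁ g₂ := by
    ext f y
    simp [quotRepOp, mul_smul]

/-- `φ ∗_ρ f = ∑_g φ(g) ρ(g) f`. -/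
def repConv (H : ι → Subgroup G) (φ : G → ℝ) (f : QuotSum H) : QuotSum H :=
  ∑' g : G, φ g • quotRep H g f

end Representation

/-! ### Thermodynamic `G`-densities -/

/-- Slowly increasing functions. -/
def IsSlowlyIncreasing (c : ℕ → ℝ) : Prop :=
  (∀ n, 0 < c n) ∧ Monotone c ∧ Tendsto c atTop atTop ∧
    ∀ k : ℕ, Tendsto (fun n => c (n + k) / c n) atTop (𝓝 1)

namespace MarkovShift

section Density

variable {W : Type*} {τ : W → W → Prop} {G ι : Type*} [Group G]

/-- The `n`-th term `t⁻ⁿ cₙ ∑ Rₙ(wx)` over `w ∈ 𝓦ₙ^{A,a}` with `𝔰(w) = g`. -/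
def densityTerm (R : MarkovShift τ → ℝ) (s : W → G) (A a : W) (x : MarkovShift τ)
    (c : ℕ → ℝ) (t : ℝ) (g : G) (n : ℕ) : ℝ :=
  (t ^ n)⁻¹ * c n *
    ∑' w : {w : List W // IsWord τ A a n w ∧ wordProd s w = g}, birkhoffProd R n (prepend w.1 x)

/-- The partial sums `φ^{A,a}_{c;≤N}[t]`. -/
def densityPartial (R : MarkovShift τ → ℝ) (s : W → G) (A a : W) (x : MarkovShift τ)
    (c : ℕ → ℝ) (t : ℝ) (N : ℕ) (g : G) : ℝ :=
  ∑ n ∈ Finset.Icc 1 N, densityTerm R s A a x c t g n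

/-- The thermodynamic `G`-density `φ^{A,a}_c[t]`. -/
def density (R : MarkovShift τ → ℝ) (s : W → G) (A a : W) (x : MarkovShift τ)
    (c : ℕ → ℝ) (t : ℝ) (g : G) : ℝ :=
  ∑' n : ℕ, densityTerm R s A a x c t g (n + 1)

/-- The decay exponent `γ(φ ∗_ρ f)`. -/
def decayExponent (R : MarkovShift τ → ℝ) (s : W → G) (A a : W) (x : MarkovShift τ)
    (H : ι → Subgroup G) (f : QuotSum H) : ℝ :=
  sInf {t : ℝ | 0 < t ∧ BddAbove (range fun N : ℕ =>
    inner ℝ (repConv H (densityPartial R s A a x (fun _ => 1) t N) f)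
      (repConv H (densityPartial R s A a x (fun _ => 1) t N) f))}

/-- The vector `φ_c[t] ∗_ρ f`. -/
def densityVec (R : MarkovShift τ → ℝ) (s : W → G) (A a : W) (x : MarkovShift τ)
    (H : ι → Subgroup G) (f : QuotSum H) (c : ℕ → ℝ) (t : ℝ) : QuotSum H :=
  repConv H (density R s A a x c t) f

/-! ### Twisted measures -/

variable [TopologicalSpace W]

/-- With `Q = φ_c[t] ∗_ρ f`, the weighted sum of Dirac masses
`∑_v t^{-|v|} c_{|v|} R_{|v|}(vx) ⟨ρ(𝔰(v)) f, ρ(g)⁻¹ Q⟩ / ⟨Q, Q⟩ · D(vx)`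
over all admissible words `v` with last letter `a`. -/
def approxMeasure (R : MarkovShift τ → ℝ) (s : W → G) (A a : W) (x : MarkovShift τ)
    (H : ι → Subgroup G) (f : QuotSum H) (c : ℕ → ℝ) (g : G) (t : ℝ) :
    Measure (MarkovShift τ) :=
  Measure.sum fun v : {v : List W // v.IsChain τ ∧ v.getLast? = some a} =>
    ENNReal.ofReal ((t ^ v.1.length)⁻¹ * c v.1.length *
      birkhoffProd R v.1.length (prepend v.1 x) *
      (inner ℝ (quotRep H (wordProd s v.1) f)
          ((quotRep H g)⁻¹ (densityVec R s A a x H f c t)) /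
        inner ℝ (densityVec R s A a x H f c t) (densityVec R s A a x H f c t))) •
    Measure.dirac (prepend v.1 x)

/-- The measure is finite on the cylinders of nonempty words. -/
def FiniteOnCylinders (m : Measure (MarkovShift τ)) : Prop :=
  ∀ w : List W, w ≠ [] → m (cylinder τ w) < ∞

/-- Weak-∗ convergence of measures finite on cylinders: on every one-letter cylinder, integrals of
bounded continuous functions converge. -/
def WeakStarTendsto (m : ℕ → Measure (MarkovShift τ)) (m' : Measure (MarkovShift τ)) : Prop :=
  (∀ k, FiniteOnCylinders (m k)) ∧ FiniteOnCylinders m' ∧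
    ∀ b : W, ∀ F : MarkovShift τ →ᵇ ℝ,
      Tendsto (fun k => ∫ z in cylinder τ [b], F z ∂(m k)) atTop
        (𝓝 (∫ z in cylinder τ [b], F z ∂m'))

/-- `m` is the one-sided twisted measure obtained along `t_k`: the approximating measures converge
for every `g ∈ G`, and `m` is the limit for `g = e`. -/
def IsTwistedLimit (R : MarkovShift τ → ℝ) (s : W → G) (A a : W) (x : MarkovShift τ)
    (H : ι → Subgroup G) (f : QuotSum H) (c : ℕ → ℝ) (t : ℕ → ℝ)
    (m : Measure (MarkovShift τ)) : Prop :=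
  ∃ μ : G → Measure (MarkovShift τ), m = μ 1 ∧
    ∀ g : G, WeakStarTendsto (fun k => approxMeasure R s A a x H f c g (t k)) (μ g)

/-- `(τ^{(w)})_* m`, the push-forward of `m` restricted to `σⁿ[w]` under the inverse branch
`z ↦ wz`. -/
def branchPush (w : List W) (m : Measure (MarkovShift τ)) : Measure (MarkovShift τ) :=
  (m.restrict (shift^[w.length] '' cylinder τ w)).map (prepend w)

/-- `m` is twisted by a generalised multiplicative cocycle `h`, with parameter `γ`: for every
admissible `w` of length `n`, the Radon–Nikodym derivative of `(τ^{(w)})_* m` with respect to `m` on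
`[w]` is `γⁿ Rₙ(z)⁻¹ h(𝔰(w), z)`. -/
def IsTwistedByCocycle (R : MarkovShift τ → ℝ) (s : W → G) (γ : ℝ)
    (m : Measure (MarkovShift τ)) : Prop :=
  ∃ h : G → MarkovShift τ → ℝ, (∀ g, Measurable (h g)) ∧ (∀ g z, 0 ≤ h g z) ∧
    ∀ w : List W, w ≠ [] → w.IsChain τ →
      branchPush w m = (m.restrict (cylinder τ w)).withDensity fun z =>
        ENNReal.ofReal (γ ^ w.length * (birkhoffProd R w.length z)⁻¹ * h (wordProd s w) z)

end Density

end MarkovShift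

end

/-! The construction is Patterson's: the vectors `Q_k` blow up as `t_k` decreases to `γ`, and
normalising by their squared norm produces `Υ` and `ν` together.

By definition of `γ`, the squared norm `pathEnergy` of the unweighted series is infinite for `t <
γ`. A slowly increasing, submultiplicative `c` can be built block by block so that the series
weighted by `c` already diverges at `γ` itself (`exists_isSlowlyIncreasing`). Since `c` grows
subexponentially, `Q_k` is still finite for `t_k > γ`, and `‖Q_k‖ → ∞` for suitable `t_k → γ`
(`exists_isApproxSeq`). By Cauchy–Schwarz the mass of `vx` in `ν^g_k` is at most its weight at `γ`
times `‖f‖ / ‖Q_k‖` (`massWeight_le`). Hence every set of words with summable weights at `γ` is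
invisible in the limit (`IsApproxSeq.tendsto_tsum_massWeight`).

The masses of `[b]` are bounded because a path from `A` to `b`, put in front, compares them with
some `⟨Q, ρ(·)Q⟩ ≤ ⟨Q, Q⟩`. Tightness is free on a compact space. Otherwise, words avoiding `B`
after position `i` have summable weights, because the first returns to `B` decay faster than `γⁿ`.
All other words split at the next `B` as `uv'`, and the total mass over `v'` is at most a constant
times the weight of `u`, which is summable; so finitely many `u` suffice up to `ε`
(`IsWeightSetting.isTightMeasureSet`). Prokhorov's theorem, applied simultaneously for the countably
many pairs of `G × W`, gives limits `μ g`.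

Prepending `w` multiplies the weight of `v` by `t^{-|w|} R_{|w|} c_{|w|+|v|} / c_{|v|}` and moves
the twist from `g` to `g 𝔰(w)`. The ratio of the `c` tends to `1` on long words, and short words
disappear. The limit is `IsWeightSetting.transfer_identity`: `γⁿ ∫_{[wb]} Rₙ⁻¹ φ dμ_g = ∫_{[b]}
φ(wz) dμ_{g𝔰(w)}`. With `φ = 1`, `g = 1`, `b = A` it is the formula for `Υ`, because `μ g [A]` is
the limit of the matrix coefficients at `g`. With `g = 𝔰(w)⁻¹` it expresses the push-forward of `μ
1` through `μ (𝔰(w)⁻¹)`. Under transitivity a loop at `A` with product `g⁻¹` gives `ρ(g)⁻¹ Q_k ≤ C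
Q_k` with `C` independent of `k`, so `μ g ≪ μ 1`, and `h(g, ·)` is the Radon–Nikodym derivative of
`μ g⁻¹`. -/

namespace MarkovShift

/-! ### Words, concatenation and periodic points. -/

section Words

variable {W : Type*} {τ : W → W → Prop}

lemma ext_seq {y z : MarkovShift τ} (h : ∀ i, y.seq i = z.seq i) : y = z := by
  cases y; cases z; congr; exact funext h

lemma shift_iterate_seq (n : ℕ) (z : MarkovShift τ) (i : ℕ) :
    (shift^[n] z).seq i = z.seq (i + n) := by
  induction n generalizing z with
  | zero => rfl
  | succ n ih => rw [Function.iterate_succ_apply, ih]; simp [shift, add_assoc]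

lemma concat_of_lt {w : List W} {z : ℕ → W} {i : ℕ} (h : i < w.length) :
    concat w z i = w[i] := by
  simp [concat, List.getD_eq_getElem?_getD, h]

lemma concat_of_ge {w : List W} {z : ℕ → W} {i : ℕ} (h : w.length ≤ i) :
    concat w z i = z (i - w.length) := by
  simp [concat, List.getD_eq_getElem?_getD, h]

lemma concat_adm {w : List W} {z : MarkovShift τ} (h : (w ++ [z.seq 0]).IsChain τ) (i : ℕ) :
    τ (concat w z.seq i) (concat w z.seq (i + 1)) := by
  rw [List.isChain_iff_getElem] at h
  rcases lt_trichotomy (i + 1) w.length with h1 | h1 | h1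
  · rw [concat_of_lt h1, concat_of_lt (by omega)]
    have := h i (by simp; omega)
    rwa [List.getElem_append_left (by omega), List.getElem_append_left h1] at this
  · rw [concat_of_lt (by omega), concat_of_ge (by omega)]
    have := h i (by simp; omega)
    rw [List.getElem_append_left (by omega), List.getElem_append_right (by omega)] at this
    simpa [h1] using this
  · rw [concat_of_ge (by omega), concat_of_ge (by omega)]
    have := z.adm (i - w.length)
    rwa [show i - w.length + 1 = i + 1 - w.length by omega] at this

lemma prepend_seq {w : List W} {z : MarkovShift τ} (h : (w ++ [z.seq 0]).IsChain τ) (i : ℕ) :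
    (prepend w z).seq i = concat w z.seq i := by
  rw [prepend, dif_pos (concat_adm h)]

lemma prepend_seq_of_lt {w : List W} {z : MarkovShift τ} (h : (w ++ [z.seq 0]).IsChain τ) {i : ℕ}
    (hi : i < w.length) : (prepend w z).seq i = w[i] := by
  rw [prepend_seq h, concat_of_lt hi]

lemma prepend_seq_length_add {w : List W} {z : MarkovShift τ} (h : (w ++ [z.seq 0]).IsChain τ)
    (i : ℕ) : (prepend w z).seq (i + w.length) = z.seq i := by
  rw [prepend_seq h, concat_of_ge (by omega)]; simp

lemma prepend_seq_eq_getElem? {w : List W} {z : MarkovShift τ} (h : (w ++ [z.seq 0]).IsChain τ)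
    {i : ℕ} (hi : i ≤ w.length) : (w ++ [z.seq 0])[i]? = some ((prepend w z).seq i) := by
  rcases hi.lt_or_eq with hi | rfl
  · rw [prepend_seq_of_lt h hi, List.getElem?_append_left hi]; simp
  · have := prepend_seq_length_add h 0
    rw [zero_add] at this
    simp [this]

lemma prepend_seq_zero {w : List W} {z : MarkovShift τ} (h : (w ++ [z.seq 0]).IsChain τ) :
    (w ++ [z.seq 0]).head? = some ((prepend w z).seq 0) := by
  rw [← prepend_seq_eq_getElem? h (Nat.zero_le _), List.head?_eq_getElem?]

lemma shift_iterate_prepend {w : List W} {z : MarkovShift τ} (h : (w ++ [z.seq 0]).IsChain τ) :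
    shift^[w.length] (prepend w z) = z :=
  ext_seq fun i => by rw [shift_iterate_seq, prepend_seq_length_add h]

lemma isChain_append_singleton_of_append {u v : List W} {b d : W}
    (h : (u ++ v ++ [d]).IsChain τ) (hb : (v ++ [d]).head? = some b) :
    (u ++ [b]).IsChain τ ∧ (v ++ [d]).IsChain τ := by
  rw [List.append_assoc, List.isChain_append] at h
  refine ⟨?_, h.2.1⟩
  rw [List.isChain_append]
  refine ⟨h.1, List.isChain_singleton _, fun y hy z hz => h.2.2 y hy z ?_⟩
  simp at hz; subst hz; simpa using hb

lemma isChain_append_append {u v : List W} {b d : W} (hb : (v ++ [d]).head? = some b)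
    (hu : (u ++ [b]).IsChain τ) (hv : (v ++ [d]).IsChain τ) : (u ++ v ++ [d]).IsChain τ := by
  rw [List.isChain_append] at hu
  rw [List.append_assoc, List.isChain_append]
  refine ⟨hu.1, hv, fun y hy z hz => hu.2.2 y hy z ?_⟩
  rw [hb] at hz; simpa using hz

lemma prepend_append {u v : List W} {z : MarkovShift τ} (h : (u ++ v ++ [z.seq 0]).IsChain τ) :
    prepend (u ++ v) z = prepend u (prepend v z) := by
  have hv : (v ++ [z.seq 0]).IsChain τ := by
    rw [List.append_assoc, List.isChain_append] at h; exact h.2.1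
  have hu := (isChain_append_singleton_of_append h (prepend_seq_zero hv)).1
  refine ext_seq fun i => ?_
  rw [prepend_seq h, prepend_seq hu]
  rcases lt_or_ge i u.length with h1 | h1
  · rw [concat_of_lt (by simp; omega), concat_of_lt h1, List.getElem_append_left h1]
  · rw [concat_of_ge h1, prepend_seq hv]
    rcases lt_or_ge i (u ++ v).length with h2 | h2
    · rw [concat_of_lt h2, concat_of_lt (by simp at h2; omega), List.getElem_append_right h1]
    · rw [concat_of_ge h2, concat_of_ge (by simp at h2; omega)]
      congr 1; simp; omega

lemma birkhoffProd_pos {R : MarkovShift τ → ℝ} (hR : ∀ z, 0 < R z) (n : ℕ) (z : MarkovShift τ) :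
    0 < birkhoffProd R n z := Finset.prod_pos fun _ _ => hR _

lemma birkhoffProd_add (R : MarkovShift τ → ℝ) (m n : ℕ) (z : MarkovShift τ) :
    birkhoffProd R (m + n) z = birkhoffProd R m z * birkhoffProd R n (shift^[m] z) := by
  simp only [birkhoffProd, Finset.prod_range_add]
  congr 1
  refine Finset.prod_congr rfl fun i _ => ?_
  rw [add_comm, Function.iterate_add_apply]

lemma mem_cylinder_iff {w : List W} {z : MarkovShift τ} :
    z ∈ cylinder τ w ↔ ∀ i (h : i < w.length), z.seq i = w[i] := by
  refine ⟨fun h i hi => h i _ (by simp [hi]), fun h i b hb => ?_⟩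
  obtain ⟨hi, rfl⟩ := List.getElem?_eq_some_iff.1 hb
  exact h i hi

lemma mem_cylinder_singleton {b : W} {z : MarkovShift τ} : z ∈ cylinder τ [b] ↔ z.seq 0 = b := by
  simp [mem_cylinder_iff]

/-- The initial word of length `n` of a point. -/
def initWord (z : MarkovShift τ) (n : ℕ) : List W := (List.range n).map z.seq

@[simp] lemma length_initWord (z : MarkovShift τ) (n : ℕ) : (initWord z n).length = n := by
  simp [initWord]

lemma initWord_append (z : MarkovShift τ) (n : ℕ) :
    initWord z n ++ [z.seq n] = initWord z (n + 1) := by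
  simp [initWord, List.range_succ]

lemma isChain_initWord (z : MarkovShift τ) (n : ℕ) : (initWord z n).IsChain τ := by
  rw [List.isChain_iff_getElem]
  intro i hi
  simpa [initWord] using z.adm i

lemma head?_initWord_succ (z : MarkovShift τ) (n : ℕ) :
    (initWord z (n + 1)).head? = some (z.seq 0) := by
  simp [initWord, List.head?_eq_getElem?]

/-- Paths are recorded without their end point: `e` can be put in front of anything that starts with
`d`, and its length is the number of steps. -/
lemma IsMixing.exists_path (hmix : IsMixing τ) (b d : W) (N : ℕ) :
    ∃ e : List W, N ≤ e.length ∧ (e ++ [d]).IsChain τ ∧ (e ++ [d]).head? = some b := by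
  obtain ⟨N₀, h⟩ := hmix b d
  obtain ⟨z, hz, hz'⟩ := h (max N N₀) (le_max_right _ _)
  refine ⟨initWord z (max N N₀), by simp, ?_⟩
  rw [← hz', initWord_append, ← hz]
  exact ⟨isChain_initWord _ _, head?_initWord_succ _ _⟩

/-- Cut a path at its first visit to `d`. -/
lemma IsMixing.exists_path_avoiding (hmix : IsMixing τ) (b d : W) :
    ∃ e : List W, d ∉ e ∧ (e ++ [d]).IsChain τ ∧ (e ++ [d]).head? = some b := by
  classical
  obtain ⟨N₀, h⟩ := hmix b d
  obtain ⟨z, hz, hz'⟩ := h N₀ le_rfl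
  obtain ⟨m, hm, hmin⟩ : ∃ m, z.seq m = d ∧ ∀ i < m, z.seq i ≠ d :=
    have hex : ∃ n, z.seq n = d := ⟨_, hz'⟩
    ⟨Nat.find hex, Nat.find_spec hex, fun i hi => Nat.find_min hex hi⟩
  refine ⟨initWord z m, ?_, ?_⟩
  · intro hd
    simp only [initWord, List.mem_map, List.mem_range] at hd
    obtain ⟨i, hi, hid⟩ := hd
    exact hmin i hi hid
  · rw [← hm, initWord_append, ← hz]
    exact ⟨isChain_initWord _ _, head?_initWord_succ _ _⟩

lemma IsMixing.exists_seq_zero_eq (hmix : IsMixing τ) (b : W) : ∃ z : MarkovShift τ, z.seq 0 = b :=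
  let ⟨_, h⟩ := hmix b b
  let ⟨z, hz, _⟩ := h _ le_rfl
  ⟨z, hz⟩

/-- The periodic point spelled by an admissible loop. -/
lemma exists_periodic {w : List W} {b : W} (hb : w.head? = some b)
    (hw : (w ++ [b]).IsChain τ) :
    ∃ z : MarkovShift τ, shift^[w.length] z = z ∧ z.seq 0 = b ∧
      ∀ i, i ≤ w.length → (w ++ [b])[i]? = some (z.seq i) := by
  have hne : w ≠ [] := by rintro rfl; simp at hb
  have hl : 0 < w.length := List.length_pos_iff.2 hne
  have hw0 : w[0] = b := by simpa [List.head?_eq_getElem?, hl] using hb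
  have hmod : ∀ i, i % w.length < w.length := fun i => Nat.mod_lt _ hl
  rw [List.isChain_iff_getElem] at hw
  have hadm : ∀ i, τ (w[i % w.length]'(hmod i)) (w[(i + 1) % w.length]'(hmod _)) := by
    intro i
    have h := hw (i % w.length) (by simpa using hmod i)
    rw [List.getElem_append_left (hmod i)] at h
    -- Only the last letter of the period is special: its successor wraps round to the first letter
    -- `b`, the transition supplied by the closing `[b]`.
    rcases (Nat.succ_le_of_lt (hmod i)).lt_or_eq with h1 | h1
    · rw [List.getElem_append_left h1] at h
      have e : (i + 1) % w.length = i % w.length + 1 := by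
        rw [Nat.add_mod, Nat.mod_eq_of_lt (a := 1) (by omega), Nat.mod_eq_of_lt h1]
      simpa [e] using h
    · rw [List.getElem_append_right (by omega)] at h
      have e : (i + 1) % w.length = 0 := by
        rw [← Nat.mod_add_mod]
        have : i % w.length + 1 = w.length := h1
        rw [this, Nat.mod_self]
      simpa [e, hw0] using h
  refine ⟨⟨fun i => w[i % w.length]'(hmod i), hadm⟩, ?_, ?_, ?_⟩
  · refine ext_seq fun i => ?_
    rw [shift_iterate_seq]
    simp
  · simpa using hw0
  · intro i hi
    rcases hi.lt_or_eq with hi | rfl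
    · rw [List.getElem?_append_left hi]
      simp [Nat.mod_eq_of_lt hi]
    · simp [hw0]

end Words

/-! ### Bounded distortion and almost multiplicativity of word weights. -/

section Distortion

variable {W : Type*} {τ : W → W → Prop} {R : MarkovShift τ → ℝ}

/-- Bounded distortion. -/
def BoundedDistortion (R : MarkovShift τ → ℝ) (K : ℝ) : Prop :=
  ∀ (n : ℕ) (y z : MarkovShift τ), (∀ i ≤ n, y.seq i = z.seq i) →
    birkhoffProd R n y ≤ K * birkhoffProd R n z

/-- The variations of the successive factors form a geometric series. Agreement on `n + 1` letters,
one more than the number of factors, leaves the last factor with two common letters, the least for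
which the Hölder bound is assumed. -/
lemma IsLocallyHolder.exists_boundedDistortion (hR : IsLocallyHolder R) (hpos : ∀ z, 0 < R z) :
    ∃ K, 1 ≤ K ∧ BoundedDistortion R K := by
  obtain ⟨C, θ, h0, h1, hC⟩ := hR
  have key : ∀ (n : ℕ) (y z : MarkovShift τ), (∀ i ≤ n, y.seq i = z.seq i) →
      birkhoffProd R n y ≤
        Real.exp (|C| * ∑ j ∈ Finset.range n, θ ^ j) * birkhoffProd R n z := by
    intro n
    induction n with
    | zero => intro y z _; simp [birkhoffProd]
    | succ n ih =>
      intro y z hyz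
      rw [add_comm n 1, birkhoffProd_add, birkhoffProd_add, add_comm 1 n, Finset.sum_range_succ,
        mul_add, Real.exp_add]
      have i1 := ih (shift y) (shift z) fun i hi => hyz (i + 1) (by omega)
      have i2 : birkhoffProd R 1 y ≤ Real.exp (|C| * θ ^ n) * birkhoffProd R 1 z := by
        simp only [birkhoffProd, Finset.prod_range_one, Function.iterate_zero, id]
        have := hC (n + 2) (by omega) y z fun i hi => hyz i (by omega)
        have h3 : Real.log (R y) ≤ |C| * θ ^ n + Real.log (R z) := by
          have h4 : C * θ ^ (n + 2) ≤ |C| * θ ^ n :=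
            mul_le_mul (le_abs_self _) (pow_le_pow_of_le_one h0.le h1.le (by omega))
              (by positivity) (abs_nonneg _)
          linarith [(abs_le.1 this).2]
        have h5 := Real.exp_le_exp.2 h3
        rwa [Real.exp_add, Real.exp_log (hpos _), Real.exp_log (hpos _)] at h5
      have := mul_le_mul i2 i1 (birkhoffProd_pos hpos _ _).le
        (mul_nonneg (Real.exp_pos _).le (birkhoffProd_pos hpos _ _).le)
      refine this.trans (le_of_eq ?_)
      simp only [Function.iterate_one]
      ring
  refine ⟨Real.exp (|C| * (1 - θ)⁻¹), Real.one_le_exp (by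
    have : 0 < 1 - θ := by linarith
    positivity), fun n y z h => (key n y z h).trans ?_⟩
  refine mul_le_mul_of_nonneg_right (Real.exp_le_exp.2 ?_) (birkhoffProd_pos hpos _ _).le
  refine mul_le_mul_of_nonneg_left ?_ (abs_nonneg _)
  rw [← tsum_geometric_of_lt_one h0.le h1]
  exact (summable_geometric_of_lt_one h0.le h1).sum_le_tsum _ fun i _ => by positivity

open Classical in
/-- The weight `R_{|v|}(vz)` of a word, zero if `vz` is not admissible. -/
noncomputable def wordWeight (R : MarkovShift τ → ℝ) (z : MarkovShift τ) (v : List W) : ℝ≥0∞ :=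
  if (v ++ [z.seq 0]).IsChain τ then ENNReal.ofReal (birkhoffProd R v.length (prepend v z)) else 0

lemma wordWeight_of_isChain {z : MarkovShift τ} {v : List W} (h : (v ++ [z.seq 0]).IsChain τ) :
    wordWeight R z v = ENNReal.ofReal (birkhoffProd R v.length (prepend v z)) := if_pos h

lemma wordWeight_of_not_isChain {z : MarkovShift τ} {v : List W}
    (h : ¬ (v ++ [z.seq 0]).IsChain τ) : wordWeight R z v = 0 := if_neg h

lemma wordWeight_ne_top (z : MarkovShift τ) (v : List W) : wordWeight R z v ≠ ∞ := by
  unfold wordWeight; split_ifs <;> simp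

lemma wordWeight_pos (hpos : ∀ z, 0 < R z) {z : MarkovShift τ} {v : List W}
    (h : (v ++ [z.seq 0]).IsChain τ) : 0 < wordWeight R z v := by
  rw [wordWeight_of_isChain h]; simpa using birkhoffProd_pos hpos _ _

lemma seq_eq_of_prefix {u : List W} {y z : MarkovShift τ} (hy : (u ++ [y.seq 0]).IsChain τ)
    (hz : (u ++ [z.seq 0]).IsChain τ) (h : y.seq 0 = z.seq 0) (i : ℕ) (hi : i ≤ u.length) :
    (prepend u y).seq i = (prepend u z).seq i := by
  have h1 := prepend_seq_eq_getElem? hy hi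
  have h2 := prepend_seq_eq_getElem? hz hi
  rw [h, h2] at h1
  simpa using h1.symm

/-- The cocycle identity splits the product over `uvz` into one over `u` and one over `v`. The
points `uvz` and `uy` share `|u| + 1` letters, so the first factor may be evaluated at any `y` with
the right first letter. -/
lemma BoundedDistortion.wordWeight_append_le {K : ℝ} (hK : BoundedDistortion R K) (hK1 : 1 ≤ K)
    (hpos : ∀ z, 0 < R z) {y z : MarkovShift τ} {u v : List W}
    (h : (v ++ [z.seq 0]).head? = some (y.seq 0)) :
    wordWeight R z (u ++ v) ≤ ENNReal.ofReal K * (wordWeight R y u * wordWeight R z v) := by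
  by_cases hc : (u ++ v ++ [z.seq 0]).IsChain τ
  · obtain ⟨hu, hv⟩ := isChain_append_singleton_of_append hc h
    rw [wordWeight_of_isChain hc, wordWeight_of_isChain hu, wordWeight_of_isChain hv,
      ← ENNReal.ofReal_mul (birkhoffProd_pos hpos _ _).le, ← ENNReal.ofReal_mul (by linarith)]
    refine ENNReal.ofReal_le_ofReal ?_
    have h0 := prepend_seq_zero hv
    rw [h] at h0
    have h0 : y.seq 0 = (prepend v z).seq 0 := by simpa using h0
    have hu' : (u ++ [(prepend v z).seq 0]).IsChain τ := h0 ▸ hu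
    rw [List.length_append, birkhoffProd_add, prepend_append hc, shift_iterate_prepend hu',
      ← mul_assoc]
    refine mul_le_mul_of_nonneg_right (hK _ _ _ ?_) (birkhoffProd_pos hpos _ _).le
    exact seq_eq_of_prefix hu' hu h0.symm
  · rw [wordWeight_of_not_isChain hc]; exact zero_le

/-- The same comparison with the two points exchanged; admissible pieces glue to an admissible word.
-/
lemma BoundedDistortion.wordWeight_mul_le {K : ℝ} (hK : BoundedDistortion R K) (hK1 : 1 ≤ K)
    (hpos : ∀ z, 0 < R z) {y z : MarkovShift τ} {u v : List W}
    (h : (v ++ [z.seq 0]).head? = some (y.seq 0)) :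
    wordWeight R y u * wordWeight R z v ≤ ENNReal.ofReal K * wordWeight R z (u ++ v) := by
  by_cases hu : (u ++ [y.seq 0]).IsChain τ
  swap
  · rw [wordWeight_of_not_isChain hu]; simp
  by_cases hv : (v ++ [z.seq 0]).IsChain τ
  swap
  · rw [wordWeight_of_not_isChain hv]; simp
  have hc := isChain_append_append h hu hv
  rw [wordWeight_of_isChain hc, wordWeight_of_isChain hu, wordWeight_of_isChain hv,
    ← ENNReal.ofReal_mul (birkhoffProd_pos hpos _ _).le, ← ENNReal.ofReal_mul (by linarith)]
  refine ENNReal.ofReal_le_ofReal ?_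
  have h0 := prepend_seq_zero hv
  rw [h] at h0
  have h0 : y.seq 0 = (prepend v z).seq 0 := by simpa using h0
  have hu' : (u ++ [(prepend v z).seq 0]).IsChain τ := h0 ▸ hu
  rw [List.length_append, birkhoffProd_add, prepend_append hc, shift_iterate_prepend hu',
    ← mul_assoc]
  refine mul_le_mul_of_nonneg_right (hK _ _ _ ?_) (birkhoffProd_pos hpos _ _).le
  exact seq_eq_of_prefix hu hu' h0

/-- The weight of a loop is comparable to the Birkhoff product of its periodic point. -/
lemma BoundedDistortion.exists_periodic_wordWeight_le {K : ℝ} (hK : BoundedDistortion R K)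
    (hK1 : 1 ≤ K) {z : MarkovShift τ} {w : List W} (hb : w.head? = some (z.seq 0))
    (hw : (w ++ [z.seq 0]).IsChain τ) :
    ∃ p : MarkovShift τ, shift^[w.length] p = p ∧ p.seq 0 = z.seq 0 ∧
      (∀ i (h : i < w.length), p.seq i = w[i]) ∧
      wordWeight R z w ≤ ENNReal.ofReal K * ENNReal.ofReal (birkhoffProd R w.length p) := by
  obtain ⟨p, h1, h2, h3⟩ := exists_periodic hb hw
  refine ⟨p, h1, h2, fun i hi => ?_, ?_⟩
  · have := h3 i hi.le
    rw [List.getElem?_append_left hi] at this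
    simpa [hi] using this.symm
  · rw [wordWeight_of_isChain hw, ← ENNReal.ofReal_mul (by linarith)]
    refine ENNReal.ofReal_le_ofReal (hK _ _ _ fun i hi => ?_)
    have e1 := prepend_seq_eq_getElem? hw hi
    rw [h3 i hi] at e1
    simpa using e1.symm

end Distortion

end MarkovShift

/-! ### Comparison of sums along injective correspondences. -/

section TsumComparison

/-- A relation in which each `p` determines `v` yields an injection by choice. This lets words be
matched with periodic points or with pairs of words without an explicit inverse, and only terms `f v
≠ 0` have to be matched. -/
lemma ENNReal.tsum_le_mul_tsum_of_rel {α β : Type*} {S : Set α} {f : α → ℝ≥0∞} {g : β → ℝ≥0∞}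
    {C : ℝ≥0∞} (rel : α → β → Prop)
    (h : ∀ v ∈ S, f v ≠ 0 → ∃ p, rel v p ∧ f v ≤ C * g p)
    (hinj : ∀ v ∈ S, ∀ v' ∈ S, ∀ p, rel v p → rel v' p → v = v') :
    ∑' v : S, f v ≤ C * ∑' p, g p := by
  have h' : ∀ v : {v : S // f v ≠ 0}, ∃ p, rel v.1 p ∧ f v.1 ≤ C * g p :=
    fun v => h v.1.1 v.1.2 v.2
  choose φ hφ hφ' using h'
  have hi : Function.Injective φ := fun v v' hv =>
    Subtype.ext (Subtype.ext (hinj _ v.1.2 _ v'.1.2 (φ v) (hφ v) (hv ▸ hφ v')))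
  calc ∑' v : S, f v = ∑' v : {v : S // f v ≠ 0}, f v.1 :=
        (tsum_subtype_eq_of_support_subset (f := fun v : S => f v) (s := {v : S | f v ≠ 0})
          (fun v hv => hv)).symm
    _ ≤ ∑' v, C * g (φ v) := ENNReal.tsum_le_tsum hφ'
    _ = C * ∑' v, g (φ v) := ENNReal.tsum_mul_left
    _ ≤ C * ∑' p, g p := by gcongr; exact ENNReal.tsum_comp_le_tsum_of_injective hi g

lemma ENNReal.tsum_le_mul_tsum_of_injOn {α β : Type*} {S : Set α} {T : Set β} {f : α → ℝ≥0∞}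
    {g : β → ℝ≥0∞} {C : ℝ≥0∞} (φ : α → β) (hφ : InjOn φ S)
    (h : ∀ v ∈ S, f v ≠ 0 → φ v ∈ T ∧ f v ≤ C * g (φ v)) :
    ∑' v : S, f v ≤ C * ∑' p : T, g p := by
  refine tsum_le_mul_tsum_of_rel (g := fun p : T => g p) (fun v p => φ v = p)
    (fun v hv hf => ⟨⟨φ v, (h v hv hf).1⟩, rfl, (h v hv hf).2⟩) ?_
  intro v hv v' hv' p h1 h2
  exact hφ hv hv' (h1.trans h2.symm)

end TsumComparison

namespace MarkovShift

/-! ### Sums over words against sums over periodic points. -/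

section WordSums

variable {W : Type*} {τ : W → W → Prop} {R : MarkovShift τ → ℝ}

/-- The words of length `n` with first letter `b`. -/
def wordsFrom (b : W) (n : ℕ) : Set (List W) := {v | v.head? = some b ∧ v.length = n}

/-- The words whose only occurrence of `B` is the first letter. -/
def returnWords (B : W) : Set (List W) := {v | v.head? = some B ∧ B ∉ v.tail}

/-- A word from `z₀` of nonzero weight can be followed by `z₀`, so it closes up to a periodic point;
the first `n` letters of that point recover the word. -/
lemma BoundedDistortion.tsum_wordsFrom_le_periodicSum {K : ℝ} (hK : BoundedDistortion R K)
    (hK1 : 1 ≤ K) (z : MarkovShift τ) (n : ℕ) :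
    ∑' v : wordsFrom (z.seq 0) n, wordWeight R z v ≤
      ENNReal.ofReal K * periodicSum R (z.seq 0) n := by
  refine ENNReal.tsum_le_mul_tsum_of_rel
    (fun v p => ∀ i (h : i < v.length), p.1.seq i = v[i]) ?_ ?_
  · rintro v ⟨hv, rfl⟩ h
    have hc : (v ++ [z.seq 0]).IsChain τ := by
      by_contra hc; exact h (wordWeight_of_not_isChain hc)
    obtain ⟨p, h1, h2, h3, h4⟩ := hK.exists_periodic_wordWeight_le hK1 hv hc
    exact ⟨⟨p, h1, h2⟩, h3, h4⟩
  · rintro v ⟨-, hv⟩ v' ⟨-, hv'⟩ p h1 h2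
    exact List.ext_getElem (hv.trans hv'.symm) fun i hi hi' => (h1 i hi).symm.trans (h2 i hi')

/-- The same closing-up; absence of `z₀` from the tail of the word makes `n` the first return time.
-/
lemma BoundedDistortion.tsum_returnWords_le_firstReturnSum {K : ℝ} (hK : BoundedDistortion R K)
    (hK1 : 1 ≤ K) (z : MarkovShift τ) (n : ℕ) :
    ∑' v : {v | v ∈ returnWords (z.seq 0) ∧ v.length = n}, wordWeight R z v ≤
      ENNReal.ofReal K * firstReturnSum R (z.seq 0) n := by
  refine ENNReal.tsum_le_mul_tsum_of_rel
    (fun v p => ∀ i (h : i < v.length), p.1.seq i = v[i]) ?_ ?_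
  · rintro v ⟨⟨hv, hv'⟩, rfl⟩ h
    have hc : (v ++ [z.seq 0]).IsChain τ := by
      by_contra hc; exact h (wordWeight_of_not_isChain hc)
    obtain ⟨p, h1, h2, h3, h4⟩ := hK.exists_periodic_wordWeight_le hK1 hv hc
    refine ⟨⟨p, h1, h2, fun i hi0 hi => ?_⟩, h3, h4⟩
    rw [h3 i hi]
    intro he
    refine hv' (he ▸ ?_)
    have : v[i] = v.tail[i - 1]'(by simp; omega) := by
      rw [List.getElem_tail]; congr 1; omega
    rw [this]
    exact List.getElem_mem _
  · rintro v ⟨-, hv⟩ v' ⟨-, hv'⟩ p h1 h2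
    exact List.ext_getElem (hv.trans hv'.symm) fun i hi hi' => (h1 i hi).symm.trans (h2 i hi')

/-- Appending a fixed admissible word changes the weights by a bounded factor. -/
lemma BoundedDistortion.wordWeight_le_append {K : ℝ} (hK : BoundedDistortion R K)
    (hK1 : 1 ≤ K) (hpos : ∀ z, 0 < R z) {y z : MarkovShift τ} {e : List W}
    (he : (e ++ [y.seq 0]).IsChain τ) (hz : (e ++ [y.seq 0]).head? = some (z.seq 0))
    (v : List W) :
    wordWeight R z v ≤ (ENNReal.ofReal K / wordWeight R y e) * wordWeight R y (v ++ e) := by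
  have h := hK.wordWeight_mul_le hK1 hpos (u := v) hz
  have h0 := wordWeight_pos hpos he
  rw [← ENNReal.mul_div_right_comm, ENNReal.le_div_iff_mul_le (Or.inl h0.ne')
    (Or.inl (wordWeight_ne_top _ _))]
  exact h

/-- Prepending a fixed admissible word changes the weights by a bounded factor. -/
lemma BoundedDistortion.wordWeight_le_prepend {K : ℝ} (hK : BoundedDistortion R K)
    (hK1 : 1 ≤ K) (hpos : ∀ z, 0 < R z) {y z : MarkovShift τ} {p v : List W}
    (hp : (p ++ [y.seq 0]).IsChain τ) (hv : (v ++ [z.seq 0]).head? = some (y.seq 0)) :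
    wordWeight R z v ≤ (ENNReal.ofReal K / wordWeight R y p) * wordWeight R z (p ++ v) := by
  have h := hK.wordWeight_mul_le hK1 hpos (u := p) hv
  have h0 := wordWeight_pos hpos hp
  rw [← ENNReal.mul_div_right_comm, ENNReal.le_div_iff_mul_le (Or.inl h0.ne')
    (Or.inl (wordWeight_ne_top _ _)), mul_comm]
  exact h

lemma div_wordWeight_ne_top (hpos : ∀ z, 0 < R z) {y : MarkovShift τ} {e : List W}
    (he : (e ++ [y.seq 0]).IsChain τ) (K : ℝ) : ENNReal.ofReal K / wordWeight R y e ≠ ∞ :=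
  ENNReal.div_ne_top ENNReal.ofReal_ne_top (wordWeight_pos hpos he).ne'

lemma head?_append_of_head? {v e : List W} {b : W} (h : v.head? = some b) :
    (v ++ e).head? = some b := by
  cases v with
  | nil => simp at h
  | cons d v => simpa using h

/-- The weights of the words of a given length from a given letter have bounded sums. -/
lemma exists_tsum_wordsFrom_le (hmix : IsMixing τ) (hpos : ∀ z, 0 < R z) {K : ℝ}
    (hK : BoundedDistortion R K) (hK1 : 1 ≤ K) (hrec : IsPositiveRecurrent R)
    (b : W) (z : MarkovShift τ) :
    ∃ M : ℝ≥0∞, M ≠ ∞ ∧ ∀ n, ∑' v : wordsFrom b n, wordWeight R z v ≤ M := by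
  obtain ⟨M, hM, hev⟩ := hrec b
  obtain ⟨N, hN⟩ := eventually_atTop.1 hev
  obtain ⟨y, rfl⟩ := hmix.exists_seq_zero_eq b
  -- The path both closes the words to loops at `b` and has length at least `N`, so the recurrence
  -- bound, valid only for large lengths, covers every `n`.
  obtain ⟨e, heN, he, hez⟩ := hmix.exists_path (z.seq 0) (y.seq 0) N
  refine ⟨(ENNReal.ofReal K / wordWeight R y e) * (ENNReal.ofReal K * ENNReal.ofReal M),
    ENNReal.mul_ne_top (div_wordWeight_ne_top hpos he K)
      (ENNReal.mul_ne_top ENNReal.ofReal_ne_top ENNReal.ofReal_ne_top), fun n => ?_⟩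
  calc ∑' v : wordsFrom (y.seq 0) n, wordWeight R z v
      ≤ (ENNReal.ofReal K / wordWeight R y e) *
          ∑' v : wordsFrom (y.seq 0) (n + e.length), wordWeight R y v := by
        refine ENNReal.tsum_le_mul_tsum_of_injOn (fun v => v ++ e)
          (fun v _ v' _ h => List.append_cancel_right h) ?_
        rintro v ⟨hv, rfl⟩ -
        exact ⟨⟨head?_append_of_head? hv, by simp⟩, hK.wordWeight_le_append hK1 hpos he hez v⟩
    _ ≤ _ := by
        gcongr
        refine (hK.tsum_wordsFrom_le_periodicSum hK1 y _).trans ?_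
        gcongr
        exact (hN _ (by omega)).2

end WordSums

end MarkovShift

/-! ### Convolution with positive weights on the Hilbert sum, computed in `[0, ∞]`. -/

section PositiveVectors

variable {G ι : Type*} [Group G] {H : ι → Subgroup G}

@[simp] lemma quotRep_apply_apply (g : G) (f : QuotSum H) (y : Σ j : ι, G ⧸ H j) :
    quotRep H g f y = f (g⁻¹ • y) := rfl

lemma quotRep_mul_apply (g h : G) (f : QuotSum H) :
    quotRep H (g * h) f = quotRep H g (quotRep H h f) := by rw [map_mul]; rfl

lemma quotRep_inv_apply (g : G) (f : QuotSum H) : (quotRep H g)⁻¹ f = quotRep H g⁻¹ f := by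
  rw [map_inv]

lemma inner_quotRep_left (g : G) (f₁ f₂ : QuotSum H) :
    inner ℝ (quotRep H g f₁) f₂ = inner ℝ f₁ (quotRep H g⁻¹ f₂) := by
  rw [← (quotRep H g⁻¹).inner_map_map, ← quotRep_mul_apply]
  simp

lemma ofReal_inner_eq_tsum {f₁ f₂ : QuotSum H} (h₁ : ∀ y, 0 ≤ f₁ y) (h₂ : ∀ y, 0 ≤ f₂ y) :
    ENNReal.ofReal (inner ℝ f₁ f₂) = ∑' y, ENNReal.ofReal (f₁ y) * ENNReal.ofReal (f₂ y) := by
  rw [lp.inner_eq_tsum, ENNReal.ofReal_tsum_of_nonneg]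
  · refine tsum_congr fun y => ?_
    rw [← ENNReal.ofReal_mul (h₁ y)]
    simp [mul_comm]
  · intro y; simpa using mul_nonneg (h₂ y) (h₁ y)
  · exact lp.summable_inner f₁ f₂

lemma inner_nonneg_of_nonneg {f₁ f₂ : QuotSum H} (h₁ : ∀ y, 0 ≤ f₁ y) (h₂ : ∀ y, 0 ≤ f₂ y) :
    0 ≤ inner ℝ f₁ f₂ := by
  rw [lp.inner_eq_tsum]
  exact tsum_nonneg fun y => by simpa using mul_nonneg (h₂ y) (h₁ y)

lemma inner_quotRep_quotRep_le (g h : G) (f : QuotSum H) :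
    inner ℝ (quotRep H g f) (quotRep H h f) ≤ inner ℝ f f := by
  refine (real_inner_le_norm _ _).trans ?_
  rw [LinearIsometryEquiv.norm_map, LinearIsometryEquiv.norm_map, real_inner_self_eq_norm_mul_norm]

/-- The square of the `ℓ²` norm of a non-negative function. -/
noncomputable def energy {Y : Type*} (q : Y → ℝ≥0∞) : ℝ≥0∞ := ∑' y, q y ^ 2

lemma energy_mono {Y : Type*} {q q' : Y → ℝ≥0∞} (h : ∀ y, q y ≤ q' y) : energy q ≤ energy q' :=
  ENNReal.tsum_le_tsum fun y => by gcongr; exact h y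

lemma energy_const_mul {Y : Type*} (C : ℝ≥0∞) (q : Y → ℝ≥0∞) :
    energy (fun y => C * q y) = C ^ 2 * energy q := by
  simp only [energy, mul_pow, ENNReal.tsum_mul_left]

lemma energy_add_le {Y : Type*} (q q' : Y → ℝ≥0∞) :
    energy (fun y => q y + q' y) ≤ 2 * energy q + 2 * energy q' := by
  simp only [energy]
  rw [← ENNReal.tsum_mul_left, ← ENNReal.tsum_mul_left, ← ENNReal.tsum_add]
  refine ENNReal.tsum_le_tsum fun y => ?_
  have := ENNReal.rpow_add_le_mul_rpow_add_rpow (q y) (q' y) (p := 2) (by norm_num)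
  norm_num at this
  rwa [mul_add] at this

/-- Monotone convergence: squares and sums commute with increasing suprema. -/
lemma energy_iSup {Y : Type*} {q : ℕ → Y → ℝ≥0∞} (hq : Monotone q) :
    energy (fun y => ⨆ n, q n y) = ⨆ n, energy (q n) := by
  simp only [energy]
  have h : ∀ y, (⨆ n, q n y) ^ 2 = ⨆ n, q n y ^ 2 := fun y => by
    have h2 := (ENNReal.orderIsoRpow 2 (by norm_num)).map_iSup (fun n => q n y)
    simp only [ENNReal.orderIsoRpow_apply] at h2
    simpa only [← ENNReal.rpow_natCast, Nat.cast_ofNat] using h2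
  simp only [h]
  refine (le_antisymm ?_ ?_)
  · rw [ENNReal.tsum_eq_iSup_sum]
    refine iSup_le fun S => ?_
    rw [ENNReal.finsetSum_iSup_of_monotone]
    · exact iSup_mono fun n => ENNReal.sum_le_tsum _
    · intro y m n hmn
      dsimp only
      gcongr
      exact hq hmn y
  · exact iSup_le fun n => ENNReal.tsum_le_tsum fun y => le_iSup (fun n => q n y ^ 2) n

lemma apply_ne_top_of_energy_ne_top {Y : Type*} {q : Y → ℝ≥0∞} (h : energy q ≠ ∞) (y : Y) :
    q y ≠ ∞ := by
  have := ENNReal.ne_top_of_tsum_ne_top h y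
  intro h'
  simp [h'] at this

lemma ofReal_inner_self {f : QuotSum H} (h : ∀ y, 0 ≤ f y) :
    ENNReal.ofReal (inner ℝ f f) = energy fun y => ENNReal.ofReal (f y) := by
  simp only [ofReal_inner_eq_tsum h h, energy, sq]

variable {V : Type*} {p : V → G} {f : QuotSum H}

/-- The function `∑ ω(v) ρ(p v) f`, with values in `[0, ∞]`. -/
noncomputable def weightedSum (p : V → G) (f : QuotSum H) (ω : V → ℝ≥0∞)
    (y : Σ j : ι, G ⧸ H j) : ℝ≥0∞ :=
  ∑' v, ω v * ENNReal.ofReal (quotRep H (p v) f y)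

lemma weightedSum_mono {ω ω' : V → ℝ≥0∞} (h : ∀ v, ω v ≤ ω' v) (y : Σ j : ι, G ⧸ H j) :
    weightedSum p f ω y ≤ weightedSum p f ω' y :=
  ENNReal.tsum_le_tsum fun v => by gcongr; exact h v

lemma weightedSum_const_mul (C : ℝ≥0∞) (ω : V → ℝ≥0∞) (y : Σ j : ι, G ⧸ H j) :
    weightedSum p f (fun v => C * ω v) y = C * weightedSum p f ω y := by
  simp only [weightedSum, mul_assoc, ENNReal.tsum_mul_left]

lemma weightedSum_add (ω ω' : V → ℝ≥0∞) (y : Σ j : ι, G ⧸ H j) :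
    weightedSum p f (fun v => ω v + ω' v) y = weightedSum p f ω y + weightedSum p f ω' y := by
  simp only [weightedSum, add_mul, ENNReal.tsum_add]

open Classical in
/-- `φ` is the image of the weights `ω` under `p`. -/
def IsPushWeight (p : V → G) (ω : V → ℝ≥0∞) (φ : G → ℝ) : Prop :=
  ∀ g, 0 ≤ φ g ∧ ENNReal.ofReal (φ g) = ∑' v, if p v = g then ω v else 0

variable {ω : V → ℝ≥0∞} {φ : G → ℝ}

/-- Change of variables under `p`, by exchanging the sums over `G` and over its fibres. -/
lemma IsPushWeight.tsum_mul {G : Type*} {p : V → G} {φ : G → ℝ} (h : IsPushWeight p ω φ)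
    (F : G → ℝ≥0∞) :
    ∑' g, ENNReal.ofReal (φ g) * F g = ∑' v, ω v * F (p v) := by
  classical
  calc ∑' g, ENNReal.ofReal (φ g) * F g = ∑' g, ∑' v, (if p v = g then ω v * F g else 0) := by
        refine tsum_congr fun g => ?_
        rw [(h g).2, ← ENNReal.tsum_mul_right]
        refine tsum_congr fun v => ?_
        split_ifs with h1
        · convert rfl
        · simp
    _ = ∑' v, ∑' g, (if p v = g then ω v * F g else 0) := ENNReal.tsum_comm
    _ = _ := by
        refine tsum_congr fun v => ?_
        rw [tsum_eq_single (p v) (fun g hg => if_neg hg.symm), if_pos rfl]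

/-- Here `φ` is in `ℓ¹(G)` and `ρ` is isometric, so the series converges absolutely. -/
lemma IsPushWeight.summable_of_tsum_ne_top (h : IsPushWeight p ω φ) (hω : ∑' v, ω v ≠ ∞) :
    Summable fun g => φ g • quotRep H g f := by
  have h1 := h.tsum_mul 1
  simp only [Pi.one_apply, mul_one] at h1
  have h2 : Summable φ := by
    have := ENNReal.summable_toReal (h1 ▸ hω)
    simpa only [ENNReal.toReal_ofReal (h _).1] using this
  refine Summable.of_norm ?_
  simp only [norm_smul, LinearIsometryEquiv.norm_map, Real.norm_of_nonneg (h _).1]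
  exact h2.mul_right _

/-- Evaluation at a coset is a continuous functional, so the vector-valued sum may be computed
pointwise, where all terms are non-negative. -/
lemma IsPushWeight.repConv_apply (h : IsPushWeight p ω φ) (hf : ∀ y, 0 ≤ f y)
    (hs : Summable fun g => φ g • quotRep H g f) (y : Σ j : ι, G ⧸ H j) :
    0 ≤ repConv H φ f y ∧ ENNReal.ofReal (repConv H φ f y) = weightedSum p f ω y := by
  have h1 : HasSum (fun g => φ g * f (g⁻¹ • y)) (repConv H φ f y) :=
    (lp.evalCLM ℝ (fun _ : (Σ j : ι, G ⧸ H j) => ℝ) 2 y).hasSum hs.hasSum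
  have h0 : ∀ g, 0 ≤ φ g * f (g⁻¹ • y) := fun g => mul_nonneg (h g).1 (hf _)
  rw [← h1.tsum_eq]
  refine ⟨tsum_nonneg h0, ?_⟩
  rw [ENNReal.ofReal_tsum_of_nonneg h0 h1.summable, weightedSum]
  simp only [ENNReal.ofReal_mul (h _).1]
  exact h.tsum_mul fun g => ENNReal.ofReal (f (g⁻¹ • y))

/-- The weights need not be summable here. Positivity replaces absolute convergence: the partial
sums lie between `0` and the pointwise sum, which is in `ℓ²`, and dominated convergence gives
convergence in norm. -/
lemma IsPushWeight.summable_of_energy_ne_top (h : IsPushWeight p ω φ) (hf : ∀ y, 0 ≤ f y)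
    (hE : energy (weightedSum p f ω) ≠ ∞) :
    Summable fun g => φ g • quotRep H g f := by
  set q : (Σ j : ι, G ⧸ H j) → ℝ := fun y => (weightedSum p f ω y).toReal with hq
  have hsq : Summable fun y => q y ^ 2 := by
    simpa [q] using ENNReal.summable_toReal hE
  let Q : QuotSum H := ⟨q, memℓp_gen (by simpa using hsq)⟩
  have hy : ∀ y, HasSum (fun g => φ g * f (g⁻¹ • y)) (q y) := by
    intro y
    have h0 : ∀ g, 0 ≤ φ g * f (g⁻¹ • y) := fun g => mul_nonneg (h g).1 (hf _)
    have e : weightedSum p f ω y = ∑' g, ENNReal.ofReal (φ g * f (g⁻¹ • y)) := by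
      simp only [ENNReal.ofReal_mul (h _).1]
      exact (h.tsum_mul fun g => ENNReal.ofReal (f (g⁻¹ • y))).symm
    have ht := apply_ne_top_of_energy_ne_top hE y
    rw [e] at ht
    have := ENNReal.hasSum_toReal ht
    rw [← ENNReal.tsum_toReal_eq (fun g => ENNReal.ofReal_ne_top), ← e] at this
    simpa only [ENNReal.toReal_ofReal (h0 _)] using this
  refine ⟨Q, ?_⟩
  rw [HasSum, tendsto_iff_norm_sub_tendsto_zero]
  have key : Tendsto (fun S : Finset G => ∑' y, (∑ g ∈ S, φ g * f (g⁻¹ • y) - q y) ^ 2) atTop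
      (𝓝 (∑' y : (Σ j : ι, G ⧸ H j), (0 : ℝ))) := by
    refine tendsto_tsum_of_dominated_convergence hsq (fun y => ?_) (Eventually.of_forall ?_)
    · have := ((hy y).sub_const (q y)).pow 2
      simpa using this
    · intro S y
      have h0 : ∀ g, 0 ≤ φ g * f (g⁻¹ • y) := fun g => mul_nonneg (h g).1 (hf _)
      have h1 := sum_le_hasSum S (fun g _ => h0 g) (hy y)
      have h2 := Finset.sum_nonneg fun g (_ : g ∈ S) => h0 g
      rw [Real.norm_of_nonneg (sq_nonneg _)]
      nlinarith
  rw [tsum_zero] at key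
  have hn : ∀ S : Finset G, ‖∑ g ∈ S, φ g • quotRep H g f - Q‖ =
      Real.sqrt (∑' y, (∑ g ∈ S, φ g * f (g⁻¹ • y) - q y) ^ 2) := by
    intro S
    rw [← Real.sqrt_sq (norm_nonneg (∑ g ∈ S, φ g • quotRep H g f - Q)), sq,
      ← real_inner_self_eq_norm_mul_norm, lp.inner_eq_tsum]
    congr 1
    refine tsum_congr fun y => ?_
    have e : (∑ g ∈ S, φ g • quotRep H g f - Q : QuotSum H) y =
        ∑ g ∈ S, φ g * f (g⁻¹ • y) - q y := by
      rw [lp.coeFn_sub, Pi.sub_apply, lp.coeFn_sum, Finset.sum_apply]; rfl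
    rw [e, real_inner_self_eq_norm_sq, Real.norm_eq_abs, sq_abs]
  simp only [hn]
  have := (Real.continuous_sqrt.tendsto 0).comp key
  rw [Real.sqrt_zero] at this
  exact this

lemma IsPushWeight.ofReal_inner_self (h : IsPushWeight p ω φ) (hf : ∀ y, 0 ≤ f y)
    (hs : Summable fun g => φ g • quotRep H g f) :
    ENNReal.ofReal (inner ℝ (repConv H φ f) (repConv H φ f)) = energy (weightedSum p f ω) := by
  rw [_root_.ofReal_inner_self fun y => (h.repConv_apply hf hs y).1]
  congr 1
  exact funext fun y => (h.repConv_apply hf hs y).2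

/-- Pairing `φ ∗ f` with a positive vector. -/
lemma IsPushWeight.tsum_inner (h : IsPushWeight p ω φ) (hf : ∀ y, 0 ≤ f y)
    (hs : Summable fun g => φ g • quotRep H g f) {P : QuotSum H} (hP : ∀ y, 0 ≤ P y) :
    ∑' v, ω v * ENNReal.ofReal (inner ℝ (quotRep H (p v) f) P) =
      ENNReal.ofReal (inner ℝ (repConv H φ f) P) := by
  rw [ofReal_inner_eq_tsum (fun y => (h.repConv_apply hf hs y).1) hP]
  simp only [(h.repConv_apply hf hs _).2, weightedSum, ← ENNReal.tsum_mul_right]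
  rw [ENNReal.tsum_comm]
  refine tsum_congr fun v => ?_
  rw [ofReal_inner_eq_tsum (f₁ := quotRep H (p v) f) (fun y => hf _) hP, ← ENNReal.tsum_mul_left]
  simp only [mul_assoc]

end PositiveVectors

namespace MarkovShift

/-! ### Weighted words from `A` to `a` and the energy of their vectors. -/

section PathWeights

variable {W : Type*} {τ : W → W → Prop} {R : MarkovShift τ → ℝ}

/-- The words with first letter `A` and last letter `a`. -/
def pathWords (A a : W) : Set (List W) := {v | v.head? = some A ∧ v.getLast? = some a}

open Classical in
/-- The weight `κ(|v|) R_{|v|}(vx)` on the words from `A` to `a`. -/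
noncomputable def pathWeight (R : MarkovShift τ → ℝ) (A a : W) (x : MarkovShift τ)
    (κ : ℕ → ℝ≥0∞) (v : List W) : ℝ≥0∞ :=
  if v ∈ pathWords A a then κ v.length * wordWeight R x v else 0

variable {A a : W} {x : MarkovShift τ}

lemma pathWeight_of_mem {κ : ℕ → ℝ≥0∞} {v : List W} (h : v ∈ pathWords A a) :
    pathWeight R A a x κ v = κ v.length * wordWeight R x v := if_pos h

lemma pathWeight_of_notMem {κ : ℕ → ℝ≥0∞} {v : List W} (h : v ∉ pathWords A a) :
    pathWeight R A a x κ v = 0 := if_neg h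

lemma pathWeight_mono {κ κ' : ℕ → ℝ≥0∞} (h : ∀ n, κ n ≤ κ' n) (v : List W) :
    pathWeight R A a x κ v ≤ pathWeight R A a x κ' v := by
  unfold pathWeight; split_ifs
  · gcongr; exact h _
  · exact le_rfl

lemma pathWeight_const_mul (C : ℝ≥0∞) (κ : ℕ → ℝ≥0∞) (v : List W) :
    pathWeight R A a x (fun n => C * κ n) v = C * pathWeight R A a x κ v := by
  unfold pathWeight; split_ifs
  · rw [mul_assoc]
  · simp

lemma pathWeight_add (κ κ' : ℕ → ℝ≥0∞) (v : List W) :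
    pathWeight R A a x (fun n => κ n + κ' n) v =
      pathWeight R A a x κ v + pathWeight R A a x κ' v := by
  unfold pathWeight; split_ifs
  · rw [add_mul]
  · simp

lemma length_pos_of_mem_pathWords {v : List W} (h : v ∈ pathWords A a) : 0 < v.length := by
  rcases v with _ | ⟨b, v⟩
  · simp [pathWords] at h
  · simp

/-- The coefficients `κ` cut off after `N`. -/
noncomputable def truncate (κ : ℕ → ℝ≥0∞) (N : ℕ) (n : ℕ) : ℝ≥0∞ := if n ≤ N then κ n else 0

lemma truncate_le (κ : ℕ → ℝ≥0∞) (N n : ℕ) : truncate κ N n ≤ κ n := by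
  unfold truncate; split_ifs <;> simp

lemma truncate_mono (κ : ℕ → ℝ≥0∞) {N N' : ℕ} (h : N ≤ N') (n : ℕ) :
    truncate κ N n ≤ truncate κ N' n := by
  unfold truncate; split_ifs <;> first | omega | simp

lemma iSup_truncate_mul (κ : ℕ → ℝ≥0∞) (n : ℕ) (r : ℝ≥0∞) :
    ⨆ N, truncate κ N n * r = κ n * r := by
  refine le_antisymm (iSup_le fun N => by gcongr; exact truncate_le _ _ _) ?_
  refine le_trans (le_of_eq ?_) (le_iSup _ n)
  simp [truncate]

/-- The total weight of the words of length `n`. -/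
lemma tsum_pathWeight (κ : ℕ → ℝ≥0∞) (F : List W → ℝ≥0∞) :
    ∑' v, pathWeight R A a x κ v * F v =
      ∑' n, κ n * ∑' v, pathWeight R A a x (Pi.single n 1) v * F v := by
  simp_rw [← ENNReal.tsum_mul_left]
  rw [ENNReal.tsum_comm]
  refine tsum_congr fun v => ?_
  rw [tsum_eq_single v.length]
  · unfold pathWeight; split_ifs <;> simp [mul_assoc]
  · intro n hn
    unfold pathWeight; split_ifs <;> simp [hn.symm]

lemma tsum_pathWeight_single_le (n : ℕ) :
    ∑' v, pathWeight R A a x (Pi.single n 1) v ≤ ∑' v : wordsFrom A n, wordWeight R x v := by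
  rw [tsum_subtype]
  refine ENNReal.tsum_le_tsum fun v => ?_
  unfold pathWeight
  split_ifs with h
  · by_cases hn : v.length = n
    · rw [indicator_of_mem (show v ∈ wordsFrom A n from ⟨h.1, hn⟩)]; simp [hn]
    · simp [hn]
  · exact zero_le

variable {G ι : Type*} [Group G] {s : W → G} {H : ι → Subgroup G} {f : QuotSum H}

/-- `‖∑ κ(|v|) R_{|v|}(vx) ρ(𝔰(v)) f‖²`. -/
noncomputable def pathEnergy (R : MarkovShift τ → ℝ) (s : W → G) (A a : W) (x : MarkovShift τ)
    (f : QuotSum H) (κ : ℕ → ℝ≥0∞) : ℝ≥0∞ :=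
  energy (weightedSum (wordProd s) f (pathWeight R A a x κ))

lemma pathEnergy_mono {κ κ' : ℕ → ℝ≥0∞} (h : ∀ n, κ n ≤ κ' n) :
    pathEnergy R s A a x f κ ≤ pathEnergy R s A a x f κ' :=
  energy_mono fun _ => weightedSum_mono (pathWeight_mono h) _

lemma pathEnergy_const_mul (C : ℝ≥0∞) (κ : ℕ → ℝ≥0∞) :
    pathEnergy R s A a x f (fun n => C * κ n) = C ^ 2 * pathEnergy R s A a x f κ := by
  rw [pathEnergy, pathEnergy, ← energy_const_mul]
  congr 1; funext y
  rw [← weightedSum_const_mul]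
  congr 1; funext v
  exact pathWeight_const_mul _ _ _

lemma pathEnergy_add_le (κ κ' : ℕ → ℝ≥0∞) :
    pathEnergy R s A a x f (fun n => κ n + κ' n) ≤
      2 * pathEnergy R s A a x f κ + 2 * pathEnergy R s A a x f κ' := by
  refine le_trans (le_of_eq ?_) (energy_add_le _ _)
  rw [pathEnergy]
  congr 1; funext y
  rw [← weightedSum_add]
  congr 1; funext v
  exact pathWeight_add _ _ _

/-- Monotone convergence again; it reduces every statement about divergence to finite ranges of
lengths. -/
lemma pathEnergy_eq_iSup (κ : ℕ → ℝ≥0∞) :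
    pathEnergy R s A a x f κ = ⨆ N, pathEnergy R s A a x f (truncate κ N) := by
  unfold pathEnergy
  rw [← energy_iSup fun N N' h y => weightedSum_mono (pathWeight_mono (truncate_mono κ h)) y]
  congr 1; funext y
  refine le_antisymm ?_
    (iSup_le fun N => weightedSum_mono (pathWeight_mono (truncate_le κ N)) y)
  rw [weightedSum, ENNReal.tsum_eq_iSup_sum]
  refine iSup_le fun S => ?_
  have : ∀ v, pathWeight R A a x κ v = ⨆ N, pathWeight R A a x (truncate κ N) v := by
    intro v
    unfold pathWeight; split_ifs
    · rw [iSup_truncate_mul]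
    · simp
  simp only [this, ENNReal.iSup_mul]
  rw [ENNReal.finsetSum_iSup_of_monotone]
  · exact iSup_mono fun N => ENNReal.sum_le_tsum _
  · intro v N N' h
    dsimp only
    gcongr
    exact pathWeight_mono (truncate_mono κ h) v

/-- Summable weights push forward to `ℓ¹(G)`, and the energy is then the squared norm of a genuine
vector. -/
lemma energy_ne_top_of_tsum_ne_top {V : Type*} {p : V → G} {ω : V → ℝ≥0∞} (hf : ∀ y, 0 ≤ f y)
    (h : ∑' v, ω v ≠ ∞) : energy (weightedSum p f ω) ≠ ∞ := by
  classical
  have hφ : IsPushWeight p ω fun g => (∑' v, if p v = g then ω v else 0).toReal := by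
    intro g
    refine ⟨ENNReal.toReal_nonneg, ?_⟩
    rw [ENNReal.ofReal_toReal]
    · refine ne_top_of_le_ne_top h (ENNReal.tsum_le_tsum fun v => ?_)
      split_ifs <;> simp
  rw [← hφ.ofReal_inner_self hf (hφ.summable_of_tsum_ne_top h)]
  exact ENNReal.ofReal_ne_top

/-- The hypotheses under which the sums over the words of a given length are finite. -/
lemma tsum_pathWeight_ne_top {M : ℝ≥0∞} (hM : M ≠ ∞)
    (hle : ∀ n, ∑' v : wordsFrom A n, wordWeight R x v ≤ M) {κ : ℕ → ℝ≥0∞}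
    (hκ : ∑' n, κ n ≠ ∞) : ∑' v, pathWeight R A a x κ v ≠ ∞ := by
  have := tsum_pathWeight (R := R) (A := A) (a := a) (x := x) κ fun _ => 1
  simp only [mul_one] at this
  rw [this]
  refine ne_top_of_le_ne_top (ENNReal.mul_ne_top hκ hM) ?_
  rw [← ENNReal.tsum_mul_right]
  refine ENNReal.tsum_le_tsum fun n => ?_
  gcongr
  exact (tsum_pathWeight_single_le n).trans (hle n)

lemma tsum_truncate_ne_top {κ : ℕ → ℝ≥0∞} (hκ : ∀ n, κ n ≠ ∞) (N : ℕ) :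
    ∑' n, truncate κ N n ≠ ∞ := by
  rw [tsum_eq_sum (s := Finset.range (N + 1))]
  · refine (ENNReal.sum_lt_top.2 fun n _ => ?_).ne
    exact ((truncate_le κ N n).trans_lt (hκ n).lt_top)
  · intro n hn
    simp only [Finset.mem_range, not_lt] at hn
    simp [truncate]; omega

end PathWeights

/-! ### The `G`-densities as push-forwards of word weights. -/

section Densities

variable {W : Type*} {τ : W → W → Prop} {R : MarkovShift τ → ℝ} {A a : W} {x : MarkovShift τ}
  {G ι : Type*} [Group G] {s : W → G} {H : ι → Subgroup G} {f : QuotSum H}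

lemma isChain_append_of_getLast? (hax : τ a (x.seq 0)) {v : List W} (hv : v.IsChain τ)
    (hl : v.getLast? = some a) : (v ++ [x.seq 0]).IsChain τ := by
  rw [List.isChain_append]
  refine ⟨hv, List.isChain_singleton _, fun y hy z hz => ?_⟩
  simp only [hl, List.head?_cons, Option.mem_def, Option.some.injEq] at hy hz
  rwa [← hy, ← hz]

open Classical in
-- Finiteness excludes the default value `0` of a divergent real sum, so real and extended sums
-- agree.
lemma ofReal_tsum_words (hpos : ∀ z, 0 < R z) (hax : τ a (x.seq 0)) (n : ℕ) (g : G)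
    (hfin : ∑' v, pathWeight R A a x (Pi.single n 1) v ≠ ∞) :
    ENNReal.ofReal (∑' w : {w : List W // IsWord τ A a n w ∧ wordProd s w = g},
        birkhoffProd R n (prepend w.1 x)) =
      ∑' v, pathWeight R A a x (Pi.single n 1) v * (if wordProd s v = g then 1 else 0) := by
  have hterm : ∀ v, pathWeight R A a x (Pi.single n 1) v * (if wordProd s v = g then 1 else 0) =
      {w : List W | IsWord τ A a n w ∧ wordProd s w = g}.indicator
        (fun v => ENNReal.ofReal (birkhoffProd R n (prepend v x))) v := by
    intro v
    by_cases h : IsWord τ A a n v ∧ wordProd s v = g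
    · rw [indicator_of_mem (by exact h)]
      obtain ⟨⟨hn, hc, hA, ha⟩, hg⟩ := h
      rw [pathWeight_of_mem ⟨hA, ha⟩, if_pos hg,
        wordWeight_of_isChain (isChain_append_of_getLast? hax hc ha)]
      simp [hn]
    · rw [indicator_of_notMem (by exact h)]
      by_cases hg : wordProd s v = g
      swap
      · simp [hg]
      by_cases hp : v ∈ pathWords A a
      swap
      · simp [pathWeight_of_notMem hp]
      rw [pathWeight_of_mem hp]
      by_cases hn : v.length = n
      swap
      · simp [hn]
      have : ¬ (v ++ [x.seq 0]).IsChain τ := fun hc =>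
        h ⟨⟨hn, (List.isChain_append.1 hc).1, hp.1, hp.2⟩, hg⟩
      simp [wordWeight_of_not_isChain this]
  simp only [hterm]
  rw [← tsum_subtype]
  have hfin' : ∑' v : {w : List W | IsWord τ A a n w ∧ wordProd s w = g},
      ENNReal.ofReal (birkhoffProd R n (prepend v.1 x)) ≠ ∞ := by
    rw [tsum_subtype {w : List W | IsWord τ A a n w ∧ wordProd s w = g}
      fun v => ENNReal.ofReal (birkhoffProd R n (prepend v x))]
    simp only [← hterm]
    refine ne_top_of_le_ne_top hfin (ENNReal.tsum_le_tsum fun v => ?_)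
    split_ifs <;> simp
  rw [ENNReal.ofReal_tsum_of_nonneg (fun _ => (birkhoffProd_pos hpos _ _).le)]
  · rfl
  · have := ENNReal.summable_toReal hfin'
    simpa only [ENNReal.toReal_ofReal (birkhoffProd_pos hpos _ _).le] using! this

/-- The coefficients `t⁻ⁿ cₙ`. -/
noncomputable def coeff (c : ℕ → ℝ) (t : ℝ) (n : ℕ) : ℝ≥0∞ := ENNReal.ofReal ((t ^ n)⁻¹ * c n)

lemma coeff_ne_top (c : ℕ → ℝ) (t : ℝ) (n : ℕ) : coeff c t n ≠ ∞ := ENNReal.ofReal_ne_top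

lemma densityTerm_nonneg (hpos : ∀ z, 0 < R z) {c : ℕ → ℝ} (hc : ∀ n, 0 ≤ c n) {t : ℝ}
    (ht : 0 < t) (g : G) (n : ℕ) : 0 ≤ densityTerm R s A a x c t g n :=
  mul_nonneg (mul_nonneg (by positivity) (hc n))
    (tsum_nonneg fun _ => (birkhoffProd_pos hpos _ _).le)

open Classical in
lemma ofReal_densityTerm (hpos : ∀ z, 0 < R z) (hax : τ a (x.seq 0)) {c : ℕ → ℝ}
    (hc : ∀ n, 0 ≤ c n) {t : ℝ} (ht : 0 < t) (g : G) (n : ℕ)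
    (hfin : ∑' v, pathWeight R A a x (Pi.single n 1) v ≠ ∞) :
    ENNReal.ofReal (densityTerm R s A a x c t g n) =
      coeff c t n *
        ∑' v, pathWeight R A a x (Pi.single n 1) v * (if wordProd s v = g then 1 else 0) := by
  rw [densityTerm, ENNReal.ofReal_mul (mul_nonneg (by positivity) (hc n)),
    ofReal_tsum_words hpos hax n g hfin, coeff]

/-- A word with a first letter is nonempty; this reconciles the densities, summed from `n = 1`, with
sums over all lengths. -/
lemma pathWeight_single_zero (v : List W) : pathWeight R A a x (Pi.single 0 1) v = 0 := by
  by_cases h : v ∈ pathWords A a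
  · rw [pathWeight_of_mem h, Pi.single_eq_of_ne (length_pos_of_mem_pathWords h).ne', zero_mul]
  · exact pathWeight_of_notMem h

lemma isPushWeight_densityPartial (hpos : ∀ z, 0 < R z) (hax : τ a (x.seq 0)) {c : ℕ → ℝ}
    (hc : ∀ n, 0 ≤ c n) {t : ℝ} (ht : 0 < t)
    (hfin : ∀ n, ∑' v, pathWeight R A a x (Pi.single n 1) v ≠ ∞) (N : ℕ) :
    IsPushWeight (wordProd s) (pathWeight R A a x (truncate (coeff c t) N))
      (densityPartial R s A a x c t N) := by
  classical
  intro g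
  refine ⟨Finset.sum_nonneg fun n _ => densityTerm_nonneg hpos hc ht g n, ?_⟩
  rw [densityPartial, ENNReal.ofReal_sum_of_nonneg fun n _ => densityTerm_nonneg hpos hc ht g n]
  have h := tsum_pathWeight (R := R) (A := A) (a := a) (x := x) (truncate (coeff c t) N)
    fun v => if wordProd s v = g then 1 else 0
  simp only [mul_ite, mul_one, mul_zero] at h
  refine Eq.trans ?_ (h.symm.trans (by congr!))
  rw [tsum_eq_sum (s := Finset.Icc 1 N)]
  · refine Finset.sum_congr rfl fun n hn => ?_
    rw [ofReal_densityTerm hpos hax hc ht g n (hfin n), truncate, if_pos (Finset.mem_Icc.1 hn).2]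
    simp only [mul_ite, mul_one, mul_zero]
  · intro n hn
    rcases Nat.eq_zero_or_pos n with rfl | hn0
    · simp [pathWeight_single_zero]
    · have : ¬ n ≤ N := fun h => hn (Finset.mem_Icc.2 ⟨hn0, h⟩)
      simp [truncate, this]

lemma exists_pos_of_ne_zero (hf : ∀ y, 0 ≤ f y) (hf0 : f ≠ 0) : ∃ y, 0 < f y := by
  by_contra! h
  exact hf0 (lp.ext (funext fun y => le_antisymm (h y) (hf y)))

/-- Choose `y` with `f y > 0`. The value of the weighted sum at `g • y` is at least the fibre sum
times `f y`, and finite energy forces finite values. -/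
lemma tsum_fiber_ne_top (hf : ∀ y, 0 ≤ f y) (hf0 : f ≠ 0) {V : Type*} {p : V → G}
    {ω : V → ℝ≥0∞} (hE : energy (weightedSum p f ω) ≠ ∞) (g : G) (S : V → Prop)
    [DecidablePred S] (hS : ∀ v, S v → p v = g) : ∑' v, (if S v then ω v else 0) ≠ ∞ := by
  obtain ⟨y, hy⟩ := exists_pos_of_ne_zero hf hf0
  intro h
  refine apply_ne_top_of_energy_ne_top hE (g • y) ?_
  have : ∑' v, (if S v then ω v else 0) * ENNReal.ofReal (f y) ≤ weightedSum p f ω (g • y) := by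
    refine ENNReal.tsum_le_tsum fun v => ?_
    split_ifs with hv
    · rw [quotRep_apply_apply, hS v hv, inv_smul_smul]
    · simp
  rw [ENNReal.tsum_mul_right, h, ENNReal.top_mul (by simpa using hy)] at this
  exact top_le_iff.1 this

/-- Finite energy makes each fibre sum finite, so `density` is not a default value. -/
lemma isPushWeight_density (hpos : ∀ z, 0 < R z) (hax : τ a (x.seq 0)) {c : ℕ → ℝ}
    (hc : ∀ n, 0 ≤ c n) {t : ℝ} (ht : 0 < t) (hf : ∀ y, 0 ≤ f y) (hf0 : f ≠ 0)
    (hfin : ∀ n, ∑' v, pathWeight R A a x (Pi.single n 1) v ≠ ∞)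
    (hE : pathEnergy R s A a x f (coeff c t) ≠ ∞) :
    (∀ g, Summable fun n : ℕ => densityTerm R s A a x c t g (n + 1)) ∧
    IsPushWeight (wordProd s) (pathWeight R A a x (coeff c t)) (density R s A a x c t) := by
  classical
  have h : ∀ g, ∑' n, ENNReal.ofReal (densityTerm R s A a x c t g (n + 1)) =
      ∑' v, if wordProd s v = g then pathWeight R A a x (coeff c t) v else 0 := by
    intro g
    have h := tsum_pathWeight (R := R) (A := A) (a := a) (x := x) (coeff c t)
      fun v => if wordProd s v = g then 1 else 0
    simp only [mul_ite, mul_one, mul_zero] at h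
    symm
    rw [h, tsum_eq_zero_add' ENNReal.summable]
    simp only [ofReal_densityTerm hpos hax hc ht g _ (hfin _), pathWeight_single_zero, mul_ite,
      mul_one, mul_zero, ite_self, tsum_zero, zero_add]
  have hsum : ∀ g, Summable fun n : ℕ => densityTerm R s A a x c t g (n + 1) := by
    intro g
    have h1 : ∑' n, ENNReal.ofReal (densityTerm R s A a x c t g (n + 1)) ≠ ∞ := by
      rw [h g]; exact tsum_fiber_ne_top hf hf0 hE g _ fun v hv => hv
    have := ENNReal.summable_toReal h1
    simpa only [ENNReal.toReal_ofReal (densityTerm_nonneg hpos hc ht g _)] using this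
  refine ⟨hsum, fun g => ⟨tsum_nonneg fun n => densityTerm_nonneg hpos hc ht g _, ?_⟩⟩
  rw [density, ENNReal.ofReal_tsum_of_nonneg (fun n => densityTerm_nonneg hpos hc ht g _) (hsum g),
    h g]

end Densities

end MarkovShift

/-! ### Slowly increasing functions. -/

section SlowlyIncreasing

/-- A null sequence decreasing as slowly as prescribed. -/
lemma exists_antitone_slow {N : ℕ → ℕ} (hN : StrictMono N) :
    ∃ d : ℕ → ℝ, Antitone d ∧ (∀ i, 0 ≤ d i) ∧ Tendsto d atTop (𝓝 0) ∧
      ∀ j i, i < N (j + 1) → 1 / ((j : ℝ) + 1) ≤ d i := by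
  -- The index of the block containing `i`; searching up to `i` loses nothing since `j ≤ N j`. The
  -- sequence is then `1 / (J i + 1)`.
  set J : ℕ → ℕ := fun i => Nat.findGreatest (fun j => N j ≤ i) i with hJ
  have hJm : Monotone J := fun i k hik =>
    Nat.findGreatest_mono (fun j (h : N j ≤ i) => h.trans hik) hik
  have hJle : ∀ j i, i < N (j + 1) → J i ≤ j := by
    intro j i hi
    by_contra! h
    have h0 : J i ≠ 0 := by omega
    have h1 : N (J i) ≤ i := Nat.findGreatest_of_ne_zero (m := J i) (P := fun j => N j ≤ i) rfl h0
    have := hN.monotone (show j + 1 ≤ J i by omega)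
    omega
  have hJge : ∀ j, j ≤ J (N j) := fun j => Nat.le_findGreatest (hN.le_apply) le_rfl
  have hJt : Tendsto J atTop atTop := tendsto_atTop_atTop_of_monotone hJm fun j => ⟨N j, hJge j⟩
  refine ⟨fun i => 1 / ((J i : ℝ) + 1), ?_, fun i => by positivity, ?_, ?_⟩
  · intro i k hik
    have : (J i : ℝ) ≤ J k := by exact_mod_cast hJm hik
    dsimp only
    gcongr
  · exact tendsto_one_div_add_atTop_nhds_zero_nat.comp hJt
  · intro j i hi
    have : (J i : ℝ) ≤ j := by exact_mod_cast hJle j i hi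
    dsimp only
    gcongr

/-- A slowly increasing function with rate `d`. -/
lemma isSlowlyIncreasing_exp_sum {d : ℕ → ℝ} (hd : Antitone d) (hd0 : ∀ i, 0 ≤ d i)
    (hdt : Tendsto d atTop (𝓝 0))
    (hunb : Tendsto (fun n => ∑ i ∈ Finset.range n, d i) atTop atTop) :
    IsSlowlyIncreasing (fun n => Real.exp (∑ i ∈ Finset.range n, d i)) ∧
      ∀ m n, Real.exp (∑ i ∈ Finset.range (m + n), d i) ≤
        Real.exp (∑ i ∈ Finset.range m, d i) * Real.exp (∑ i ∈ Finset.range n, d i) := by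
  refine ⟨⟨fun n => Real.exp_pos _, ?_, Real.tendsto_exp_atTop.comp hunb, fun k => ?_⟩, ?_⟩
  · refine monotone_nat_of_le_succ fun n => ?_
    rw [Real.exp_le_exp, Finset.sum_range_succ]
    linarith [hd0 n]
  · have h : Tendsto (fun n => ∑ i ∈ Finset.range k, d (n + i)) atTop (𝓝 0) := by
      rw [show (0 : ℝ) = ∑ i ∈ Finset.range k, (0 : ℝ) by simp]
      exact tendsto_finsetSum _ fun i _ => hdt.comp (tendsto_add_atTop_nat i)
    have := (Real.continuous_exp.tendsto 0).comp h
    rw [Real.exp_zero] at this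
    refine this.congr fun n => ?_
    simp only [Function.comp_apply]
    rw [Finset.sum_range_add, Real.exp_add, mul_div_cancel_left₀ _ (Real.exp_pos _).ne']
  -- Submultiplicativity: `d` is antitone, so its sum over `n` terms is largest when started at `0`.
  · intro m n
    rw [← Real.exp_add, Real.exp_le_exp, Finset.sum_range_add]
    gcongr with i
    exact hd (by omega)

/-- The ratio of consecutive values is eventually below `r`, so growth is subexponential; this is
why `c` leaves the exponent unchanged. -/
lemma IsSlowlyIncreasing.exists_le_mul_pow {c : ℕ → ℝ} (hc : IsSlowlyIncreasing c) {r : ℝ}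
    (hr : 1 < r) : ∃ C, 0 < C ∧ ∀ n, c n ≤ C * r ^ n := by
  obtain ⟨hpos, hmono, -, hratio⟩ := hc
  obtain ⟨N, hN⟩ := eventually_atTop.1 ((hratio 1).eventually (gt_mem_nhds hr))
  refine ⟨c N, hpos N, fun n => ?_⟩
  have key : ∀ k, c (N + k) ≤ c N * r ^ k := by
    intro k
    induction k with
    | zero => simp
    | succ k ih =>
      have := (div_lt_iff₀ (hpos _)).1 (hN (N + k) (by omega))
      calc c (N + (k + 1)) ≤ r * c (N + k) := this.le
        _ ≤ r * (c N * r ^ k) := by gcongr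
        _ = _ := by ring
  rcases le_total n N with h | h
  · calc c n ≤ c N := hmono h
      _ ≤ c N * r ^ n := le_mul_of_one_le_right (hpos N).le (one_le_pow₀ hr.le)
  · obtain ⟨k, rfl⟩ := Nat.exists_eq_add_of_le h
    refine (key k).trans ?_
    have := hpos N
    gcongr
    · exact hr.le
    · omega

end SlowlyIncreasing

namespace MarkovShift

/-! ### The decay exponent and divergence at the exponent. -/

section DecayExponent

variable {W : Type*} {τ : W → W → Prop} {R : MarkovShift τ → ℝ} {A a : W} {x : MarkovShift τ}
  {G ι : Type*} [Group G] {s : W → G} {H : ι → Subgroup G} {f : QuotSum H} {M : ℝ≥0∞}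

lemma tsum_pathWeight_single_ne_top (hM : M ≠ ∞)
    (hle : ∀ n, ∑' v : wordsFrom A n, wordWeight R x v ≤ M) (n : ℕ) :
    ∑' v, pathWeight R A a x (Pi.single n 1) v ≠ ∞ :=
  ne_top_of_le_ne_top hM ((tsum_pathWeight_single_le n).trans (hle n))

lemma pathEnergy_truncate_ne_top (hM : M ≠ ∞)
    (hle : ∀ n, ∑' v : wordsFrom A n, wordWeight R x v ≤ M) (hf : ∀ y, 0 ≤ f y)
    {κ : ℕ → ℝ≥0∞} (hκ : ∀ n, κ n ≠ ∞) (N : ℕ) :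
    pathEnergy R s A a x f (truncate κ N) ≠ ∞ :=
  energy_ne_top_of_tsum_ne_top hf (tsum_pathWeight_ne_top hM hle (tsum_truncate_ne_top hκ N))

/-- Each partial sum is a genuine vector whose squared norm is the energy of a truncation, and the
energy is the supremum of these. -/
lemma bddAbove_inner_iff (hpos : ∀ z, 0 < R z) (hax : τ a (x.seq 0)) (hM : M ≠ ∞)
    (hle : ∀ n, ∑' v : wordsFrom A n, wordWeight R x v ≤ M) (hf : ∀ y, 0 ≤ f y) {t : ℝ}
    (ht : 0 < t) :
    BddAbove (range fun N : ℕ =>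
      inner ℝ (repConv H (densityPartial R s A a x (fun _ => 1) t N) f)
        (repConv H (densityPartial R s A a x (fun _ => 1) t N) f)) ↔
      pathEnergy R s A a x f (coeff (fun _ => 1) t) ≠ ∞ := by
  have hN : ∀ N, ENNReal.ofReal (inner ℝ (repConv H (densityPartial R s A a x (fun _ => 1) t N) f)
      (repConv H (densityPartial R s A a x (fun _ => 1) t N) f)) =
      pathEnergy R s A a x f (truncate (coeff (fun _ => 1) t) N) := by
    intro N
    have h := isPushWeight_densityPartial (s := s) hpos hax (c := fun _ => 1)
      (fun _ => zero_le_one) ht (tsum_pathWeight_single_ne_top (a := a) hM hle) N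
    exact h.ofReal_inner_self hf (h.summable_of_tsum_ne_top
      (tsum_pathWeight_ne_top hM hle (tsum_truncate_ne_top (coeff_ne_top _ _) N)))
  rw [pathEnergy_eq_iSup]
  simp only [← hN]
  constructor
  · rintro ⟨B, hB⟩
    refine ne_top_of_le_ne_top (ENNReal.ofReal_ne_top (r := B)) (iSup_le fun N => ?_)
    exact ENNReal.ofReal_le_ofReal (hB ⟨N, rfl⟩)
  · intro h
    have hb : ∀ N, inner ℝ (repConv H (densityPartial R s A a x (fun _ => 1) t N) f)
        (repConv H (densityPartial R s A a x (fun _ => 1) t N) f) ≤ ENNReal.toReal _ := fun N =>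
      (ENNReal.ofReal_le_iff_le_toReal h).1 (le_iSup (fun N => ENNReal.ofReal
        (inner ℝ (repConv H (densityPartial R s A a x (fun _ => 1) t N) f)
          (repConv H (densityPartial R s A a x (fun _ => 1) t N) f))) N)
    exact ⟨_, forall_mem_range.2 hb⟩

lemma decayExponent_eq (hpos : ∀ z, 0 < R z) (hax : τ a (x.seq 0)) (hM : M ≠ ∞)
    (hle : ∀ n, ∑' v : wordsFrom A n, wordWeight R x v ≤ M) (hf : ∀ y, 0 ≤ f y) :
    decayExponent R s A a x H f =
      sInf {t : ℝ | 0 < t ∧ pathEnergy R s A a x f (coeff (fun _ => 1) t) ≠ ∞} := by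
  rw [decayExponent]
  congr 1
  ext t
  exact and_congr_right fun ht => bddAbove_inner_iff hpos hax hM hle hf ht

/-- Geometric decay beats the bounded word sums at `t = 2`; hence the infimum defining the exponent
is over a nonempty set. -/
lemma pathEnergy_coeff_one_two_ne_top (hM : M ≠ ∞)
    (hle : ∀ n, ∑' v : wordsFrom A n, wordWeight R x v ≤ M) (hf : ∀ y, 0 ≤ f y) :
    pathEnergy R s A a x f (coeff (fun _ => 1) 2) ≠ ∞ := by
  refine energy_ne_top_of_tsum_ne_top hf (tsum_pathWeight_ne_top hM hle ?_)
  have h : Summable fun n : ℕ => (((2 : ℝ) ^ n)⁻¹ * 1) := by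
    simpa using! summable_geometric_two
  exact h.tsum_ofReal_ne_top

/-- Pick an admissible `t' < t`; the factor `c n` is absorbed by `(t / t') ^ n`. -/
lemma pathEnergy_ne_top_of_decayExponent_lt (hpos : ∀ z, 0 < R z) (hax : τ a (x.seq 0))
    (hM : M ≠ ∞) (hle : ∀ n, ∑' v : wordsFrom A n, wordWeight R x v ≤ M) (hf : ∀ y, 0 ≤ f y)
    {c : ℕ → ℝ} (hc : IsSlowlyIncreasing c) {t : ℝ} (ht : decayExponent R s A a x H f < t) :
    pathEnergy R s A a x f (coeff c t) ≠ ∞ := by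
  rw [decayExponent_eq hpos hax hM hle hf] at ht
  have hne : {t : ℝ | 0 < t ∧ pathEnergy R s A a x f (coeff (fun _ => 1) t) ≠ ∞}.Nonempty :=
    ⟨2, two_pos, pathEnergy_coeff_one_two_ne_top hM hle hf⟩
  obtain ⟨t', ⟨ht0, hE⟩, htt⟩ := exists_lt_of_csInf_lt hne ht
  obtain ⟨C, hC0, hC⟩ := hc.exists_le_mul_pow ((one_lt_div ht0).2 htt)
  have ht1 : 0 < t := ht0.trans htt
  have hle' : ∀ n, coeff c t n ≤ ENNReal.ofReal C * coeff (fun _ => 1) t' n := by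
    intro n
    rw [coeff, coeff, ← ENNReal.ofReal_mul hC0.le]
    refine ENNReal.ofReal_le_ofReal ?_
    calc (t ^ n)⁻¹ * c n ≤ (t ^ n)⁻¹ * (C * (t / t') ^ n) := by gcongr; exact hC n
      _ = C * ((t' ^ n)⁻¹ * 1) := by
        have h1 : t ^ n ≠ 0 := by positivity
        rw [div_pow]; field_simp
  refine ne_top_of_le_ne_top ?_ (pathEnergy_mono hle')
  rw [pathEnergy_const_mul]
  exact ENNReal.mul_ne_top (by simp) hE

lemma pathEnergy_eq_top_of_lt_decayExponent (hpos : ∀ z, 0 < R z) (hax : τ a (x.seq 0))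
    (hM : M ≠ ∞) (hle : ∀ n, ∑' v : wordsFrom A n, wordWeight R x v ≤ M) (hf : ∀ y, 0 ≤ f y)
    {t : ℝ} (ht0 : 0 < t) (ht : t < decayExponent R s A a x H f) :
    pathEnergy R s A a x f (coeff (fun _ => 1) t) = ∞ := by
  rw [decayExponent_eq hpos hax hM hle hf] at ht
  by_contra h
  exact notMem_of_lt_csInf ht ⟨0, fun t ht => ht.1.le⟩ ⟨ht0, h⟩

lemma pathWeight_sq_mul_le_pathEnergy (κ : ℕ → ℝ≥0∞) (v : List W)
    (y : Σ j : ι, G ⧸ H j) :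
    (pathWeight R A a x κ v * ENNReal.ofReal (f y)) ^ 2 ≤ pathEnergy R s A a x f κ := by
  refine le_trans ?_ (ENNReal.le_tsum (wordProd s v • y))
  gcongr
  refine le_trans (le_of_eq ?_) (ENNReal.le_tsum v)
  rw [quotRep_apply_apply, inv_smul_smul]

/-- Mixing gives arbitrarily long words from `A` to `a`. For `t < r` a single such word has weight
at least `(r / t) ^ N`, which is unbounded, so the exponent is at least `r`. -/
lemma decayExponent_pos_of_le (hpos : ∀ z, 0 < R z) (hax : τ a (x.seq 0)) (hmix : IsMixing τ)
    (hM : M ≠ ∞) (hle : ∀ n, ∑' v : wordsFrom A n, wordWeight R x v ≤ M) (hf : ∀ y, 0 ≤ f y)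
    (hf0 : f ≠ 0) {r : ℝ} (hr : 0 < r) (hrR : ∀ z, r ≤ R z) :
    0 < decayExponent R s A a x H f := by
  refine hr.trans_le ?_
  rw [decayExponent_eq hpos hax hM hle hf]
  refine le_csInf ⟨2, two_pos, pathEnergy_coeff_one_two_ne_top hM hle hf⟩ ?_
  rintro t ⟨ht0, hE⟩
  by_contra! htr
  obtain ⟨y, hy⟩ := exists_pos_of_ne_zero hf hf0
  have h1 : 1 < r / t := (one_lt_div ht0).2 htr
  have key : ∀ N : ℕ, ENNReal.ofReal (((r / t) ^ N * f y) ^ 2) ≤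
      pathEnergy R s A a x f (coeff (fun _ => 1) t) := by
    intro N
    obtain ⟨e, heN, he, heA⟩ := hmix.exists_path A a N
    refine le_trans ?_ (pathWeight_sq_mul_le_pathEnergy _ (e ++ [a]) y)
    rw [ENNReal.ofReal_pow (by positivity), ENNReal.ofReal_mul (by positivity)]
    gcongr
    have hch := isChain_append_of_getLast? hax he (by simp)
    rw [pathWeight_of_mem ⟨heA, by simp⟩, wordWeight_of_isChain hch, coeff,
      ← ENNReal.ofReal_mul (by positivity)]
    refine ENNReal.ofReal_le_ofReal ?_
    have h2 : r ^ (e ++ [a]).length ≤ birkhoffProd R (e ++ [a]).length (prepend (e ++ [a]) x) := by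
      have h3 := Finset.prod_const (s := Finset.range (e ++ [a]).length) r
      rw [Finset.card_range] at h3
      rw [← h3]
      exact Finset.prod_le_prod (fun _ _ => hr.le) fun _ _ => hrR _
    calc (r / t) ^ N ≤ (r / t) ^ (e ++ [a]).length :=
          pow_le_pow_right₀ h1.le (by simp; omega)
      _ = (t ^ (e ++ [a]).length)⁻¹ * 1 * r ^ (e ++ [a]).length := by
          rw [div_pow]; field_simp
      _ ≤ _ := by gcongr
  have ht : Tendsto (fun N : ℕ => ENNReal.ofReal (((r / t) ^ N * f y) ^ 2)) atTop (𝓝 ∞) := by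
    refine ENNReal.tendsto_ofReal_atTop.comp ?_
    refine (tendsto_pow_atTop two_ne_zero).comp ?_
    exact (tendsto_pow_atTop_atTop_of_one_lt h1).atTop_mul_const hy
  exact hE (top_le_iff.1 (le_of_tendsto' ht key))

/-- A block of coefficients of large energy beyond a given length. -/
lemma exists_block (hM : M ≠ ∞)
    (hle : ∀ n, ∑' v : wordsFrom A n, wordWeight R x v ≤ M) (hf : ∀ y, 0 ≤ f y)
    {γ : ℝ} (hγ : 0 < γ)
    (htop : ∀ t, 0 < t → t < γ → pathEnergy R s A a x f (coeff (fun _ => 1) t) = ∞) (j N : ℕ) :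
    ∃ N', N < N' ∧ (j + 1) ^ 2 ≤ N' ∧ (j : ℝ≥0∞) ≤ pathEnergy R s A a x f fun n =>
      if N < n ∧ n ≤ N' then
        ENNReal.ofReal ((γ ^ n)⁻¹ * Real.exp (((n : ℝ) - N) * (1 / ((j : ℝ) + 1)))) else 0 := by
  set δ : ℝ := 1 / ((j : ℝ) + 1) with hδ
  have hδ0 : 0 < δ := by positivity
  -- The parameter `γ e^{-δ}` lies below `γ`, so the energy is infinite; its coefficients are `γ⁻ⁿ
  -- e^{nδ}`.
  set κ := coeff (fun _ => 1) (γ * Real.exp (-δ)) with hκ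
  have hκtop : pathEnergy R s A a x f κ = ∞ :=
    htop _ (by positivity) (mul_lt_of_lt_one_right hγ (by simpa using hδ0))
  set κ' : ℕ → ℝ≥0∞ := fun n => if N < n then κ n else 0 with hκ'
  -- Lengths up to `N` contribute finite energy, so the tail alone diverges.
  have htail : pathEnergy R s A a x f κ' = ∞ := by
    by_contra h
    have h1 : pathEnergy R s A a x f κ ≤ 2 * pathEnergy R s A a x f (truncate κ N) +
        2 * pathEnergy R s A a x f κ' := by
      refine le_trans (pathEnergy_mono fun n => ?_) (pathEnergy_add_le _ _)
      rcases le_or_gt n N with h | h <;> simp [truncate, hκ', h]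
    rw [hκtop, top_le_iff] at h1
    exact ENNReal.add_ne_top.2 ⟨ENNReal.mul_ne_top (by simp)
      (pathEnergy_truncate_ne_top hM hle hf (coeff_ne_top _ _) N),
      ENNReal.mul_ne_top (by simp) h⟩ h1
  -- This factor turns `e^{nδ}` into `e^{(n-N)δ}`, the growth allowed when it starts only at `N`; it
  -- enters the energy squared.
  set C : ℝ≥0∞ := ENNReal.ofReal (Real.exp (-(N * δ))) with hC
  have hC0 : C ^ 2 ≠ 0 := by
    have : C ≠ 0 := by simp [hC, Real.exp_pos]
    positivity
  rw [pathEnergy_eq_iSup] at htail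
  obtain ⟨N₁, hN₁⟩ := lt_iSup_iff.1 (htail ▸ ENNReal.div_lt_top (ENNReal.natCast_ne_top j) hC0)
  set N' := max N₁ (max (N + 1) ((j + 1) ^ 2)) with hN'
  refine ⟨N', lt_of_lt_of_le (Nat.lt_succ_self N) ((le_max_left _ _).trans (le_max_right _ _)),
    (le_max_right _ _).trans (le_max_right _ _), ?_⟩
  have h2 := hN₁.le.trans (pathEnergy_mono (truncate_mono κ' (le_max_left N₁ _ : N₁ ≤ N')))
  rw [ENNReal.div_le_iff hC0 (by simp [hC]), mul_comm, ← pathEnergy_const_mul] at h2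
  refine h2.trans (pathEnergy_mono fun n => ?_)
  by_cases h : N < n ∧ n ≤ N'
  · rw [if_pos h, truncate, if_pos h.2, show κ' n = κ n from if_pos h.1, hκ, hC, coeff,
      ← ENNReal.ofReal_mul (Real.exp_pos _).le]
    refine ENNReal.ofReal_le_ofReal (le_of_eq ?_)
    rw [mul_pow, mul_inv, ← Real.exp_nat_mul, ← Real.exp_neg, mul_one, mul_left_comm,
      ← Real.exp_add]
    congr 2
    ring
  · rw [if_neg h]
    simp only [truncate, hκ']
    split_ifs with h3 h4
    · exact absurd ⟨h4, h3⟩ h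
    all_goals simp

/-- Patterson's slowly increasing function, which makes the energy diverge at the exponent. -/
lemma exists_isSlowlyIncreasing (hM : M ≠ ∞)
    (hle : ∀ n, ∑' v : wordsFrom A n, wordWeight R x v ≤ M) (hf : ∀ y, 0 ≤ f y)
    {γ : ℝ} (hγ : 0 < γ)
    (htop : ∀ t, 0 < t → t < γ → pathEnergy R s A a x f (coeff (fun _ => 1) t) = ∞) :
    ∃ c : ℕ → ℝ, IsSlowlyIncreasing c ∧ (∀ m n, c (m + n) ≤ c m * c n) ∧
      pathEnergy R s A a x f (coeff c γ) = ∞ := by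
  choose Φ hΦ hΦ2 hΦE using exists_block (s := s) hM hle hf hγ htop
  obtain ⟨N, hNs⟩ : ∃ N : ℕ → ℕ, ∀ j, N (j + 1) = Φ j (N j) :=
    ⟨fun j => Nat.rec 0 (fun j n => Φ j n) j, fun _ => rfl⟩
  have hN : StrictMono N := strictMono_nat_of_lt_succ fun j => by rw [hNs]; exact hΦ _ _
  obtain ⟨d, hd, hd0, hdt, hdN⟩ := exists_antitone_slow hN
  have hSm : Monotone fun n => ∑ i ∈ Finset.range n, d i := by
    refine monotone_nat_of_le_succ fun n => ?_
    rw [Finset.sum_range_succ]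
    linarith [hd0 n]
  -- On the block after `N j` the logarithm of `c` dominates the exponent in `exists_block`, because
  -- `d ≥ 1 / (j + 1)` up to `N (j + 1)`.
  have hS : ∀ j m n, m ≤ n → n ≤ N (j + 1) →
      ((n : ℝ) - m) * (1 / ((j : ℝ) + 1)) ≤ ∑ i ∈ Finset.range n, d i := by
    intro j m n hmn hn
    obtain ⟨k, rfl⟩ := Nat.exists_eq_add_of_le hmn
    rw [Finset.sum_range_add]
    have h1 : 0 ≤ ∑ i ∈ Finset.range m, d i := Finset.sum_nonneg fun i _ => hd0 i
    have h2 : ∑ i ∈ Finset.range k, (1 / ((j : ℝ) + 1)) ≤ ∑ i ∈ Finset.range k, d (m + i) :=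
      Finset.sum_le_sum fun i hi => hdN j _ (by have := Finset.mem_range.1 hi; omega)
    rw [Finset.sum_const, Finset.card_range, nsmul_eq_mul] at h2
    push_cast
    linarith [show ((m : ℝ) + k - m) * (1 / ((j : ℝ) + 1)) = k * (1 / ((j : ℝ) + 1)) by ring]
  -- The requirement `(j + 1)² ≤ N (j + 1)` serves only here: it makes the sum up to `N (j + 1)` at
  -- least `j + 1`.
  have hunb : Tendsto (fun n => ∑ i ∈ Finset.range n, d i) atTop atTop := by
    refine tendsto_atTop_atTop_of_monotone hSm fun b => ?_
    obtain ⟨j, hj⟩ := exists_nat_ge b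
    refine ⟨N (j + 1), le_trans ?_ (hS j 0 _ (Nat.zero_le _) le_rfl)⟩
    have h1 : ((j : ℝ) + 1) ^ 2 ≤ N (j + 1) := by rw [hNs]; exact_mod_cast hΦ2 j (N j)
    have h2 : (0 : ℝ) < (j : ℝ) + 1 := by positivity
    rw [mul_one_div, le_div_iff₀ h2]
    push_cast
    nlinarith
  obtain ⟨hc, hsub⟩ := isSlowlyIncreasing_exp_sum hd hd0 hdt hunb
  refine ⟨_, hc, hsub, ?_⟩
  -- The `j`-th block alone has energy at least `j`.
  refine ENNReal.eq_top_of_forall_nnreal_le fun r => ?_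
  obtain ⟨j, hj⟩ := exists_nat_ge r
  have hj' : (r : ℝ≥0∞) ≤ j := by exact_mod_cast hj
  have hE := hΦE j (N j)
  rw [← hNs] at hE
  refine hj'.trans (hE.trans (pathEnergy_mono fun n => ?_))
  by_cases h : N j < n ∧ n ≤ N (j + 1)
  · rw [if_pos h]
    refine ENNReal.ofReal_le_ofReal ?_
    gcongr
    exact Real.exp_le_exp.2 (hS j (N j) n h.1.le h.2)
  · rw [if_neg h]
    exact zero_le

end DecayExponent

end MarkovShift

namespace MarkovShift

/-! ### Topology of the shift and continuity of the inverse branches. -/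

section Topology

variable {W : Type*} [TopologicalSpace W] {τ : W → W → Prop}

lemma isInducing_seq : IsInducing (seq : MarkovShift τ → ℕ → W) := ⟨rfl⟩

lemma continuous_seq : Continuous (seq : MarkovShift τ → ℕ → W) := isInducing_seq.continuous

lemma continuous_seq_apply (i : ℕ) : Continuous fun z : MarkovShift τ => z.seq i :=
  (continuous_apply i).comp continuous_seq

lemma continuous_shift : Continuous (shift : MarkovShift τ → MarkovShift τ) :=
  isInducing_seq.continuous_iff.2 (continuous_pi fun i => continuous_seq_apply (i + 1))

lemma continuous_birkhoffProd {R : MarkovShift τ → ℝ} (hR : Continuous R) (n : ℕ) :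
    Continuous (birkhoffProd R n) :=
  continuous_finsetProd _ fun i _ => hR.comp (continuous_shift.iterate i)

variable [DiscreteTopology W]

/-- Admissibility is a countable family of clopen conditions. The embedding makes the shift Polish,
as Prokhorov's theorem requires. -/
lemma isClosedEmbedding_seq : IsClosedEmbedding (seq : MarkovShift τ → ℕ → W) := by
  refine ⟨⟨isInducing_seq, fun y z h => ext_seq (congrFun h)⟩, ?_⟩
  have : range (seq : MarkovShift τ → ℕ → W) = ⋂ i, {z | τ (z i) (z (i + 1))} := by
    ext z
    simp only [mem_range, mem_iInter, mem_ofPred_eq]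
    exact ⟨fun ⟨y, hy⟩ i => hy ▸ y.adm i, fun h => ⟨⟨z, h⟩, rfl⟩⟩
  rw [this]
  refine isClosed_iInter fun i => ?_
  have h : Continuous fun z : ℕ → W => (z i, z (i + 1)) := by fun_prop
  exact (isClosed_discrete {p : W × W | τ p.1 p.2}).preimage h

instance [Countable W] : PolishSpace (MarkovShift τ) :=
  haveI : PolishSpace W := inferInstance
  isClosedEmbedding_seq.polishSpace

lemma isClopen_setOf_seq (i : ℕ) (P : W → Prop) : IsClopen {z : MarkovShift τ | P (z.seq i)} :=
  (isClopen_discrete {b | P b}).preimage (continuous_seq_apply i)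

lemma isClopen_cylinder (w : List W) : IsClopen (cylinder τ w) := by
  have : cylinder τ w = ⋂ i ∈ Finset.range w.length,
      {z : MarkovShift τ | ∀ b, w[i]? = some b → z.seq i = b} := by
    ext z
    simp only [cylinder, mem_ofPred_eq, mem_iInter, Finset.mem_range]
    refine ⟨fun h i _ => h i, fun h i b hb => h i ?_ b hb⟩
    exact (List.getElem?_eq_some_iff.1 hb).1
  rw [this]
  exact isClopen_biInter_finset fun i _ =>
    isClopen_setOf_seq i fun d => ∀ b, w[i]? = some b → d = b

lemma measurableSet_cylinder (w : List W) : MeasurableSet (cylinder τ w) :=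
  (isClopen_cylinder w).isOpen.measurableSet

/-- Sets of sequences with finitely many choices for each letter are compact. -/
lemma isCompact_setOf_forall_mem {F : ℕ → Set W} (hF : ∀ i, (F i).Finite) :
    IsCompact {z : MarkovShift τ | ∀ i, z.seq i ∈ F i} := by
  have := isClosedEmbedding_seq (τ := τ) |>.isCompact_preimage
    (isCompact_univ_pi fun i => (hF i).isCompact)
  convert this using 1
  ext z; simp

/-- Whether `wz` is admissible depends only on the first letter of `z`, which is locally constant;
so the default branch `z` glues continuously. -/
lemma continuous_prepend (w : List W) : Continuous (prepend w : MarkovShift τ → MarkovShift τ) := by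
  classical
  refine continuous_iff_continuousAt.2 fun z => ?_
  have hev : ∀ᶠ y : MarkovShift τ in 𝓝 z, y.seq 0 = z.seq 0 :=
    (isClopen_setOf_seq 0 fun b => b = z.seq 0).isOpen.mem_nhds rfl
  have hadm : ∀ y : MarkovShift τ, y.seq 0 = z.seq 0 →
      ((∀ i, τ (concat w y.seq i) (concat w y.seq (i + 1))) ↔
        ∀ i, τ (concat w z.seq i) (concat w z.seq (i + 1))) := by
    have : ∀ y y' : MarkovShift τ, y.seq 0 = y'.seq 0 →
      (∀ i, τ (concat w y.seq i) (concat w y.seq (i + 1))) →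
        ∀ i, τ (concat w y'.seq i) (concat w y'.seq (i + 1)) := by
      intro y y' h0 h i
      rcases lt_trichotomy (i + 1) w.length with h1 | h1 | h1
      · have := h i
        rwa [concat_of_lt h1, concat_of_lt (by omega)] at this ⊢
      · have := h i
        rw [concat_of_lt (by omega), concat_of_ge (by omega)] at this ⊢
        simpa [h1, h0] using this
      · rw [concat_of_ge (by omega), concat_of_ge (by omega),
          show i + 1 - w.length = i - w.length + 1 by omega]
        exact y'.adm _
    exact fun y hy => ⟨this y z hy, this z y hy.symm⟩
  have hcont : Continuous fun y : MarkovShift τ => concat w y.seq := by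
    refine continuous_pi fun i => ?_
    rcases lt_or_ge i w.length with h | h
    · simp only [concat_of_lt h]; exact continuous_const
    · simp only [concat_of_ge h]; exact continuous_seq_apply _
  by_cases hz : ∀ i, τ (concat w z.seq i) (concat w z.seq (i + 1))
  · rw [isInducing_seq.continuousAt_iff]
    refine hcont.continuousAt.congr ?_
    filter_upwards [hev] with y hy
    simp only [Function.comp_apply]
    rw [prepend, dif_pos ((hadm y hy).2 hz)]
  · refine continuousAt_id.congr ?_
    filter_upwards [hev] with y hy
    rw [prepend, dif_neg fun h => hz ((hadm y hy).1 h)]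
    rfl

lemma IsLocallyHolder.continuous {R : MarkovShift τ → ℝ} (hR : IsLocallyHolder R)
    (hpos : ∀ z, 0 < R z) : Continuous R := by
  obtain ⟨C, θ, h0, h1, hC⟩ := hR
  have hlog : Continuous fun z => Real.log (R z) := by
    refine continuous_iff_continuousAt.2 fun z => ?_
    rw [ContinuousAt, Metric.tendsto_nhds]
    intro ε hε
    have ht : Tendsto (fun n : ℕ => C * θ ^ n) atTop (𝓝 0) := by
      simpa using (tendsto_pow_atTop_nhds_zero_of_lt_one h0.le h1).const_mul C
    obtain ⟨n, hn, hn2⟩ := ((ht.eventually (gt_mem_nhds hε)).and (eventually_ge_atTop 2)).exists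
    have hev : ∀ᶠ y : MarkovShift τ in 𝓝 z, y ∈ cylinder τ (initWord z n) :=
      (isClopen_cylinder _).isOpen.mem_nhds (mem_cylinder_iff.2 fun i hi => by simp [initWord])
    filter_upwards [hev] with y hy
    rw [Real.dist_eq]
    refine (hC n hn2 y z fun i hi => ?_).trans_lt hn
    have := mem_cylinder_iff.1 hy i (by simpa using hi)
    simpa [initWord] using this
  have := Real.continuous_exp.comp hlog
  refine this.congr fun z => ?_
  simp [Real.exp_log (hpos z)]

end Topology

/-! ### Images of cylinders under the shift. -/

section Shadow

variable {W : Type*} {τ : W → W → Prop}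

/-- The image of a cylinder under the full branch. -/
lemma shift_iterate_image_cylinder {w : List W} :
    shift^[w.length] '' cylinder τ w = {z : MarkovShift τ | (w ++ [z.seq 0]).IsChain τ} := by
  ext z
  constructor
  · rintro ⟨y, hy, rfl⟩
    have hw : w = initWord y w.length := by
      refine List.ext_getElem (by simp) fun i h1 h2 => ?_
      rw [← mem_cylinder_iff.1 hy i h1]; simp [initWord]
    have := isChain_initWord y (w.length + 1)
    rw [← initWord_append, ← hw] at this
    rw [mem_ofPred_eq, shift_iterate_seq, zero_add]
    exact this
  · intro h
    exact ⟨prepend w z, mem_cylinder_iff.2 fun i hi => prepend_seq_of_lt h hi,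
      shift_iterate_prepend h⟩

lemma mem_cylinder_append_singleton {w : List W} {b : W} {z : MarkovShift τ}
    (h : (w ++ [z.seq 0]).IsChain τ) :
    prepend w z ∈ cylinder τ (w ++ [b]) ↔ z.seq 0 = b := by
  rw [mem_cylinder_iff]
  constructor
  · intro h'
    have := h' w.length (by simp)
    have e := prepend_seq_length_add h 0
    rw [zero_add] at e
    rw [← e, this]; simp
  · rintro rfl i hi
    have := prepend_seq_eq_getElem? h (i := i) (by simp at hi; omega)
    rw [List.getElem?_eq_getElem hi] at this
    simpa using this.symm

end Shadow

end MarkovShift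

/-! ### Prokhorov's theorem for bounded tight sequences of finite measures. -/

section Prokhorov

variable {X : Type*} [MeasurableSpace X]

/-- A finite measure of mass at most `C`, completed to a probability measure on `X × Bool`. -/
noncomputable def completeMeasure (p : X) (C : ℝ≥0∞) (m : Measure X) : Measure (X × Bool) :=
  C⁻¹ • m.map (fun z => (z, true)) + (1 - C⁻¹ * m univ) • Measure.dirac (p, false)

lemma isProbabilityMeasure_completeMeasure (p : X) {C : ℝ≥0∞} (hC0 : C ≠ 0) (hC : C ≠ ∞)
    {m : Measure X} (hm : m univ ≤ C) : IsProbabilityMeasure (completeMeasure p C m) := by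
  constructor
  have h : C⁻¹ * m univ ≤ 1 := by
    calc C⁻¹ * m univ ≤ C⁻¹ * C := by gcongr
      _ = 1 := ENNReal.inv_mul_cancel hC0 hC
  rw [completeMeasure, Measure.add_apply, Measure.smul_apply, Measure.smul_apply,
    Measure.map_apply (by fun_prop) MeasurableSet.univ]
  simp [add_tsub_cancel_of_le h]

variable [TopologicalSpace X] [PolishSpace X] [BorelSpace X]

/-- The extension of `F` by zero to `X × Bool`. -/
noncomputable def extendTest (F : X →ᵇ ℝ) : X × Bool →ᵇ ℝ :=
  BoundedContinuousFunction.ofNormedAddCommGroup (fun q => F q.1 * (bif q.2 then 1 else 0))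
    ((F.continuous.comp continuous_fst).mul
      ((continuous_of_discreteTopology (f := fun b : Bool => (bif b then (1 : ℝ) else 0))).comp
        continuous_snd)) ‖F‖ (fun q => by
      rcases q with ⟨z, _ | _⟩
      · simp
      · simpa using F.norm_coe_le_norm z)

/-- Extended test functions vanish on the second sheet, so the filler mass there is not seen. -/
lemma integral_extendTest_completeMeasure (p : X) {C : ℝ≥0∞} (hC0 : C ≠ 0) {m : Measure X}
    [IsFiniteMeasure m] (F : X →ᵇ ℝ) :
    ∫ q, extendTest F q ∂(completeMeasure p C m) = C⁻¹.toReal * ∫ z, F z ∂m := by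
  have hm : Measurable fun z : X => (z, true) := by fun_prop
  have hfin : IsFiniteMeasure (C⁻¹ • m.map fun z => (z, true)) := by
    have := Measure.isFiniteMeasure_map m fun z : X => (z, true)
    exact Measure.smul_finite _ (ENNReal.inv_ne_top.2 hC0)
  have hfin' : IsFiniteMeasure ((1 - C⁻¹ * m univ) • Measure.dirac (p, false)) :=
    Measure.smul_finite _ (ne_top_of_le_ne_top ENNReal.one_ne_top tsub_le_self)
  rw [completeMeasure, integral_add_measure ((extendTest F).integrable _)
    ((extendTest F).integrable _), integral_smul_measure, integral_smul_measure,
    integral_map hm.aemeasurable (extendTest F).continuous.aestronglyMeasurable, integral_dirac]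
  simp [extendTest]

lemma isTightMeasureSet_completeMeasure (p : X) {C : ℝ≥0∞} (hC : 1 ≤ C) {S : Set (Measure X)}
    (hS : IsTightMeasureSet S) : IsTightMeasureSet (completeMeasure p C '' S) := by
  rw [isTightMeasureSet_iff_exists_isCompact_measure_compl_le] at hS ⊢
  intro ε hε
  obtain ⟨K, hK, hKS⟩ := hS ε hε
  refine ⟨K ×ˢ {true} ∪ {(p, false)}, (hK.prod isCompact_singleton).union isCompact_singleton, ?_⟩
  rintro _ ⟨m, hm, rfl⟩
  have hmeas : MeasurableSet (K ×ˢ {true} ∪ {(p, false)} : Set (X × Bool))ᶜ :=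
    ((hK.prod isCompact_singleton).union isCompact_singleton).measurableSet.compl
  rw [completeMeasure, Measure.add_apply, Measure.smul_apply, Measure.smul_apply,
    Measure.map_apply (by fun_prop) hmeas, Measure.dirac_apply' _ hmeas]
  have h1 : (fun z : X => (z, true)) ⁻¹' (K ×ˢ {true} ∪ {(p, false)})ᶜ = Kᶜ := by
    ext z; simp
  rw [h1]
  simp only [mem_compl_iff, mem_union, mem_singleton_iff, or_true, not_true_eq_false,
    not_false_eq_true, indicator_of_notMem, smul_eq_mul, mul_zero, add_zero]
  calc C⁻¹ * m Kᶜ ≤ 1 * m Kᶜ := by gcongr; exact ENNReal.inv_le_one.2 hC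
    _ ≤ ε := by rw [one_mul]; exact hKS m hm

/-- Countably many tight and bounded sequences of finite measures have a common weakly convergent
subsequence. -/
lemma exists_subseq_tendsto_integral {I : Type*} [Countable I] [Nonempty X]
    (m : I → ℕ → Measure X)
    (C : I → ℝ≥0∞) (hC : ∀ i, C i ≠ ∞) (hm : ∀ i k, m i k univ ≤ C i)
    (ht : ∀ i, IsTightMeasureSet (range (m i))) :
    ∃ φ : ℕ → ℕ, StrictMono φ ∧ ∃ L : I → Measure X, (∀ i, IsFiniteMeasure (L i)) ∧
      ∀ i (F : X →ᵇ ℝ), Tendsto (fun k => ∫ z, F z ∂(m i (φ k))) atTop (𝓝 (∫ z, F z ∂(L i))) := by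
  obtain ⟨p⟩ := ‹Nonempty X›
  -- Adding `1` keeps the normalising constant nonzero and makes its inverse at most `1`, as
  -- tightness needs.
  set D : I → ℝ≥0∞ := fun i => C i + 1 with hD
  have hD1 : ∀ i, 1 ≤ D i := fun i => le_add_self
  have hD0 : ∀ i, D i ≠ 0 := fun i => (zero_lt_one.trans_le (hD1 i)).ne'
  have hDt : ∀ i, D i ≠ ∞ := fun i => ENNReal.add_ne_top.2 ⟨hC i, ENNReal.one_ne_top⟩
  have hfin : ∀ i k, IsFiniteMeasure (m i k) := fun i k => ⟨(hm i k).trans_lt (hC i).lt_top⟩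
  let P : I → ℕ → ProbabilityMeasure (X × Bool) := fun i k =>
    ⟨completeMeasure p (D i) (m i k), isProbabilityMeasure_completeMeasure p (hD0 i) (hDt i)
      ((hm i k).trans le_self_add)⟩
  have hcomp : ∀ i, IsCompact (closure (range (P i))) := by
    intro i
    refine isCompact_closure_of_isTightMeasureSet ?_
    refine (isTightMeasureSet_completeMeasure p (hD1 i) (ht i)).subset ?_
    rintro _ ⟨_, ⟨k, rfl⟩, rfl⟩
    exact ⟨m i k, ⟨k, rfl⟩, rfl⟩
  -- Tychonoff in place of a diagonal argument: `I` is countable, so the compact product is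
  -- sequentially compact and one subsequence serves all indices.
  obtain ⟨Q, -, φ, hφ, hQ⟩ := (isCompact_univ_pi hcomp).tendsto_subseq
    (x := fun k i => P i k) fun k i _ => subset_closure ⟨k, rfl⟩
  -- The limit is read off on the first sheet, with the normalisation undone.
  refine ⟨φ, hφ, fun i => D i • ((Q i : Measure (X × Bool)).restrict (Prod.snd ⁻¹' {true})).map
    Prod.fst, fun i => ?_, fun i F => ?_⟩
  · have := Measure.isFiniteMeasure_map
      ((Q i : Measure (X × Bool)).restrict (Prod.snd ⁻¹' {true})) Prod.fst
    exact Measure.smul_finite _ (hDt i)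
  · have h1 := (ProbabilityMeasure.tendsto_iff_forall_integral_tendsto.1
      (tendsto_pi_nhds.1 hQ i)) (extendTest F)
    have h2 := h1.const_mul (D i).toReal
    have hms : MeasurableSet (Prod.snd ⁻¹' {true} : Set (X × Bool)) :=
      measurable_snd (measurableSet_singleton true)
    have e1 : (D i).toReal * ∫ q, extendTest F q ∂(Q i : Measure (X × Bool)) =
        ∫ z, F z ∂(D i • ((Q i : Measure (X × Bool)).restrict (Prod.snd ⁻¹' {true})).map
          Prod.fst) := by
      rw [integral_smul_measure, integral_map measurable_fst.aemeasurable
        F.continuous.aestronglyMeasurable, ← integral_indicator hms, smul_eq_mul]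
      congr 1
      refine integral_congr_ae (Eventually.of_forall fun q => ?_)
      rcases q with ⟨z, _ | _⟩ <;> simp [extendTest, indicator]
    rw [← e1]
    refine h2.congr fun k => ?_
    have e2 := integral_extendTest_completeMeasure p (hD0 i) (m := m i (φ k)) F
    simp only [Function.comp_apply]
    change (D i).toReal * ∫ q, extendTest F q ∂(completeMeasure p (D i) (m i (φ k))) = _
    rw [e2, ← mul_assoc, ← ENNReal.toReal_mul, ENNReal.mul_inv_cancel (hD0 i) (hDt i)]
    simp

end Prokhorov

namespace MarkovShift

/-! ### Uniform bounds for the masses of words. -/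

section MassWeights

variable {W : Type*} {τ : W → W → Prop} {R : MarkovShift τ → ℝ} {A a : W} {x : MarkovShift τ}
  {G ι : Type*} [Group G] {s : W → G} {H : ι → Subgroup G} {f : QuotSum H} {c : ℕ → ℝ} {t : ℝ}

/-- The words with first letter `b`. -/
def headSet (b : W) : Set (List W) := {v | v.head? = some b}

open Classical in
/-- The weight `κ(|v|) R_{|v|}(vx)` on the words ending in `a`. -/
noncomputable def endWeight (R : MarkovShift τ → ℝ) (a : W) (x : MarkovShift τ)
    (κ : ℕ → ℝ≥0∞) (v : List W) : ℝ≥0∞ :=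
  if v.getLast? = some a then κ v.length * wordWeight R x v else 0

/-- The mass of `vx` in the approximating measure. -/
noncomputable def massWeight (R : MarkovShift τ → ℝ) (s : W → G) (A a : W) (x : MarkovShift τ)
    (f : QuotSum H) (c : ℕ → ℝ) (g : G) (t : ℝ) (v : List W) : ℝ≥0∞ :=
  endWeight R a x (coeff c t) v *
    ENNReal.ofReal (inner ℝ (quotRep H (wordProd s v) f)
      (quotRep H g⁻¹ (densityVec R s A a x H f c t)) /
        inner ℝ (densityVec R s A a x H f c t) (densityVec R s A a x H f c t))

/-- The parameter `t` for which `φ_c[t] ∗ f` is a well-defined non-zero vector. -/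
structure IsRegular (R : MarkovShift τ → ℝ) (s : W → G) (A a : W) (x : MarkovShift τ)
    (f : QuotSum H) (c : ℕ → ℝ) (t : ℝ) : Prop where
  pos : 0 < t
  push : IsPushWeight (wordProd s) (pathWeight R A a x (coeff c t)) (density R s A a x c t)
  summable : Summable fun g : G => density R s A a x c t g • quotRep H g f
  inner_pos : 0 < inner ℝ (densityVec R s A a x H f c t) (densityVec R s A a x H f c t)

lemma IsRegular.densityVec_nonneg (h : IsRegular R s A a x f c t) (hf : ∀ y, 0 ≤ f y)
    (y : Σ j : ι, G ⧸ H j) : 0 ≤ densityVec R s A a x H f c t y :=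
  (h.push.repConv_apply hf h.summable y).1

lemma endWeight_of_mem_headSet {κ : ℕ → ℝ≥0∞} {v : List W} (hv : v ∈ headSet A) :
    endWeight R a x κ v = pathWeight R A a x κ v := by
  unfold endWeight pathWeight
  by_cases h : v.getLast? = some a
  · rw [if_pos h, if_pos ⟨hv, h⟩]
  · rw [if_neg h, if_neg fun h' => h h'.2]

lemma endWeight_mono {κ κ' : ℕ → ℝ≥0∞} (h : ∀ n, κ n ≤ κ' n) (v : List W) :
    endWeight R a x κ v ≤ endWeight R a x κ' v := by
  unfold endWeight; split_ifs
  · gcongr; exact h _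
  · exact le_rfl

lemma coeff_add_le (hc0 : ∀ n, 0 < c n) (hsub : ∀ m n, c (m + n) ≤ c m * c n) (ht : 0 < t)
    (m n : ℕ) : coeff c t (m + n) ≤ coeff c t m * coeff c t n := by
  have := hc0 m
  rw [coeff, coeff, coeff, ← ENNReal.ofReal_mul (by positivity)]
  refine ENNReal.ofReal_le_ofReal ?_
  calc (t ^ (m + n))⁻¹ * c (m + n) ≤ (t ^ (m + n))⁻¹ * (c m * c n) := by gcongr; exact hsub m n
    _ = _ := by rw [pow_add, mul_inv]; ring

lemma coeff_anti (hc0 : ∀ n, 0 < c n) {γ : ℝ} (hγ : 0 < γ) (h : γ ≤ t) (n : ℕ) :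
    coeff c t n ≤ coeff c γ n := by
  have := hc0 n
  exact ENNReal.ofReal_le_ofReal (by gcongr)

lemma coeff_le_mul_coeff_add (hmono : Monotone c) (ht : 0 < t) (m n : ℕ) :
    coeff c t n ≤ ENNReal.ofReal (t ^ m) * coeff c t (m + n) := by
  rw [coeff, coeff, ← ENNReal.ofReal_mul (by positivity)]
  refine ENNReal.ofReal_le_ofReal ?_
  calc (t ^ n)⁻¹ * c n ≤ (t ^ n)⁻¹ * c (m + n) := by gcongr; exact hmono (by omega)
    _ = _ := by
      rw [pow_add]
      have : t ^ m ≠ 0 := by positivity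
      field_simp

lemma getLast?_append_of_head? {u v : List W} {b : W} (h : v.head? = some b) :
    (u ++ v).getLast? = v.getLast? := by
  cases v with
  | nil => simp at h
  | cons d v => rw [List.getLast?_append_of_ne_nil _ (by simp)]

lemma wordProd_append (u v : List W) : wordProd s (u ++ v) = wordProd s u * wordProd s v := by
  simp [wordProd]

lemma head?_append_singleton {v : List W} {b d : W} (h : v.head? = some b) :
    (v ++ [d]).head? = some b := head?_append_of_head? h

/-- Comparison of `v` and `pv` for a fixed word `p`. -/
lemma endWeight_le_prepend {K : ℝ} (hK : BoundedDistortion R K) (hK1 : 1 ≤ K)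
    (hpos : ∀ z, 0 < R z) (hmono : Monotone c) (ht : 0 < t) {y : MarkovShift τ} {p v : List W}
    (hp : (p ++ [y.seq 0]).IsChain τ) (hv : v ∈ headSet (y.seq 0)) :
    endWeight R a x (coeff c t) v ≤
      (ENNReal.ofReal (t ^ p.length) * (ENNReal.ofReal K / wordWeight R y p)) *
        endWeight R a x (coeff c t) (p ++ v) := by
  unfold endWeight
  rw [getLast?_append_of_head? hv]
  split_ifs with h
  · calc coeff c t v.length * wordWeight R x v
        ≤ (ENNReal.ofReal (t ^ p.length) * coeff c t (p.length + v.length)) *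
          ((ENNReal.ofReal K / wordWeight R y p) * wordWeight R x (p ++ v)) := by
          gcongr
          · exact coeff_le_mul_coeff_add hmono ht _ _
          · exact hK.wordWeight_le_prepend hK1 hpos hp (head?_append_singleton hv)
      _ = _ := by rw [List.length_append]; ring
  · exact zero_le

/-- Submultiplicativity of the weights. -/
lemma endWeight_append_le {K : ℝ} (hK : BoundedDistortion R K) (hK1 : 1 ≤ K)
    (hpos : ∀ z, 0 < R z) (hc0 : ∀ n, 0 < c n) (hsub : ∀ m n, c (m + n) ≤ c m * c n)
    (ht : 0 < t) {y : MarkovShift τ} {u v : List W} (hv : v ∈ headSet (y.seq 0)) :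
    endWeight R a x (coeff c t) (u ++ v) ≤
      (ENNReal.ofReal K * (coeff c t u.length * wordWeight R y u)) *
        endWeight R a x (coeff c t) v := by
  unfold endWeight
  rw [getLast?_append_of_head? hv]
  split_ifs with h
  · calc coeff c t (u ++ v).length * wordWeight R x (u ++ v)
        ≤ (coeff c t u.length * coeff c t v.length) *
          (ENNReal.ofReal K * (wordWeight R y u * wordWeight R x v)) := by
          gcongr
          · rw [List.length_append]; exact coeff_add_le hc0 hsub ht _ _
          · exact hK.wordWeight_append_le hK1 hpos (head?_append_singleton hv)
      _ = _ := by ring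
  · exact zero_le

/-- The masses of words from a fixed letter have bounded sums. -/
lemma exists_tsum_endWeight_le {K : ℝ} (hK : BoundedDistortion R K) (hK1 : 1 ≤ K)
    (hpos : ∀ z, 0 < R z) (hmix : IsMixing τ) (hf : ∀ y, 0 ≤ f y) (hmono : Monotone c)
    (T : ℝ) (b : W) :
    ∃ M : ℝ≥0∞, M ≠ ∞ ∧ ∀ t ≤ T, IsRegular R s A a x f c t → ∀ g : G,
      ∑' v : headSet b, endWeight R a x (coeff c t) v *
          ENNReal.ofReal (inner ℝ (quotRep H (wordProd s v) f)
            (quotRep H g (densityVec R s A a x H f c t))) ≤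
        M * ENNReal.ofReal
          (inner ℝ (densityVec R s A a x H f c t) (densityVec R s A a x H f c t)) := by
  obtain ⟨y, rfl⟩ := hmix.exists_seq_zero_eq b
  -- Prepending `p` turns words from `b` into words from `A`, whose weighted vectors sum to `Q`
  -- itself. The cost `t ^ |p|` is uniform for `t ≤ T`.
  obtain ⟨p, -, hp, hpA⟩ := hmix.exists_path A (y.seq 0) 0
  refine ⟨ENNReal.ofReal (T ^ p.length) * (ENNReal.ofReal K / wordWeight R y p),
    ENNReal.mul_ne_top ENNReal.ofReal_ne_top (div_wordWeight_ne_top hpos hp K),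
    fun t htT hreg g => ?_⟩
  set Q := densityVec R s A a x H f c t with hQ
  have ht := hreg.pos
  have hQ0 := hreg.densityVec_nonneg hf
  set P := quotRep H (wordProd s p * g) Q with hP
  calc _ ≤ (ENNReal.ofReal (T ^ p.length) * (ENNReal.ofReal K / wordWeight R y p)) *
        ∑' u : (univ : Set (List W)), pathWeight R A a x (coeff c t) u.1 *
          ENNReal.ofReal (inner ℝ (quotRep H (wordProd s u.1) f) P) := by
        refine ENNReal.tsum_le_mul_tsum_of_injOn
          (f := fun v => endWeight R a x (coeff c t) v *
            ENNReal.ofReal (inner ℝ (quotRep H (wordProd s v) f) (quotRep H g Q)))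
          (g := fun u => pathWeight R A a x (coeff c t) u *
            ENNReal.ofReal (inner ℝ (quotRep H (wordProd s u) f) P))
          (fun v => p ++ v)
          (fun v _ v' _ h => List.append_cancel_left h) fun v hv _ => ⟨mem_univ _, ?_⟩
        have hh : p ++ v ∈ headSet A := by
          cases v with
          | nil => simp [headSet] at hv
          | cons d v =>
            have hd : d = y.seq 0 := by simpa [headSet] using hv
            subst hd
            cases p with
            | nil => simpa [headSet] using hpA
            | cons e p => simpa [headSet] using hpA
        rw [← endWeight_of_mem_headSet hh]
        have e : inner ℝ (quotRep H (wordProd s (p ++ v)) f) P =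
            inner ℝ (quotRep H (wordProd s v) f) (quotRep H g Q) := by
          rw [wordProd_append, hP, quotRep_mul_apply, quotRep_mul_apply,
            LinearIsometryEquiv.inner_map_map]
        rw [e, ← mul_assoc]
        gcongr
        refine (endWeight_le_prepend hK hK1 hpos hmono ht hp hv).trans ?_
        gcongr
    _ = (ENNReal.ofReal (T ^ p.length) * (ENNReal.ofReal K / wordWeight R y p)) *
        ENNReal.ofReal (inner ℝ Q P) := by
        rw [tsum_univ (fun u => pathWeight R A a x (coeff c t) u *
          ENNReal.ofReal (inner ℝ (quotRep H (wordProd s u) f) P)),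
          hreg.push.tsum_inner hf hreg.summable (P := P) fun y => hQ0 _]
        rfl
    _ ≤ _ := by
        gcongr
        have := inner_quotRep_quotRep_le 1 (wordProd s p * g) Q
        rwa [map_one] at this

lemma massWeight_eq_mul_div (h : IsRegular R s A a x f c t) (g : G) (v : List W) :
    massWeight R s A a x f c g t v = endWeight R a x (coeff c t) v *
      ENNReal.ofReal (inner ℝ (quotRep H (wordProd s v) f)
        (quotRep H g⁻¹ (densityVec R s A a x H f c t))) *
      (ENNReal.ofReal
        (inner ℝ (densityVec R s A a x H f c t) (densityVec R s A a x H f c t)))⁻¹ := by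
  rw [massWeight, ENNReal.ofReal_div_of_pos h.inner_pos, div_eq_mul_inv, mul_assoc]

/-- The masses of the words `uv`, for a fixed word `u` and `v` with a fixed first letter. -/
lemma exists_tsum_massWeight_append_le {K : ℝ} (hK : BoundedDistortion R K) (hK1 : 1 ≤ K)
    (hpos : ∀ z, 0 < R z) (hmix : IsMixing τ) (hf : ∀ y, 0 ≤ f y) (hc0 : ∀ n, 0 < c n)
    (hmono : Monotone c) (hsub : ∀ m n, c (m + n) ≤ c m * c n) (T : ℝ) (y : MarkovShift τ) :
    ∃ M : ℝ≥0∞, M ≠ ∞ ∧ ∀ t ≤ T, IsRegular R s A a x f c t → ∀ (g : G) (u : List W),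
      ∑' v : headSet (y.seq 0), massWeight R s A a x f c g t (u ++ v) ≤
        M * (coeff c t u.length * wordWeight R y u) := by
  obtain ⟨M, hM, hle⟩ := exists_tsum_endWeight_le (A := A) (a := a) (x := x) (s := s) hK hK1 hpos
    hmix hf hmono T (y.seq 0)
  refine ⟨ENNReal.ofReal K * M, ENNReal.mul_ne_top ENNReal.ofReal_ne_top hM,
    fun t htT hreg g u => ?_⟩
  set Q := densityVec R s A a x H f c t with hQ
  have hD0 : ENNReal.ofReal (inner ℝ Q Q) ≠ 0 := (ENNReal.ofReal_pos.2 hreg.inner_pos).ne'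
  calc ∑' v : headSet (y.seq 0), massWeight R s A a x f c g t (u ++ v)
      ≤ ∑' v : headSet (y.seq 0), (ENNReal.ofReal K * (coeff c t u.length * wordWeight R y u) *
          (ENNReal.ofReal (inner ℝ Q Q))⁻¹) * (endWeight R a x (coeff c t) v *
          ENNReal.ofReal (inner ℝ (quotRep H (wordProd s v) f)
            (quotRep H ((wordProd s u)⁻¹ * g⁻¹) Q))) := by
        refine ENNReal.tsum_le_tsum fun v => ?_
        rw [massWeight_eq_mul_div hreg]
        -- The factor `ρ(𝔰(u))` moves into the group element, and the bound for words from a letter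
        -- is uniform in that element.
        have e : inner ℝ (quotRep H (wordProd s (u ++ v)) f) (quotRep H g⁻¹ Q) =
            inner ℝ (quotRep H (wordProd s v) f) (quotRep H ((wordProd s u)⁻¹ * g⁻¹) Q) := by
          rw [wordProd_append, quotRep_mul_apply, inner_quotRep_left, quotRep_mul_apply]
        rw [← hQ, e]
        calc _ ≤ (ENNReal.ofReal K * (coeff c t u.length * wordWeight R y u)) *
              endWeight R a x (coeff c t) v * _ * _ := by
                gcongr
                exact endWeight_append_le hK hK1 hpos hc0 hsub hreg.pos v.2
          _ = _ := by ring
    _ ≤ (ENNReal.ofReal K * (coeff c t u.length * wordWeight R y u) *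
          (ENNReal.ofReal (inner ℝ Q Q))⁻¹) * (M * ENNReal.ofReal (inner ℝ Q Q)) := by
        rw [ENNReal.tsum_mul_left]
        gcongr
        exact hle t htT hreg _
    _ = ENNReal.ofReal K * M * (coeff c t u.length * wordWeight R y u) *
          ((ENNReal.ofReal (inner ℝ Q Q))⁻¹ * ENNReal.ofReal (inner ℝ Q Q)) := by ring
    _ = _ := by rw [ENNReal.inv_mul_cancel hD0 ENNReal.ofReal_ne_top, mul_one]

/-- A single word has little mass if `φ_c[t] ∗ f` is large. -/
lemma massWeight_le (h : IsRegular R s A a x f c t) (hc0 : ∀ n, 0 < c n) {γ : ℝ} (hγ : 0 < γ)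
    (hγt : γ ≤ t) (g : G) (v : List W) :
    massWeight R s A a x f c g t v ≤ endWeight R a x (coeff c γ) v *
      ENNReal.ofReal (‖f‖ / ‖densityVec R s A a x H f c t‖) := by
  rw [massWeight]
  set Q := densityVec R s A a x H f c t with hQ
  refine mul_le_mul' (endWeight_mono (coeff_anti hc0 hγ hγt) v) (ENNReal.ofReal_le_ofReal ?_)
  · have hQ0 : 0 < ‖Q‖ := by
      have := h.inner_pos
      rw [← hQ, real_inner_self_eq_norm_mul_norm] at this
      exact (pos_iff_pos_of_mul_pos this).1 (pos_of_mul_pos_left this (norm_nonneg _))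
    -- Cauchy–Schwarz bounds the pairing by `‖f‖ ‖Q‖`, while the denominator is `‖Q‖²`.
    have h1 := real_inner_le_norm (quotRep H (wordProd s v) f) (quotRep H g⁻¹ Q)
    rw [LinearIsometryEquiv.norm_map, LinearIsometryEquiv.norm_map] at h1
    rw [real_inner_self_eq_norm_mul_norm, div_le_div_iff₀ (by positivity) hQ0]
    nlinarith

end MassWeights

/-! ### Integrals against the approximating measures as sums over words. -/

section ApproxMeasure

variable {W : Type*} [Countable W] [TopologicalSpace W] [DiscreteTopology W] {τ : W → W → Prop}
  {R : MarkovShift τ → ℝ} {A a : W} {x : MarkovShift τ}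
  {G ι : Type*} [Group G] {s : W → G} {H : ι → Subgroup G} {f : QuotSum H} {c : ℕ → ℝ} {t : ℝ}

/-- Inadmissible words and words not ending in `a` have mass zero, so the sum may run over all
lists. -/
lemma lintegral_approxMeasure (hax : τ a (x.seq 0)) (hpos : ∀ z, 0 < R z) (hc0 : ∀ n, 0 < c n)
    (ht : 0 < t) (g : G) (F : MarkovShift τ → ℝ≥0∞) :
    ∫⁻ z, F z ∂(approxMeasure R s A a x H f c g t) =
      ∑' v, massWeight R s A a x f c g t v * F (prepend v x) := by
  rw [approxMeasure, lintegral_sum_measure]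
  have h : ∀ v, massWeight R s A a x f c g t v * F (prepend v x) =
      {v : List W | v.IsChain τ ∧ v.getLast? = some a}.indicator
        (fun v => massWeight R s A a x f c g t v * F (prepend v x)) v := by
    intro v
    by_cases hv : v.IsChain τ ∧ v.getLast? = some a
    · rw [indicator_of_mem (by exact hv)]
    · rw [indicator_of_notMem (by exact hv), massWeight]
      have : endWeight R a x (coeff c t) v = 0 := by
        unfold endWeight
        split_ifs with h
        · have hn : ¬ (v ++ [x.seq 0]).IsChain τ := fun h' => hv ⟨(List.isChain_append.1 h').1, h⟩
          rw [wordWeight_of_not_isChain hn, mul_zero]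
        · rfl
      simp [this]
  rw [tsum_congr h, ← tsum_subtype]
  refine tsum_congr fun v => ?_
  rw [lintegral_smul_measure, lintegral_dirac, smul_eq_mul, massWeight, endWeight, if_pos v.2.2,
    wordWeight_of_isChain (isChain_append_of_getLast? hax v.2.1 v.2.2), coeff]
  have h1 := hc0 v.1.length
  have h2 := birkhoffProd_pos hpos v.1.length (prepend v.1 x)
  rw [← ENNReal.ofReal_mul (by positivity), ← ENNReal.ofReal_mul (by positivity),
    quotRep_inv_apply]

/-- Integrals over a one-letter cylinder. -/
lemma setLIntegral_approxMeasure (hax : τ a (x.seq 0)) (hpos : ∀ z, 0 < R z)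
    (hc0 : ∀ n, 0 < c n) (ht : 0 < t) (g : G) (b : W) (F : MarkovShift τ → ℝ≥0∞) :
    ∫⁻ z in cylinder τ [b], F z ∂(approxMeasure R s A a x H f c g t) =
      ∑' v : headSet b, massWeight R s A a x f c g t v * F (prepend v x) := by
  classical
  rw [← lintegral_indicator (measurableSet_cylinder _),
    lintegral_approxMeasure hax hpos hc0 ht,
    tsum_subtype (headSet b) fun v => massWeight R s A a x f c g t v * F (prepend v x)]
  refine tsum_congr fun v => ?_
  by_cases h : massWeight R s A a x f c g t v = 0
  · rw [h, zero_mul, indicator_apply, h, zero_mul, ite_self]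
  have he : endWeight R a x (coeff c t) v ≠ 0 := fun h' => h (by rw [massWeight, h', zero_mul])
  have hl : v.getLast? = some a := by
    by_contra hl; exact he (if_neg hl)
  have hch : (v ++ [x.seq 0]).IsChain τ := by
    by_contra hch
    exact he (by rw [endWeight, wordWeight_of_not_isChain hch]; simp)
  have hne : v ≠ [] := by rintro rfl; simp at hl
  have h0 : v.head? = some ((prepend v x).seq 0) := by
    rw [← prepend_seq_zero hch]
    cases v with
    | nil => exact absurd rfl hne
    | cons d v => simp
  have hiff : prepend v x ∈ cylinder τ [b] ↔ v ∈ headSet b := by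
    rw [mem_cylinder_singleton, headSet, mem_ofPred_eq, h0, Option.some.injEq]
  by_cases hb : v ∈ headSet b
  · rw [indicator_of_mem (hiff.2 hb), indicator_of_mem hb]
  · rw [indicator_of_notMem fun h => hb (hiff.1 h), indicator_of_notMem hb, mul_zero]

lemma approxMeasure_cylinder (hax : τ a (x.seq 0)) (hpos : ∀ z, 0 < R z)
    (hc0 : ∀ n, 0 < c n) (ht : 0 < t) (g : G) (b : W) :
    approxMeasure R s A a x H f c g t (cylinder τ [b]) =
      ∑' v : headSet b, massWeight R s A a x f c g t v := by
  have := setLIntegral_approxMeasure (s := s) (f := f) (A := A) hax hpos hc0 ht g b fun _ => 1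
  simpa using this

end ApproxMeasure

end MarkovShift

namespace MarkovShift

/-! ### Summability at `γ` of words that stop visiting `B`. -/

section ReturnSums

variable {W : Type*} {τ : W → W → Prop} {R : MarkovShift τ → ℝ} {c : ℕ → ℝ} {γ : ℝ}

lemma tsum_le_tsum_length (S : Set (List W)) (F : List W → ℝ≥0∞) :
    ∑' u : S, F u ≤ ∑' n : ℕ, ∑' u : {u : List W | u ∈ S ∧ u.length = n}, F u := by
  refine le_trans ?_ (ENNReal.tsum_iUnion_le_tsum F fun n => {u : List W | u ∈ S ∧ u.length = n})
  exact ENNReal.tsum_mono_subtype F fun u hu => mem_iUnion.2 ⟨u.length, hu, rfl⟩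

lemma tsum_ne_top_of_eventually_le {α : ℕ → ℝ≥0∞} (h : ∀ n, α n ≠ ∞) {C q : ℝ}
    (hq0 : 0 ≤ q) (hq1 : q < 1) (hle : ∀ᶠ n in atTop, α n ≤ ENNReal.ofReal (C * q ^ n)) :
    ∑' n, α n ≠ ∞ := by
  obtain ⟨N, hN⟩ := eventually_atTop.1 hle
  have h1 : ∑' n, ENNReal.ofReal (C * q ^ n) ≠ ∞ :=
    ((summable_geometric_of_lt_one hq0 hq1).mul_left C).tsum_ofReal_ne_top
  rw [← ENNReal.summable.sum_add_tsum_nat_add' (f := α) (k := N)]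
  refine ENNReal.add_ne_top.2 ⟨(ENNReal.sum_lt_top.2 fun n _ => (h n).lt_top).ne, ?_⟩
  refine ne_top_of_le_ne_top h1 (le_trans (ENNReal.tsum_le_tsum fun n => hN (n + N) (by omega)) ?_)
  exact ENNReal.tsum_comp_le_tsum_of_injective (add_left_injective N)
    fun n => ENNReal.ofReal (C * q ^ n)

/-- The weights of the first return words are summable above the rate of the first returns. -/
lemma tsum_returnWords_ne_top {K : ℝ} (hK : BoundedDistortion R K) (hK1 : 1 ≤ K)
    (hc : IsSlowlyIncreasing c) (hγ : 0 < γ) (y : MarkovShift τ)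
    (hspr : gammaSPR R (y.seq 0) < ENNReal.ofReal γ) {M : ℝ≥0∞} (hM : M ≠ ∞)
    (hle : ∀ n, ∑' v : wordsFrom (y.seq 0) n, wordWeight R y v ≤ M) :
    ∑' u : returnWords (y.seq 0), coeff c γ u.1.length * wordWeight R y u ≠ ∞ := by
  obtain ⟨r, hr0, hr1, hr2⟩ := ENNReal.lt_iff_exists_real_btwn.1 hspr
  have hrpos : 0 < r := by
    have := (zero_le (a := gammaSPR R (y.seq 0))).trans_lt hr1
    simpa using this
  have hrγ : r < γ := (ENNReal.ofReal_lt_ofReal_iff hγ).1 hr2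
  -- With `r` between the return rate and `γ`, and `1 < q < γ / r`, the growth of `c` is absorbed by
  -- `qⁿ` and the series is dominated by one of ratio `q r / γ < 1`.
  obtain ⟨q, hq1, hq2⟩ := exists_between ((one_lt_div hrpos).2 hrγ)
  obtain ⟨C, hC0, hC⟩ := hc.exists_le_mul_pow hq1
  have hq0 : 0 < q := zero_lt_one.trans hq1
  refine ne_top_of_le_ne_top ?_ (tsum_le_tsum_length _
    fun u => coeff c γ u.length * wordWeight R y u)
  have hterm : ∀ n, ∑' u : {u : List W | u ∈ returnWords (y.seq 0) ∧ u.length = n},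
      coeff c γ u.1.length * wordWeight R y u =
      coeff c γ n * ∑' u : {u : List W | u ∈ returnWords (y.seq 0) ∧ u.length = n},
        wordWeight R y u := by
    intro n
    rw [← ENNReal.tsum_mul_left]
    exact tsum_congr fun u => by rw [u.2.2]
  simp only [hterm]
  refine tsum_ne_top_of_eventually_le (C := C * K) (q := q * r / γ) (fun n => ?_)
    (by positivity) ?_ ?_
  · refine ENNReal.mul_ne_top (coeff_ne_top _ _ _) (ne_top_of_le_ne_top hM (le_trans ?_ (hle n)))
    exact ENNReal.tsum_mono_subtype _ fun u hu => ⟨hu.1.1, hu.2⟩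
  · rw [div_lt_one hγ]
    rwa [lt_div_iff₀ hrpos] at hq2
  · filter_upwards [eventually_lt_of_limsup_lt hr1, eventually_gt_atTop 0] with n hn hn0
    have hfr : firstReturnSum R (y.seq 0) n ≤ ENNReal.ofReal (r ^ n) := by
      have hn' : (0 : ℝ) < n := by exact_mod_cast hn0
      have := (ENNReal.rpow_inv_le_iff hn').1 hn.le
      rwa [ENNReal.rpow_natCast, ← ENNReal.ofReal_pow hr0] at this
    calc _ ≤ ENNReal.ofReal ((γ ^ n)⁻¹ * (C * q ^ n)) *
          (ENNReal.ofReal K * ENNReal.ofReal (r ^ n)) := by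
          refine mul_le_mul' ?_ ?_
          · rw [coeff]
            refine ENNReal.ofReal_le_ofReal ?_
            gcongr
            exact hC n
          · refine (hK.tsum_returnWords_le_firstReturnSum hK1 y n).trans ?_
            gcongr
      _ = _ := by
          rw [← ENNReal.ofReal_mul (by linarith), ← ENNReal.ofReal_mul (by positivity)]
          congr 1
          rw [div_pow, mul_pow]
          have : γ ^ n ≠ 0 := by positivity
          field_simp

/-- The words from `b` that avoid the letter `B` after position `i`. -/
def avoidingWords (b B : W) (i : ℕ) : Set (List W) :=
  {u | u.head? = some b ∧ ∀ j, i < j → u[j]? ≠ some B}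

/-- Finitely many lengths, each with bounded word sums, together with the empty word. -/
lemma tsum_short_ne_top (y : MarkovShift τ) {M : ℝ≥0∞} (hM : M ≠ ∞)
    (hle : ∀ n, ∑' v : wordsFrom (y.seq 0) n, wordWeight R y v ≤ M) (κ : ℕ → ℝ≥0∞)
    (hκ : ∀ n, κ n ≠ ∞) (i : ℕ) :
    ∑' u : {u : List W | u.length ≤ i ∧ (u = [] ∨ u.head? = some (y.seq 0))},
      κ u.1.length * wordWeight R y u ≠ ∞ := by
  have hsub : {u : List W | u.length ≤ i ∧ (u = [] ∨ u.head? = some (y.seq 0))} ⊆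
      {[]} ∪ ⋃ j ∈ Finset.range (i + 1), wordsFrom (y.seq 0) j := by
    rintro u ⟨hu, rfl | h⟩
    · exact Or.inl rfl
    · refine Or.inr ?_
      simp only [mem_iUnion, Finset.mem_range]
      exact ⟨u.length, by omega, h, rfl⟩
  let F : List W → ℝ≥0∞ := fun u => κ u.length * wordWeight R y u
  refine ne_top_of_le_ne_top ?_ ((ENNReal.tsum_mono_subtype F hsub).trans
    ((ENNReal.tsum_union_le F _ _).trans (add_le_add_right (ENNReal.tsum_biUnion_le F _ _) _)))
  refine ENNReal.add_ne_top.2 ⟨?_, (ENNReal.sum_lt_top.2 fun j _ => ?_).ne⟩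
  · rw [tsum_singleton]
    exact ENNReal.mul_ne_top (hκ _) (wordWeight_ne_top _ _)
  · have : ∑' u : wordsFrom (y.seq 0) j, F u = κ j * ∑' u : wordsFrom (y.seq 0) j,
        wordWeight R y u := by
      rw [← ENNReal.tsum_mul_left]
      refine tsum_congr fun u => ?_
      change κ u.1.length * _ = _
      rw [u.2.2]
    rw [this]
    exact ENNReal.mul_lt_top (hκ j).lt_top ((hle j).trans_lt hM.lt_top)

/-- Split at the last occurrence of `B`. It exists, since `u` starts with `B`, and it lies at a
position at most `i`. -/
lemma exists_split_at_last {u : List W} {B : W} {i : ℕ} (hu : u ∈ avoidingWords B B i) :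
    ∃ u₁ u₂, u = u₁ ++ u₂ ∧ u₁.length ≤ i ∧ (u₁ = [] ∨ u₁.head? = some B) ∧
      u₂ ∈ returnWords B := by
  classical
  obtain ⟨h0, hav⟩ := hu
  set j := Nat.findGreatest (fun j => u[j]? = some B) i with hj
  have hjB : u[j]? = some B := by
    have := Nat.findGreatest_spec (P := fun j => u[j]? = some B) (Nat.zero_le i)
      (by rwa [← List.head?_eq_getElem?])
    exact this
  have hmax : ∀ k, j < k → u[k]? ≠ some B := by
    intro k hk
    rcases le_or_gt k i with h | h
    · exact Nat.findGreatest_is_greatest hk h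
    · exact hav k h
  refine ⟨u.take j, u.drop j, (List.take_append_drop j u).symm, ?_, ?_, ?_, ?_⟩
  · have := Nat.findGreatest_le (P := fun j => u[j]? = some B) i
    simp only [List.length_take]; omega
  · rcases Nat.eq_zero_or_pos j with h | h
    · left; simp [h]
    · right
      rw [List.head?_take, if_neg h.ne', h0]
  · rw [List.head?_drop, hjB]
  · intro hmem
    rw [List.tail_drop, List.mem_iff_getElem?] at hmem
    obtain ⟨k, hk⟩ := hmem
    rw [List.getElem?_drop] at hk
    exact hmax _ (by omega) hk

/-- Splitting at the last `B` and submultiplicativity bound the sum by a product: a finite sum over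
short words times the first-return sum. -/
lemma tsum_avoidingWords_self_ne_top {K : ℝ} (hK : BoundedDistortion R K) (hK1 : 1 ≤ K)
    (hpos : ∀ z, 0 < R z) (hc : IsSlowlyIncreasing c) (hsub : ∀ m n, c (m + n) ≤ c m * c n)
    (hγ : 0 < γ) (y : MarkovShift τ)
    (hspr : gammaSPR R (y.seq 0) < ENNReal.ofReal γ) {M : ℝ≥0∞} (hM : M ≠ ∞)
    (hle : ∀ n, ∑' v : wordsFrom (y.seq 0) n, wordWeight R y v ≤ M) (i : ℕ) :
    ∑' u : avoidingWords (y.seq 0) (y.seq 0) i, coeff c γ u.1.length * wordWeight R y u ≠ ∞ := by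
  set V : Set (List W) := {u | u.length ≤ i ∧ (u = [] ∨ u.head? = some (y.seq 0))}
  let F : List W → ℝ≥0∞ := fun u => coeff c γ u.length * wordWeight R y u
  have key : ∑' u : avoidingWords (y.seq 0) (y.seq 0) i, F u ≤
      ENNReal.ofReal K * ∑' p : V × returnWords (y.seq 0), F p.1 * F p.2 := by
    refine ENNReal.tsum_le_mul_tsum_of_rel (fun u p => u = p.1.1 ++ p.2.1) ?_ ?_
    · intro u hu _
      obtain ⟨u₁, u₂, rfl, h1, h2, h3⟩ := exists_split_at_last hu
      refine ⟨⟨⟨u₁, h1, h2⟩, ⟨u₂, h3⟩⟩, rfl, ?_⟩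
      calc F (u₁ ++ u₂) ≤ (coeff c γ u₁.length * coeff c γ u₂.length) *
            (ENNReal.ofReal K * (wordWeight R y u₁ * wordWeight R y u₂)) := by
            refine mul_le_mul' ?_ (hK.wordWeight_append_le hK1 hpos (head?_append_singleton h3.1))
            rw [List.length_append]; exact coeff_add_le hc.1 hsub hγ _ _
        _ = _ := by simp only [F]; ring
    · rintro u - u' - p h h'
      exact h.trans h'.symm
  refine ne_top_of_le_ne_top (ENNReal.mul_ne_top ENNReal.ofReal_ne_top ?_) key
  rw [ENNReal.tsum_prod (f := fun (a : V) (b : returnWords (y.seq 0)) => F a * F b)]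
  simp only [ENNReal.tsum_mul_left, ENNReal.tsum_mul_right]
  exact ENNReal.mul_ne_top (tsum_short_ne_top y hM hle _ (coeff_ne_top _ _) i)
    (tsum_returnWords_ne_top hK hK1 hc hγ y hspr hM hle)

/-- The weights of the words with a bounded time to avoid `B` are summable. -/
lemma tsum_avoidingWords_ne_top {K : ℝ} (hK : BoundedDistortion R K) (hK1 : 1 ≤ K)
    (hpos : ∀ z, 0 < R z) (hmix : IsMixing τ) (hc : IsSlowlyIncreasing c)
    (hsub : ∀ m n, c (m + n) ≤ c m * c n) (hγ : 0 < γ) (y : MarkovShift τ)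
    (hspr : gammaSPR R (y.seq 0) < ENNReal.ofReal γ) {M : ℝ≥0∞} (hM : M ≠ ∞)
    (hle : ∀ n, ∑' v : wordsFrom (y.seq 0) n, wordWeight R y v ≤ M) (b : W) (i : ℕ) :
    ∑' u : avoidingWords b (y.seq 0) i, coeff c γ u.1.length * wordWeight R y u ≠ ∞ := by
  obtain ⟨z, rfl⟩ := hmix.exists_seq_zero_eq b
  -- A path from `B` to `b` reduces to words starting at `B`; the time after which `B` is avoided
  -- moves to `i + |p|`.
  obtain ⟨p, -, hp, hpB⟩ := hmix.exists_path (y.seq 0) (z.seq 0) 0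
  let F : List W → ℝ≥0∞ := fun u => coeff c γ u.length * wordWeight R y u
  have key : ∑' u : avoidingWords (z.seq 0) (y.seq 0) i, F u ≤
      (ENNReal.ofReal (γ ^ p.length) * (ENNReal.ofReal K / wordWeight R z p)) *
        ∑' u : avoidingWords (y.seq 0) (y.seq 0) (i + p.length), F u := by
    refine ENNReal.tsum_le_mul_tsum_of_injOn (fun u => p ++ u)
      (fun v _ v' _ h => List.append_cancel_left h) ?_
    rintro u ⟨hu, hav⟩ -
    refine ⟨⟨?_, fun j hj => ?_⟩, ?_⟩
    · cases u with
      | nil => simp at hu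
      | cons d u =>
        have hd : d = z.seq 0 := by simpa using hu
        subst hd
        cases p with
        | nil => simpa using hpB
        | cons e p => simpa using hpB
    · rw [List.getElem?_append_right (by omega)]
      exact hav _ (by omega)
    · calc F u ≤ (ENNReal.ofReal (γ ^ p.length) * coeff c γ (p.length + u.length)) *
            ((ENNReal.ofReal K / wordWeight R z p) * wordWeight R y (p ++ u)) :=
            mul_le_mul' (coeff_le_mul_coeff_add hc.2.1 hγ _ _)
              (hK.wordWeight_le_prepend hK1 hpos hp (head?_append_singleton hu))
        _ = _ := by simp only [F]; rw [List.length_append]; ring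
  refine ne_top_of_le_ne_top (ENNReal.mul_ne_top (ENNReal.mul_ne_top ENNReal.ofReal_ne_top
    (div_wordWeight_ne_top hpos hp K)) ?_) key
  exact tsum_avoidingWords_self_ne_top hK hK1 hpos hc hsub hγ y hspr hM hle _

/-- The weights of the words ending in `a` with a bounded time to avoid `B` are summable. -/
lemma tsum_endWeight_avoidingWords_ne_top {K : ℝ} (hK : BoundedDistortion R K) (hK1 : 1 ≤ K)
    (hpos : ∀ z, 0 < R z) (hmix : IsMixing τ) (hc : IsSlowlyIncreasing c)
    (hsub : ∀ m n, c (m + n) ≤ c m * c n) (hγ : 0 < γ) (y : MarkovShift τ)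
    (hspr : gammaSPR R (y.seq 0) < ENNReal.ofReal γ) {M : ℝ≥0∞} (hM : M ≠ ∞)
    (hle : ∀ n, ∑' v : wordsFrom (y.seq 0) n, wordWeight R y v ≤ M) (a : W) (x : MarkovShift τ)
    (b : W) (i : ℕ) :
    ∑' v : avoidingWords b (y.seq 0) i, endWeight R a x (coeff c γ) v ≠ ∞ := by
  -- The connecting word avoids `B`, so appending it does not disturb the avoidance condition.
  obtain ⟨e, heB, he, hex⟩ := hmix.exists_path_avoiding (x.seq 0) (y.seq 0)
  let F : List W → ℝ≥0∞ := fun u => coeff c γ u.length * wordWeight R y u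
  have key : ∑' v : avoidingWords b (y.seq 0) i, endWeight R a x (coeff c γ) v ≤
      (ENNReal.ofReal (γ ^ e.length) * (ENNReal.ofReal K / wordWeight R y e)) *
        ∑' u : avoidingWords b (y.seq 0) i, F u := by
    refine ENNReal.tsum_le_mul_tsum_of_injOn (fun u => u ++ e)
      (fun v _ v' _ h => List.append_cancel_right h) ?_
    rintro v ⟨hv, hav⟩ -
    refine ⟨⟨head?_append_of_head? hv, fun j hj => ?_⟩, ?_⟩
    · rw [List.getElem?_append]
      split_ifs
      · exact hav j hj
      · exact fun h => heB (List.mem_iff_getElem?.2 ⟨_, h⟩)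
    · calc endWeight R a x (coeff c γ) v ≤ coeff c γ v.length * wordWeight R x v := by
            unfold endWeight; split_ifs <;> simp
        _ ≤ (ENNReal.ofReal (γ ^ e.length) * coeff c γ (e.length + v.length)) *
            ((ENNReal.ofReal K / wordWeight R y e) * wordWeight R y (v ++ e)) :=
            mul_le_mul' (coeff_le_mul_coeff_add hc.2.1 hγ _ _)
              (hK.wordWeight_le_append hK1 hpos he hex v)
        _ = _ := by simp only [F]; rw [List.length_append, add_comm v.length]; ring
  refine ne_top_of_le_ne_top (ENNReal.mul_ne_top (ENNReal.mul_ne_top ENNReal.ofReal_ne_top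
    (div_wordWeight_ne_top hpos he K)) ?_) key
  exact tsum_avoidingWords_ne_top hK hK1 hpos hmix hc hsub hγ y hspr hM hle b i

/-- A word either avoids `B` after `i`, or splits at the first `B` after `i`. -/
lemma exists_split_at_next {v : List W} {b B : W} {i : ℕ} (hv : v ∈ headSet b)
    (h : v ∉ avoidingWords b B i) :
    ∃ u v', v = u ++ v' ∧ i < u.length ∧ u ∈ avoidingWords b B i ∧ v' ∈ headSet B := by
  classical
  have hex : ∃ j, i < j ∧ v[j]? = some B := by
    by_contra! hne
    exact h ⟨hv, fun j hj => hne j hj⟩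
  obtain ⟨hij, hjB⟩ := Nat.find_spec hex
  have hmin := fun k => Nat.find_min hex (m := k)
  set j := Nat.find hex with hj
  have hjl : j < v.length := (List.getElem?_eq_some_iff.1 hjB).1
  refine ⟨v.take j, v.drop j, (List.take_append_drop j v).symm, ?_, ⟨?_, fun k hk => ?_⟩, ?_⟩
  · simp only [List.length_take]; omega
  · rw [List.head?_take, if_neg (by omega)]; exact hv
  · rw [List.getElem?_take]
    split_ifs with hkj
    · exact fun hB => hmin k hkj ⟨hk, hB⟩
    · simp
  · rw [headSet, mem_ofPred_eq, List.head?_drop, hjB]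

end ReturnSums

end MarkovShift

namespace MarkovShift

/-! ### Tightness of the approximating measures. -/

section Tightness

/-- Bounded distortion, mixing, bounded word sums, and a submultiplicative slowly increasing
function. -/
structure IsWeightSetting {W : Type*} {τ : W → W → Prop} (R : MarkovShift τ → ℝ) (K : ℝ)
    (c : ℕ → ℝ) : Prop where
  pos : ∀ z, 0 < R z
  mixing : IsMixing τ
  distortion : BoundedDistortion R K
  one_le : 1 ≤ K
  sums : ∀ (b : W) (z : MarkovShift τ), ∃ M : ℝ≥0∞, M ≠ ∞ ∧
    ∀ n, ∑' v : wordsFrom b n, wordWeight R z v.1 ≤ M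
  slow : IsSlowlyIncreasing c
  submul : ∀ m n, c (m + n) ≤ c m * c n

/-- A sequence of parameters decreasing to `γ` along which `‖φ_c[t] ∗ f‖ → ∞`. -/
structure IsApproxSeq {W : Type*} {τ : W → W → Prop} {G ι : Type*} [Group G]
    {H : ι → Subgroup G} (R : MarkovShift τ → ℝ) (s : W → G) (A a : W) (x : MarkovShift τ)
    (f : QuotSum H) (c : ℕ → ℝ) (γ : ℝ) (t : ℕ → ℝ) : Prop where
  adm : τ a (x.seq 0)
  nonneg : ∀ y, 0 ≤ f y
  pos : 0 < γ
  lt : ∀ k, γ < t k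
  le : ∀ k, t k ≤ γ + 1
  tendsto : Tendsto t atTop (𝓝 γ)
  regular : ∀ k, IsRegular R s A a x f c (t k)
  norm_tendsto : Tendsto (fun k => ‖densityVec R s A a x H f c (t k)‖) atTop atTop

variable {W : Type*} {τ : W → W → Prop}
  {R : MarkovShift τ → ℝ} {A a : W} {x : MarkovShift τ}
  {G ι : Type*} [Group G] {s : W → G} {H : ι → Subgroup G} {f : QuotSum H} {c : ℕ → ℝ}
  {t : ℕ → ℝ} {K γ : ℝ}

lemma IsApproxSeq.comp (h : IsApproxSeq R s A a x f c γ t) {φ : ℕ → ℕ} (hφ : StrictMono φ) :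
    IsApproxSeq R s A a x f c γ (t ∘ φ) where
  adm := h.adm
  nonneg := h.nonneg
  pos := h.pos
  lt _ := h.lt _
  le _ := h.le _
  tendsto := h.tendsto.comp hφ.tendsto_atTop
  regular _ := h.regular _
  norm_tendsto := h.norm_tendsto.comp hφ.tendsto_atTop

lemma IsApproxSeq.tendsto_ofReal_div (h : IsApproxSeq R s A a x f c γ t) :
    Tendsto (fun k => ENNReal.ofReal (‖f‖ / ‖densityVec R s A a x H f c (t k)‖)) atTop
      (𝓝 0) := by
  rw [← ENNReal.ofReal_zero]
  exact ENNReal.tendsto_ofReal (h.norm_tendsto.const_div_atTop _)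

/-- A set of words whose weights are summable carries no mass in the limit. -/
lemma IsApproxSeq.tendsto_tsum_massWeight (h : IsApproxSeq R s A a x f c γ t)
    (hc0 : ∀ n, 0 < c n) (S : Set (List W))
    (hS : ∑' v : S, endWeight R a x (coeff c γ) v ≠ ∞) (g : G) :
    Tendsto (fun k => ∑' v : S, massWeight R s A a x f c g (t k) v) atTop (𝓝 0) := by
  have h1 := ENNReal.Tendsto.const_mul h.tendsto_ofReal_div (Or.inr hS)
  rw [mul_zero] at h1
  refine tendsto_of_tendsto_of_tendsto_of_le_of_le tendsto_const_nhds h1 (fun _ => zero_le)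
    fun k => ?_
  dsimp only
  rw [← ENNReal.tsum_mul_right]
  exact ENNReal.tsum_le_tsum fun v => massWeight_le (h.regular k) hc0 h.pos (h.lt k).le g v

/-- The masses of the one-letter cylinders are bounded. -/
lemma IsWeightSetting.exists_tsum_massWeight_le (hw : IsWeightSetting R K c)
    (h : IsApproxSeq R s A a x f c γ t) (b : W) :
    ∃ M : ℝ≥0∞, M ≠ ∞ ∧ ∀ k (g : G),
      ∑' v : headSet b, massWeight R s A a x f c g (t k) v ≤ M := by
  obtain ⟨M, hM, hle⟩ := exists_tsum_endWeight_le (A := A) (a := a) (x := x) (s := s)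
    hw.distortion hw.one_le hw.pos hw.mixing h.nonneg hw.slow.2.1 (γ + 1) b
  refine ⟨M, hM, fun k g => ?_⟩
  have hD0 := (ENNReal.ofReal_pos.2 (h.regular k).inner_pos).ne'
  simp only [massWeight_eq_mul_div (h.regular k), ENNReal.tsum_mul_right]
  rw [← div_eq_mul_inv, ENNReal.div_le_iff hD0 ENNReal.ofReal_ne_top]
  exact hle _ (h.le k) (h.regular k) g⁻¹

open Classical in
lemma exists_finset_tsum_le {α : Type*} {F : α → ℝ≥0∞} {S : Set α} (h : ∑' v : S, F v ≠ ∞)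
    {ε : ℝ≥0∞} (hε : 0 < ε) : ∃ T : Finset α, ∑' v : {v | v ∈ S ∧ v ∉ T}, F v ≤ ε := by
  obtain ⟨T, hT⟩ := ((ENNReal.tendsto_tsum_compl_atTop_zero h).eventually
    (ge_mem_nhds hε)).exists
  refine ⟨T.image Subtype.val, le_trans ?_ hT⟩
  rw [← one_mul (∑' b : {x : S // x ∉ T}, F b)]
  refine ENNReal.tsum_le_mul_tsum_of_rel (fun v p => v = p.1.1) ?_ ?_
  · rintro v ⟨hv, hvT⟩ -
    refine ⟨⟨⟨v, hv⟩, fun h => hvT (Finset.mem_image.2 ⟨_, h, rfl⟩)⟩, rfl, by simp⟩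
  · rintro v - v' - p h h'
    exact h.trans h'.symm

/-- Tightness of a coordinate along the tail of the sequence. -/
lemma IsWeightSetting.exists_finite_eventually_le (hw : IsWeightSetting R K c)
    (h : IsApproxSeq R s A a x f c γ t) {B : W} (hB : gammaSPR R B < ENNReal.ofReal γ)
    (g : G) (b : W) (i : ℕ) {ε : ℝ≥0∞} (hε : 0 < ε) :
    ∃ F : Set W, F.Finite ∧ ∀ᶠ k in atTop,
      ∑' v : {v | v ∈ headSet b ∧ (v ++ [x.seq 0]).IsChain τ ∧ (prepend v x).seq i ∉ F},
        massWeight R s A a x f c g (t k) v ≤ ε := by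
  obtain ⟨y, rfl⟩ := hw.mixing.exists_seq_zero_eq B
  obtain ⟨M, hM, hle⟩ := hw.sums (y.seq 0) y
  obtain ⟨M', hM', hle'⟩ := exists_tsum_massWeight_append_le (A := A) (a := a) (x := x) (s := s)
    hw.distortion hw.one_le hw.pos hw.mixing h.nonneg hw.slow.1 hw.slow.2.1 hw.submul (γ + 1) y
  have hsum := tsum_avoidingWords_ne_top hw.distortion hw.one_le hw.pos hw.mixing hw.slow
    hw.submul h.pos y hB hM hle b i
  have hsum' := tsum_endWeight_avoidingWords_ne_top hw.distortion hw.one_le hw.pos hw.mixing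
    hw.slow hw.submul h.pos y hB hM hle a x b i
  have hε2 : 0 < ε / 2 := ENNReal.half_pos hε.ne'
  have hδ : 0 < ε / 2 / (M' + 1) := ENNReal.div_pos hε2.ne' (by simp [hM'])
  -- Words that meet `B` after `i` start with some `u` longer than `i` ending just before that `B`.
  -- Outside a finite set `T` of such `u` the weights are small, and `F` collects the `i`-th letters
  -- of the words in `T`.
  obtain ⟨T, hT⟩ := exists_finset_tsum_le
    (F := fun u => coeff c γ u.length * wordWeight R y u) hsum hδ
  refine ⟨some ⁻¹' ((fun u : List W => u[i]?) '' T),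
    (T.finite_toSet.image _).preimage (Option.some_injective _).injOn, ?_⟩
  -- Words that avoid `B` after `i` have summable weights at `γ`, so their mass tends to `0`; this
  -- half holds only for large `k`.
  filter_upwards [(h.tendsto_tsum_massWeight hw.slow.1 _ hsum' g).eventually
    (ge_mem_nhds hε2)] with k hk
  set F : Set W := some ⁻¹' ((fun u : List W => u[i]?) '' T) with hF
  set X : Set (List W) := {v | v ∈ headSet b ∧ v ∉ avoidingWords b (y.seq 0) i ∧
    (v ++ [x.seq 0]).IsChain τ ∧ (prepend v x).seq i ∉ F} with hX
  have hsplit : ∑' v : X, massWeight R s A a x f c g (t k) v ≤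
      1 * ∑' p : {u | u ∈ avoidingWords b (y.seq 0) i ∧ u ∉ T} × headSet (y.seq 0),
        massWeight R s A a x f c g (t k) (p.1.1 ++ p.2.1) := by
    refine ENNReal.tsum_le_mul_tsum_of_rel (fun v p => v = p.1.1 ++ p.2.1) ?_ ?_
    · rintro v ⟨hv, hav, hch, hvF⟩ -
      obtain ⟨u, v', rfl, hiu, hu, hv'⟩ := exists_split_at_next hv hav
      refine ⟨⟨⟨u, hu, fun huT => hvF ⟨u, huT, ?_⟩⟩, ⟨v', hv'⟩⟩, rfl, by rw [one_mul]⟩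
      have := prepend_seq_eq_getElem? hch (i := i) (by simp; omega)
      rw [← this, List.append_assoc, List.getElem?_append_left hiu]
    · rintro v - v' - p h h'
      exact h.trans h'.symm
  calc _ ≤ ∑' v : (X ∪ avoidingWords b (y.seq 0) i : Set (List W)),
        massWeight R s A a x f c g (t k) v := by
        refine ENNReal.tsum_mono_subtype _ fun v hv => ?_
        by_cases hav : v ∈ avoidingWords b (y.seq 0) i
        · exact Or.inr hav
        · exact Or.inl ⟨hv.1, hav, hv.2⟩
    _ ≤ _ := ENNReal.tsum_union_le _ _ _
    _ ≤ M' * (ε / 2 / (M' + 1)) + ε / 2 := by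
        refine add_le_add (hsplit.trans ?_) hk
        rw [one_mul, ENNReal.tsum_prod (f := fun
          (u : {u | u ∈ avoidingWords b (y.seq 0) i ∧ u ∉ T}) (v : headSet (y.seq 0)) =>
            massWeight R s A a x f c g (t k) (u.1 ++ v.1))]
        calc _ ≤ ∑' u : {u | u ∈ avoidingWords b (y.seq 0) i ∧ u ∉ T},
              M' * (coeff c γ u.1.length * wordWeight R y u) := by
              refine ENNReal.tsum_le_tsum fun u => ?_
              refine (hle' _ (h.le k) (h.regular k) g u.1).trans ?_
              gcongr
              exact coeff_anti hw.slow.1 h.pos (h.lt k).le _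
          _ ≤ _ := by
              rw [ENNReal.tsum_mul_left]
              gcongr
    _ ≤ ε / 2 + ε / 2 := by
        gcongr
        calc M' * (ε / 2 / (M' + 1)) ≤ (M' + 1) * (ε / 2 / (M' + 1)) := by
              gcongr; exact le_self_add
          _ ≤ ε / 2 := ENNReal.mul_div_le
    _ = ε := ENNReal.add_halves ε

/-- Tightness of a coordinate. -/
lemma IsWeightSetting.exists_finite_forall_le (hw : IsWeightSetting R K c)
    (h : IsApproxSeq R s A a x f c γ t) {B : W} (hB : gammaSPR R B < ENNReal.ofReal γ)
    (g : G) (b : W) (i : ℕ) {ε : ℝ≥0∞} (hε : 0 < ε) :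
    ∃ F : Set W, F.Finite ∧ ∀ k,
      ∑' v : {v | v ∈ headSet b ∧ (v ++ [x.seq 0]).IsChain τ ∧ (prepend v x).seq i ∉ F},
        massWeight R s A a x f c g (t k) v ≤ ε := by
  obtain ⟨F, hF, hev⟩ := hw.exists_finite_eventually_le h hB g b i hε
  obtain ⟨N, hN⟩ := eventually_atTop.1 hev
  obtain ⟨M, hM, hle⟩ := hw.exists_tsum_massWeight_le h b
  -- The finitely many remaining `k` are handled one at a time, each sum being finite.
  have hk : ∀ k, ∃ F' : Set W, F'.Finite ∧
      ∑' v : {v | v ∈ headSet b ∧ (v ++ [x.seq 0]).IsChain τ ∧ (prepend v x).seq i ∉ F'},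
        massWeight R s A a x f c g (t k) v ≤ ε := by
    intro k
    obtain ⟨T, hT⟩ := exists_finset_tsum_le (ne_top_of_le_ne_top hM (hle k g)) hε
    refine ⟨(fun v => (prepend v x).seq i) '' T, T.finite_toSet.image _, le_trans ?_ hT⟩
    exact ENNReal.tsum_mono_subtype _ fun v hv => ⟨hv.1, fun hvT => hv.2.2 ⟨v, hvT, rfl⟩⟩
  choose F' hF' hle' using hk
  refine ⟨F ∪ ⋃ k ∈ Finset.range N, F' k,
    hF.union ((Finset.range N).finite_toSet.biUnion fun k _ => hF' k), fun k => ?_⟩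
  rcases le_or_gt N k with hkN | hkN
  · refine le_trans (ENNReal.tsum_mono_subtype _ fun v hv => ?_) (hN k hkN)
    exact ⟨hv.1, hv.2.1, fun hv' => hv.2.2 (Or.inl hv')⟩
  · refine le_trans (ENNReal.tsum_mono_subtype _ fun v hv => ?_) (hle' k)
    refine ⟨hv.1, hv.2.1, fun hv' => hv.2.2 (Or.inr ?_)⟩
    simp only [mem_iUnion, Finset.mem_range]
    exact ⟨k, hkN, hv'⟩

variable [Countable W] [TopologicalSpace W] [DiscreteTopology W]

/-- The approximating measures are tight on one-letter cylinders. -/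
lemma IsWeightSetting.isTightMeasureSet (hw : IsWeightSetting R K c)
    (h : IsApproxSeq R s A a x f c γ t) {B : W} (hB : gammaSPR R B < ENNReal.ofReal γ)
    (g : G) (b : W) :
    IsTightMeasureSet (range fun k =>
      (approxMeasure R s A a x H f c g (t k)).restrict (cylinder τ [b])) := by
  rw [isTightMeasureSet_iff_exists_isCompact_measure_compl_le]
  intro ε hε
  -- Coordinate `i` is confined to a finite set up to mass `ε' i`; together these confinements
  -- define a compact set.
  obtain ⟨ε', hε', hsum⟩ := ENNReal.exists_pos_sum_of_countable hε.ne' ℕ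
  choose F hF hle using fun i => hw.exists_finite_forall_le h hB g b i
    (ENNReal.coe_pos.2 (hε' i))
  refine ⟨_, isCompact_setOf_forall_mem hF, ?_⟩
  rintro _ ⟨k, rfl⟩
  have hc : {z : MarkovShift τ | ∀ i, z.seq i ∈ F i}ᶜ = ⋃ i, {z | z.seq i ∉ F i} := by
    ext z; simp
  rw [hc]
  refine (measure_iUnion_le _).trans (le_trans (ENNReal.tsum_le_tsum fun i => ?_) hsum.le)
  refine le_trans ?_ (hle i k)
  have hm : MeasurableSet {z : MarkovShift τ | z.seq i ∉ F i} :=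
    (isClopen_setOf_seq i fun d => d ∉ F i).isOpen.measurableSet
  rw [← lintegral_indicator_one hm, setLIntegral_approxMeasure h.adm hw.pos hw.slow.1
    (h.regular k).pos]
  refine le_trans (ENNReal.tsum_le_mul_tsum_of_injOn (C := 1)
    (T := {v | v ∈ headSet b ∧ (v ++ [x.seq 0]).IsChain τ ∧ (prepend v x).seq i ∉ F i})
    (f := fun v => massWeight R s A a x f c g (t k) v *
      {z : MarkovShift τ | z.seq i ∉ F i}.indicator 1 (prepend v x))
    (g := fun v => massWeight R s A a x f c g (t k) v) id (injOn_id _) ?_) (by rw [one_mul])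
  intro v hv hne
  rw [id]
  refine ⟨⟨hv, ?_, ?_⟩, ?_⟩
  · by_contra hch
    refine hne ?_
    rw [massWeight, endWeight, wordWeight_of_not_isChain hch]
    simp
  · by_contra hi
    refine hne ?_
    rw [indicator_of_notMem (by simpa using hi), mul_zero]
  · rw [one_mul]
    exact mul_le_of_le_one_right zero_le (indicator_le_self' (fun _ _ => zero_le) _)

end Tightness

end MarkovShift

namespace MarkovShift

/-! ### Weak convergence for non-negative test functions. -/

section TestFunctions

variable {W : Type*} [TopologicalSpace W] {τ : W → W → Prop}

lemma FiniteOnCylinders.isFiniteMeasure_restrict {m : Measure (MarkovShift τ)}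
    (hm : FiniteOnCylinders m) {w : List W} (hw : w ≠ []) :
    IsFiniteMeasure (m.restrict (cylinder τ w)) :=
  ⟨by rw [Measure.restrict_apply_univ]; exact hm w hw⟩

/-- Passage to lower integrals, in which the sums over words are expressed. -/
lemma WeakStarTendsto.tendsto_setLIntegral {m : ℕ → Measure (MarkovShift τ)}
    {m' : Measure (MarkovShift τ)} (h : WeakStarTendsto m m') (b : W) {φ : MarkovShift τ → ℝ}
    (hφ : Continuous φ) (h0 : ∀ z, 0 ≤ φ z) {C : ℝ} (hC : ∀ z, φ z ≤ C) :
    Tendsto (fun k => ∫⁻ z in cylinder τ [b], ENNReal.ofReal (φ z) ∂(m k)) atTop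
      (𝓝 (∫⁻ z in cylinder τ [b], ENNReal.ofReal (φ z) ∂m')) := by
  let F : MarkovShift τ →ᵇ ℝ := BoundedContinuousFunction.ofNormedAddCommGroup φ hφ C
    fun z => by rw [Real.norm_of_nonneg (h0 z)]; exact hC z
  have key : ∀ μ : Measure (MarkovShift τ), FiniteOnCylinders μ →
      ENNReal.ofReal (∫ z in cylinder τ [b], F z ∂μ) =
        ∫⁻ z in cylinder τ [b], ENNReal.ofReal (φ z) ∂μ := by
    intro μ hμ
    have := hμ.isFiniteMeasure_restrict (w := [b]) (by simp)
    exact ofReal_integral_eq_lintegral_ofReal (F.integrable _) (Eventually.of_forall h0)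
  rw [← key m' h.2.1]
  simp only [← key _ (h.1 _)]
  exact ENNReal.tendsto_ofReal (h.2.2 b F)

end TestFunctions

/-! ### The transfer identity for the inverse branches. -/

section TransferIdentity

variable {W : Type*} {τ : W → W → Prop}
  {R : MarkovShift τ → ℝ} {A a : W} {x : MarkovShift τ}
  {G ι : Type*} [Group G] {s : W → G} {H : ι → Subgroup G} {f : QuotSum H} {c : ℕ → ℝ}
  {t : ℕ → ℝ} {K γ : ℝ}

lemma massWeight_ne_zero {g : G} {r : ℝ} {v : List W} (h : massWeight R s A a x f c g r v ≠ 0) :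
    v.getLast? = some a ∧ (v ++ [x.seq 0]).IsChain τ := by
  have he : endWeight R a x (coeff c r) v ≠ 0 := fun h' => h (by rw [massWeight, h', zero_mul])
  refine ⟨?_, ?_⟩
  · by_contra hl; exact he (if_neg hl)
  · by_contra hch
    exact he (by rw [endWeight, wordWeight_of_not_isChain hch]; simp)

/-- The masses of `wv` and `v`. -/
lemma massWeight_append (hpos : ∀ z, 0 < R z) (hc0 : ∀ n, 0 < c n) {r : ℝ} (hr : 0 < r) (g : G)
    {w v : List W} {b : W} (hwb : (w ++ [b]).IsChain τ) (hv : v ∈ headSet b) :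
    ENNReal.ofReal (r ^ w.length) * (massWeight R s A a x f c g r (w ++ v) *
      ENNReal.ofReal (birkhoffProd R w.length (prepend (w ++ v) x))⁻¹) =
    ENNReal.ofReal (c (w.length + v.length) / c v.length) *
      massWeight R s A a x f c (g * wordProd s w) r v := by
  have hpair : inner ℝ (quotRep H (wordProd s (w ++ v)) f)
        (quotRep H g⁻¹ (densityVec R s A a x H f c r)) =
      inner ℝ (quotRep H (wordProd s v) f)
        (quotRep H (g * wordProd s w)⁻¹ (densityVec R s A a x H f c r)) := by
    rw [wordProd_append, quotRep_mul_apply, inner_quotRep_left, mul_inv_rev, quotRep_mul_apply]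
  rw [massWeight, massWeight, hpair]
  have hend : ENNReal.ofReal (r ^ w.length) * (endWeight R a x (coeff c r) (w ++ v) *
      ENNReal.ofReal (birkhoffProd R w.length (prepend (w ++ v) x))⁻¹) =
      ENNReal.ofReal (c (w.length + v.length) / c v.length) *
        endWeight R a x (coeff c r) v := by
    unfold endWeight
    rw [getLast?_append_of_head? hv]
    split_ifs with hl
    swap
    · simp
    by_cases hch : (v ++ [x.seq 0]).IsChain τ
    · have hch' := isChain_append_append (head?_append_singleton hv) hwb hch
      have h0 : (prepend v x).seq 0 = b := by
        have := prepend_seq_zero hch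
        rw [head?_append_singleton hv] at this
        simpa using this.symm
      have hw' : (w ++ [(prepend v x).seq 0]).IsChain τ := h0 ▸ hwb
      have h1 := birkhoffProd_pos hpos w.length (prepend w (prepend v x))
      have h2 := birkhoffProd_pos hpos v.length (prepend v x)
      have h3 := hc0 (w.length + v.length)
      have h4 := hc0 v.length
      rw [wordWeight_of_isChain hch, wordWeight_of_isChain hch', List.length_append,
        birkhoffProd_add, prepend_append hch', shift_iterate_prepend hw', coeff, coeff,
        ← ENNReal.ofReal_mul (by positivity), ← ENNReal.ofReal_mul (by positivity),
        ← ENNReal.ofReal_mul (by positivity), ← ENNReal.ofReal_mul (by positivity),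
        ← ENNReal.ofReal_mul (by positivity)]
      congr 1
      have h5 : r ^ w.length ≠ 0 := by positivity
      rw [pow_add]
      field_simp
    · have hch' : ¬ (w ++ v ++ [x.seq 0]).IsChain τ := by
        rw [List.append_assoc, List.isChain_append]
        exact fun h => hch h.2.1
      rw [wordWeight_of_not_isChain hch, wordWeight_of_not_isChain hch']
      simp
  calc _ = ENNReal.ofReal (r ^ w.length) * (endWeight R a x (coeff c r) (w ++ v) *
      ENNReal.ofReal (birkhoffProd R w.length (prepend (w ++ v) x))⁻¹) * _ := by
        rw [mul_right_comm (endWeight R a x (coeff c r) (w ++ v)), ← mul_assoc]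
    _ = _ := by rw [hend, mul_assoc]

/-- The short words. -/
def shortWords (b : W) (N : ℕ) : Set (List W) := {v | v ∈ headSet b ∧ v.length ≤ N}

/-- Finitely many lengths have finite total weight; so short words vanish in the limit. -/
lemma IsWeightSetting.tsum_shortWords_ne_top (hw : IsWeightSetting R K c) (b : W) (N : ℕ)
    (r : ℝ) : ∑' v : shortWords b N, endWeight R a x (coeff c r) v ≠ ∞ := by
  obtain ⟨M, hM, hle⟩ := hw.sums b x
  have hsub : shortWords b N ⊆ ⋃ j ∈ Finset.range (N + 1), wordsFrom b j := by
    rintro v ⟨hv, hN⟩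
    simp only [mem_iUnion, Finset.mem_range]
    exact ⟨v.length, by omega, hv, rfl⟩
  refine ne_top_of_le_ne_top ?_ ((ENNReal.tsum_mono_subtype _ hsub).trans
    (ENNReal.tsum_biUnion_le _ _ _))
  refine (ENNReal.sum_lt_top.2 fun j _ => ?_).ne
  refine lt_of_le_of_lt ?_ (ENNReal.mul_lt_top (coeff_ne_top c r j).lt_top
    ((hle j).trans_lt hM.lt_top))
  rw [← ENNReal.tsum_mul_left]
  refine ENNReal.tsum_le_tsum fun v => ?_
  have hl : v.1.length = j := v.2.2
  unfold endWeight
  split_ifs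
  · rw [hl]
  · exact zero_le

/-- On the cylinder of an admissible word the Birkhoff products are bounded below. -/
lemma IsWeightSetting.exists_inv_birkhoffProd_le (hw : IsWeightSetting R K c) (w : List W)
    (b : W) : ∃ C', ∀ z ∈ cylinder τ (w ++ [b]), (birkhoffProd R w.length z)⁻¹ ≤ C' := by
  by_cases hne : (cylinder τ (w ++ [b])).Nonempty
  · obtain ⟨y, hy⟩ := hne
    have hK0 : 0 < K := zero_lt_one.trans_le hw.one_le
    refine ⟨K * (birkhoffProd R w.length y)⁻¹, fun z hz => ?_⟩
    have h1 := hw.distortion w.length y z fun i hi => by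
      rw [mem_cylinder_iff.1 hy i (by simp; omega), mem_cylinder_iff.1 hz i (by simp; omega)]
    have h2 := birkhoffProd_pos hw.pos w.length y
    have h3 := birkhoffProd_pos hw.pos w.length z
    rw [inv_le_iff_one_le_mul₀ h3, mul_right_comm, ← div_eq_mul_inv, one_le_div h2]
    exact h1
  · exact ⟨0, fun z hz => absurd ⟨z, hz⟩ hne⟩

variable [Countable W] [TopologicalSpace W] [DiscreteTopology W]

/-- One half of the transfer identity, along the sequence. -/
lemma IsWeightSetting.setLIntegral_le_transfer (hw : IsWeightSetting R K c)
    (h : IsApproxSeq R s A a x f c γ t) {w : List W} {b b₀ : W} (hwb : (w ++ [b]).IsChain τ)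
    (hb₀ : (w ++ [b]).head? = some b₀) (g : G) (φ : MarkovShift τ → ℝ) (k : ℕ) :
    ∫⁻ z in cylinder τ [b], ENNReal.ofReal (φ (prepend w z))
        ∂(approxMeasure R s A a x H f c (g * wordProd s w) (t k)) ≤
      ENNReal.ofReal (t k ^ w.length) * ∫⁻ z in cylinder τ [b₀],
        (cylinder τ (w ++ [b])).indicator (fun z => ENNReal.ofReal (birkhoffProd R w.length z)⁻¹ *
          ENNReal.ofReal (φ z)) z ∂(approxMeasure R s A a x H f c g (t k)) := by
  have ht := (h.regular k).pos
  rw [setLIntegral_approxMeasure h.adm hw.pos hw.slow.1 ht,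
    setLIntegral_approxMeasure h.adm hw.pos hw.slow.1 ht]
  refine ENNReal.tsum_le_mul_tsum_of_injOn (T := headSet b₀)
    (f := fun v => massWeight R s A a x f c (g * wordProd s w) (t k) v *
      ENNReal.ofReal (φ (prepend w (prepend v x))))
    (g := fun u => massWeight R s A a x f c g (t k) u *
      (cylinder τ (w ++ [b])).indicator (fun z => ENNReal.ofReal (birkhoffProd R w.length z)⁻¹ *
          ENNReal.ofReal (φ z)) (prepend u x))
    (fun v => w ++ v) (fun v _ v' _ h => List.append_cancel_left h) ?_
  intro v hv hne
  have hmw : massWeight R s A a x f c (g * wordProd s w) (t k) v ≠ 0 := left_ne_zero_of_mul hne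
  obtain ⟨hl, hch⟩ := massWeight_ne_zero hmw
  have hch' := isChain_append_append (head?_append_singleton hv) hwb hch
  have h0 : (prepend v x).seq 0 = b := by
    have := prepend_seq_zero hch
    rw [head?_append_singleton hv] at this
    simpa using this.symm
  have hw' : (w ++ [(prepend v x).seq 0]).IsChain τ := h0 ▸ hwb
  refine ⟨?_, ?_⟩
  · have h1 := isChain_append_append (head?_append_singleton hv) hwb hch
    cases v with
    | nil => simp [headSet] at hv
    | cons d v =>
      have hd : d = b := by simpa [headSet] using hv
      subst hd
      cases w with
      | nil => simpa [headSet] using hb₀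
      | cons e w => simpa [headSet] using hb₀
  · have hmem : prepend (w ++ v) x ∈ cylinder τ (w ++ [b]) := by
      rw [prepend_append hch']
      exact (mem_cylinder_append_singleton hw').2 h0
    rw [indicator_of_mem hmem, ← mul_assoc, ← mul_assoc, mul_assoc (ENNReal.ofReal _),
      massWeight_append hw.pos hw.slow.1 ht g hwb hv, prepend_append hch']
    gcongr
    -- Monotonicity of `c` makes the ratio at least `1`, so this half needs no error term.
    refine le_mul_of_one_le_left zero_le ?_
    rw [ENNReal.one_le_ofReal, one_le_div (hw.slow.1 _)]
    exact hw.slow.2.1 (by omega)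

/-- The other half of the transfer identity, along the sequence. -/
lemma IsWeightSetting.transfer_le_setLIntegral (hw : IsWeightSetting R K c)
    (h : IsApproxSeq R s A a x f c γ t) {w : List W} {b b₀ : W} (hwb : (w ++ [b]).IsChain τ)
    (g : G) {φ : MarkovShift τ → ℝ} {C : ℝ}
    (hC : ∀ z, φ z ≤ C) {C' : ℝ}
    (hC' : ∀ z ∈ cylinder τ (w ++ [b]), (birkhoffProd R w.length z)⁻¹ ≤ C') {N : ℕ} {δ : ℝ}
    (hN : ∀ n > N, c (w.length + n) / c n ≤ δ) (k : ℕ) :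
    ENNReal.ofReal (t k ^ w.length) * ∫⁻ z in cylinder τ [b₀],
        (cylinder τ (w ++ [b])).indicator (fun z => ENNReal.ofReal (birkhoffProd R w.length z)⁻¹ *
          ENNReal.ofReal (φ z)) z ∂(approxMeasure R s A a x H f c g (t k)) ≤
      ENNReal.ofReal δ * (∫⁻ z in cylinder τ [b], ENNReal.ofReal (φ (prepend w z))
        ∂(approxMeasure R s A a x H f c (g * wordProd s w) (t k))) +
      (ENNReal.ofReal (c w.length) * ENNReal.ofReal C * ∑' v : shortWords b N,
        massWeight R s A a x f c (g * wordProd s w) (t k) v +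
      ENNReal.ofReal (t k ^ w.length) * (ENNReal.ofReal C' * ENNReal.ofReal C) *
        ∑' v : shortWords b₀ w.length, massWeight R s A a x f c g (t k) v) := by
  have ht := (h.regular k).pos
  rw [setLIntegral_approxMeasure h.adm hw.pos hw.slow.1 ht,
    setLIntegral_approxMeasure h.adm hw.pos hw.slow.1 ht]
  set Φ : List W → ℝ≥0∞ := fun u => massWeight R s A a x f c g (t k) u *
      (cylinder τ (w ++ [b])).indicator (fun z => ENNReal.ofReal (birkhoffProd R w.length z)⁻¹ *
          ENNReal.ofReal (φ z)) (prepend u x) with hΦ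
  set X : Set (List W) := {u | w.length < u.length} with hX
  set mw := massWeight R s A a x f c (g * wordProd s w) (t k) with hmw
  -- A word `u` with `|u| ≤ |w|` may put `ux` into `[wb]` with the help of letters of `x`, without
  -- being of the form `wv` with `v` starting at `b`; such words go to the error term.
  have h1 : ∑' u : headSet b₀, Φ u ≤ ∑' u : shortWords b₀ w.length, Φ u + ∑' u : X, Φ u := by
    refine le_trans (ENNReal.tsum_mono_subtype Φ fun u hu => ?_) (ENNReal.tsum_union_le Φ _ _)
    rcases le_or_gt u.length w.length with hl | hl
    · exact Or.inl ⟨hu, hl⟩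
    · exact Or.inr hl
  have h2 : ∑' u : shortWords b₀ w.length, Φ u ≤ (ENNReal.ofReal C' * ENNReal.ofReal C) *
      ∑' v : shortWords b₀ w.length, massWeight R s A a x f c g (t k) v := by
    rw [← ENNReal.tsum_mul_left]
    refine ENNReal.tsum_le_tsum fun u => ?_
    rw [mul_comm]
    refine mul_le_mul' le_rfl ?_
    by_cases hu : prepend u.1 x ∈ cylinder τ (w ++ [b])
    · rw [indicator_of_mem hu]
      gcongr
      · exact hC' _ hu
      · exact hC _
    · rw [indicator_of_notMem hu]; exact zero_le
  have h3 : ENNReal.ofReal (t k ^ w.length) * ∑' u : X, Φ u ≤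
      ∑' v : headSet b, ENNReal.ofReal (c (w.length + v.1.length) / c v.1.length) * mw v *
        ENNReal.ofReal (φ (prepend w (prepend v x))) := by
    rw [← ENNReal.tsum_mul_left, ← one_mul (∑' v : headSet b, _)]
    refine ENNReal.tsum_le_mul_tsum_of_rel
      (f := fun u => ENNReal.ofReal (t k ^ w.length) * Φ u) (fun u v => u = w ++ v.1) ?_ ?_
    · intro u hu hne
      have hne' : Φ u ≠ 0 := right_ne_zero_of_mul hne
      obtain ⟨hl, hch⟩ := massWeight_ne_zero (left_ne_zero_of_mul hne')
      have hmem : prepend u x ∈ cylinder τ (w ++ [b]) := by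
        by_contra hmem
        exact hne' (by rw [hΦ]; dsimp only; rw [indicator_of_notMem hmem, mul_zero])
      have hpre : ∀ i ≤ w.length, u[i]? = (w ++ [b])[i]? := by
        intro i hi
        have e1 := prepend_seq_eq_getElem? hch (i := i) (by have : w.length < u.length := hu; omega)
        rw [List.getElem?_append_left (by have : w.length < u.length := hu; omega)] at e1
        have e2 := mem_cylinder_iff.1 hmem i (by simp; omega)
        rw [e1, e2, List.getElem?_eq_getElem]
      obtain ⟨v, rfl⟩ : ∃ v, u = w ++ v := by
        refine ⟨u.drop w.length, ?_⟩
        nth_rewrite 1 [← List.take_append_drop w.length u]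
        congr 1
        refine List.ext_getElem? fun i => ?_
        rw [List.getElem?_take]
        split_ifs with hi
        · rw [hpre i hi.le, List.getElem?_append_left hi]
        · rw [List.getElem?_eq_none (by omega)]
      have hv : v ∈ headSet b := by
        have := hpre w.length le_rfl
        rw [List.getElem?_append_right le_rfl, List.getElem?_append_right le_rfl] at this
        simpa [headSet, List.head?_eq_getElem?] using this
      refine ⟨⟨v, hv⟩, rfl, le_of_eq ?_⟩
      have hv' := isChain_append_singleton_of_append hch (head?_append_singleton hv)
      rw [one_mul, hΦ]
      dsimp only
      rw [indicator_of_mem hmem, ← mul_assoc (massWeight _ _ _ _ _ _ _ _ _ _), ← mul_assoc,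
        massWeight_append hw.pos hw.slow.1 ht g hwb hv, prepend_append hch]
    · rintro u - u' - v h h'
      exact h.trans h'.symm
  -- Beyond `N` the ratio of the `c` is at most `δ`; on shorter words submultiplicativity bounds it
  -- by `c |w|`.
  have h4 : ∑' v : headSet b, ENNReal.ofReal (c (w.length + v.1.length) / c v.1.length) * mw v *
        ENNReal.ofReal (φ (prepend w (prepend v x))) ≤
      ENNReal.ofReal δ * ∑' v : headSet b, mw v * ENNReal.ofReal (φ (prepend w (prepend v x))) +
      ENNReal.ofReal (c w.length) * ENNReal.ofReal C * ∑' v : shortWords b N, mw v := by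
    let Ψ : List W → ℝ≥0∞ := fun v => ENNReal.ofReal (c (w.length + v.length) / c v.length) *
      mw v * ENNReal.ofReal (φ (prepend w (prepend v x)))
    have hu : headSet b ⊆ {v | v ∈ headSet b ∧ N < v.length} ∪ shortWords b N := by
      intro v hv
      rcases le_or_gt v.length N with hl | hl
      · exact Or.inr ⟨hv, hl⟩
      · exact Or.inl ⟨hv, hl⟩
    refine (ENNReal.tsum_mono_subtype Ψ hu).trans ((ENNReal.tsum_union_le Ψ _ _).trans
      (add_le_add ?_ ?_))
    · refine ENNReal.tsum_le_mul_tsum_of_injOn (T := headSet b) (f := Ψ)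
        (g := fun v => mw v * ENNReal.ofReal (φ (prepend w (prepend v x)))) id (injOn_id _) ?_
      intro v hv _
      refine ⟨hv.1, ?_⟩
      rw [← mul_assoc]
      simp only [Ψ, id]
      gcongr
      exact hN _ hv.2
    · refine ENNReal.tsum_le_mul_tsum_of_injOn (T := shortWords b N) (f := Ψ)
        (g := mw) id (injOn_id _) ?_
      intro v hv _
      refine ⟨hv, ?_⟩
      calc Ψ v ≤ ENNReal.ofReal (c w.length) * mw v * ENNReal.ofReal C := by
            simp only [Ψ]
            gcongr
            · rw [div_le_iff₀ (hw.slow.1 _)]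
              exact hw.submul _ _
            · exact hC _
        _ = _ := by simp only [id]; ring
  calc _ ≤ ENNReal.ofReal (t k ^ w.length) *
          (∑' u : shortWords b₀ w.length, Φ u + ∑' u : X, Φ u) := by
        gcongr
    _ = ENNReal.ofReal (t k ^ w.length) * ∑' u : X, Φ u + ENNReal.ofReal (t k ^ w.length) *
        ∑' u : shortWords b₀ w.length, Φ u := by rw [mul_add, add_comm]
    _ ≤ _ := by
        rw [← add_assoc]
        refine add_le_add (h3.trans h4) ?_
        rw [mul_assoc (ENNReal.ofReal (t k ^ w.length))]
        gcongr

/-- The transfer identity for the limit measures. -/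
lemma IsWeightSetting.transfer_identity (hw : IsWeightSetting R K c) (hRc : Continuous R)
    (h : IsApproxSeq R s A a x f c γ t) {μ : G → Measure (MarkovShift τ)}
    (hμ : ∀ g, WeakStarTendsto (fun k => approxMeasure R s A a x H f c g (t k)) (μ g))
    {w : List W} {b : W} (hwb : (w ++ [b]).IsChain τ) (g : G) {φ : MarkovShift τ → ℝ}
    (hφ : Continuous φ) (hφ0 : ∀ z, 0 ≤ φ z) {C : ℝ} (hC : ∀ z, φ z ≤ C) :
    ENNReal.ofReal (γ ^ w.length) * ∫⁻ z in cylinder τ (w ++ [b]),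
        ENNReal.ofReal (birkhoffProd R w.length z)⁻¹ * ENNReal.ofReal (φ z) ∂(μ g) =
      ∫⁻ z in cylinder τ [b], ENNReal.ofReal (φ (prepend w z)) ∂(μ (g * wordProd s w)) := by
  obtain ⟨b₀, hb₀⟩ : ∃ b₀, (w ++ [b]).head? = some b₀ := by
    cases w with
    | nil => exact ⟨b, rfl⟩
    | cons d w => exact ⟨d, rfl⟩
  obtain ⟨C', hC'⟩ := hw.exists_inv_birkhoffProd_le w b
  set ψ : MarkovShift τ → ℝ := (cylinder τ (w ++ [b])).indicator
    fun z => (birkhoffProd R w.length z)⁻¹ * φ z with hψ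
  have hψof : ∀ z, ENNReal.ofReal (ψ z) = (cylinder τ (w ++ [b])).indicator
      (fun z => ENNReal.ofReal (birkhoffProd R w.length z)⁻¹ * ENNReal.ofReal (φ z)) z := by
    intro z
    by_cases hz : z ∈ cylinder τ (w ++ [b])
    · rw [hψ, indicator_of_mem hz, indicator_of_mem hz,
        ENNReal.ofReal_mul (inv_nonneg.2 (birkhoffProd_pos hw.pos _ _).le)]
    · rw [hψ, indicator_of_notMem hz, indicator_of_notMem hz, ENNReal.ofReal_zero]
  have hψc : Continuous ψ := (isClopen_cylinder _).continuous_indicator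
    (((continuous_birkhoffProd hRc _).inv₀ fun z => (birkhoffProd_pos hw.pos _ z).ne').mul hφ)
  have hψ0 : ∀ z, 0 ≤ ψ z := fun z => indicator_nonneg (fun z _ =>
    mul_nonneg (inv_nonneg.2 (birkhoffProd_pos hw.pos _ _).le) (hφ0 z)) z
  have hψC : ∀ z, ψ z ≤ |C'| * |C| := by
    intro z
    by_cases hz : z ∈ cylinder τ (w ++ [b])
    · rw [hψ, indicator_of_mem hz]
      exact mul_le_mul ((hC' z hz).trans (le_abs_self _)) ((hC z).trans (le_abs_self _)) (hφ0 z)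
        (abs_nonneg _)
    · rw [hψ, indicator_of_notMem hz]; positivity
  have hsubset : cylinder τ (w ++ [b]) ⊆ cylinder τ [b₀] := by
    intro z hz
    rw [mem_cylinder_singleton]
    refine hz 0 b₀ ?_
    rw [← List.head?_eq_getElem?, hb₀]
  have hlim1 := (hμ g).tendsto_setLIntegral b₀ hψc hψ0 hψC
  have hlim2 := (hμ (g * wordProd s w)).tendsto_setLIntegral b
    (hφ.comp (continuous_prepend w)) (fun z => hφ0 _) (fun z => hC _)
  simp only [hψof] at hlim1
  simp only [Function.comp_apply] at hlim2
  have hLeq : ∫⁻ z in cylinder τ [b₀], (cylinder τ (w ++ [b])).indicator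
      (fun z => ENNReal.ofReal (birkhoffProd R w.length z)⁻¹ * ENNReal.ofReal (φ z)) z ∂(μ g) =
      ∫⁻ z in cylinder τ (w ++ [b]),
        ENNReal.ofReal (birkhoffProd R w.length z)⁻¹ * ENNReal.ofReal (φ z) ∂(μ g) := by
    rw [lintegral_indicator (measurableSet_cylinder _),
      Measure.restrict_restrict (measurableSet_cylinder _), inter_eq_self_of_subset_left hsubset]
  rw [hLeq] at hlim1
  set L := ∫⁻ z in cylinder τ (w ++ [b]),
    ENNReal.ofReal (birkhoffProd R w.length z)⁻¹ * ENNReal.ofReal (φ z) ∂(μ g) with hL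
  set D := ∫⁻ z in cylinder τ [b], ENNReal.ofReal (φ (prepend w z)) ∂(μ (g * wordProd s w)) with hD
  have hLtop : L ≠ ∞ := by
    rw [← hLeq]
    simp only [← hψof]
    have := (hμ g).2.1.isFiniteMeasure_restrict (w := [b₀]) (by simp)
    refine ne_top_of_le_ne_top ?_ (lintegral_mono fun z => ENNReal.ofReal_le_ofReal (hψC z))
    rw [lintegral_const]
    exact ENNReal.mul_ne_top ENNReal.ofReal_ne_top (measure_ne_top _ _)
  have htγ : Tendsto (fun k => ENNReal.ofReal (t k ^ w.length)) atTop
      (𝓝 (ENNReal.ofReal (γ ^ w.length))) := ENNReal.tendsto_ofReal (h.tendsto.pow _)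
  have hlim3 := ENNReal.Tendsto.mul htγ (Or.inr hLtop) hlim1 (Or.inr ENNReal.ofReal_ne_top)
  refine le_antisymm ?_ (le_of_tendsto_of_tendsto' hlim2 hlim3
    fun k => hw.setLIntegral_le_transfer h hwb hb₀ g φ k)
  -- First `k → ∞` with `δ` and `N` fixed, which kills both short-word errors; then `δ` decreases to
  -- `1`.
  have hδ : ∀ δ : ℝ, 1 < δ → ENNReal.ofReal (γ ^ w.length) * L ≤ ENNReal.ofReal δ * D := by
    intro δ hδ
    obtain ⟨N, hN⟩ := eventually_atTop.1 ((hw.slow.2.2.2 w.length).eventually (ge_mem_nhds hδ))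
    have hN' : ∀ n > N, c (w.length + n) / c n ≤ δ := fun n hn => by
      rw [add_comm]; exact hN n hn.le
    have e1 := ENNReal.Tendsto.const_mul (h.tendsto_tsum_massWeight hw.slow.1 _
      (hw.tsum_shortWords_ne_top b N γ) (g * wordProd s w))
      (Or.inr (ENNReal.mul_ne_top ENNReal.ofReal_ne_top ENNReal.ofReal_ne_top) :
        _ ∨ ENNReal.ofReal (c w.length) * ENNReal.ofReal C ≠ ∞)
    have e2 := ENNReal.Tendsto.mul
      (ENNReal.Tendsto.mul_const htγ (Or.inr (ENNReal.mul_ne_top ENNReal.ofReal_ne_top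
        ENNReal.ofReal_ne_top) : _ ∨ ENNReal.ofReal C' * ENNReal.ofReal C ≠ ∞))
      (Or.inr ENNReal.zero_ne_top)
      (h.tendsto_tsum_massWeight hw.slow.1 _ (hw.tsum_shortWords_ne_top b₀ w.length γ) g)
      (Or.inr (ENNReal.mul_ne_top ENNReal.ofReal_ne_top
        (ENNReal.mul_ne_top ENNReal.ofReal_ne_top ENNReal.ofReal_ne_top)))
    have e3 := (ENNReal.Tendsto.const_mul hlim2
      (Or.inr ENNReal.ofReal_ne_top : _ ∨ ENNReal.ofReal δ ≠ ∞)).add (e1.add e2)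
    rw [mul_zero, mul_zero, add_zero, add_zero] at e3
    exact le_of_tendsto_of_tendsto' hlim3 e3
      fun k => hw.transfer_le_setLIntegral h hwb g hC hC' hN' k
  have hlimδ : Tendsto (fun δ : ℝ => ENNReal.ofReal δ * D) (𝓝[>] 1) (𝓝 (ENNReal.ofReal 1 * D)) :=
    ENNReal.Tendsto.mul_const (ENNReal.tendsto_ofReal tendsto_id |>.mono_left nhdsWithin_le_nhds)
      (Or.inl (by simp))
  rw [ENNReal.ofReal_one, one_mul] at hlimδ
  exact ge_of_tendsto hlimδ (eventually_mem_nhdsWithin.mono fun δ hδ' => hδ δ hδ')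

end TransferIdentity

end MarkovShift

namespace MarkovShift

/-! ### The approximating sequence of parameters. -/

section Existence

variable {W : Type*} {τ : W → W → Prop}
  {R : MarkovShift τ → ℝ} {A a : W} {x : MarkovShift τ}
  {G ι : Type*} [Group G] {s : W → G} {H : ι → Subgroup G} {f : QuotSum H} {c : ℕ → ℝ}
  {t : ℕ → ℝ} {K γ : ℝ}

/-- Some truncation at `γ` has energy above `4k`. It involves finitely many lengths, so for `r`
close to `γ` its coefficients change by a factor at most `2`, hence the energy by at most `4`. -/
lemma exists_le_pathEnergy (hc0 : ∀ n, 0 < c n) (hγ : 0 < γ)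
    (htop : pathEnergy R s A a x f (coeff c γ) = ∞) (k : ℕ) {δ : ℝ} (hδ : 0 < δ) :
    ∃ r, γ < r ∧ r ≤ γ + δ ∧ (k : ℝ≥0∞) ≤ pathEnergy R s A a x f (coeff c r) := by
  rw [pathEnergy_eq_iSup] at htop
  obtain ⟨N, hN⟩ := lt_iSup_iff.1 (htop ▸ ENNReal.natCast_lt_top (4 * k))
  have hcont : Tendsto (fun r : ℝ => (r / γ) ^ N) (𝓝[>] γ) (𝓝 1) := by
    have : ContinuousAt (fun r : ℝ => (r / γ) ^ N) γ := by fun_prop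
    simpa [div_self hγ.ne'] using this.tendsto.mono_left nhdsWithin_le_nhds
  obtain ⟨r, ⟨hr2, hrδ⟩, hr⟩ := ((hcont.eventually (ge_mem_nhds one_lt_two)).and
    (mem_nhdsWithin_of_mem_nhds (ge_mem_nhds (lt_add_of_pos_right γ hδ))) |>.and
    self_mem_nhdsWithin).exists
  have hr : γ < r := hr
  have hr0 : 0 < r := hγ.trans hr
  refine ⟨r, hr, hrδ, ?_⟩
  have hle : ∀ n, truncate (coeff c γ) N n ≤ 2 * coeff c r n := by
    intro n
    unfold truncate
    split_ifs with hn
    · rw [coeff, coeff, show (2 : ℝ≥0∞) = ENNReal.ofReal 2 by simp,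
        ← ENNReal.ofReal_mul zero_le_two]
      refine ENNReal.ofReal_le_ofReal ?_
      have h1 : (r / γ) ^ n ≤ 2 :=
        (pow_le_pow_right₀ ((one_le_div hγ).2 hr.le) hn).trans hr2
      have h2 : (γ ^ n)⁻¹ = (r / γ) ^ n * (r ^ n)⁻¹ := by
        rw [div_pow]; field_simp
      rw [h2, mul_assoc]
      have := hc0 n
      gcongr
    · exact zero_le
  have h4 := hN.le.trans (pathEnergy_mono hle)
  rw [pathEnergy_const_mul] at h4
  have h5 : (4 : ℝ≥0∞) * k ≤ 4 * pathEnergy R s A a x f (coeff c r) := by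
    refine le_trans (le_of_eq (by push_cast; ring)) (h4.trans (le_of_eq (by norm_num)))
  exact (ENNReal.mul_le_mul_iff_right (by norm_num) (by norm_num)).1 h5

/-- Existence of the approximating sequence. -/
lemma exists_isApproxSeq {M : ℝ≥0∞} (hpos : ∀ z, 0 < R z) (hax : τ a (x.seq 0)) (hM : M ≠ ∞)
    (hle : ∀ n, ∑' v : wordsFrom A n, wordWeight R x v ≤ M) (hf : ∀ y, 0 ≤ f y) (hf0 : f ≠ 0)
    (hγ : 0 < decayExponent R s A a x H f) (hc : IsSlowlyIncreasing c)
    (htop : pathEnergy R s A a x f (coeff c (decayExponent R s A a x H f)) = ∞) :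
    ∃ t, IsApproxSeq R s A a x f c (decayExponent R s A a x H f) t ∧
      ∀ k g, Summable fun n : ℕ => densityTerm R s A a x c (t k) g (n + 1) := by
  set γ := decayExponent R s A a x H f with hγd
  have hch : ∀ k : ℕ, ∃ r, γ < r ∧ r ≤ γ + 1 / ((k : ℝ) + 1) ∧
      ((k + 1 : ℕ) : ℝ≥0∞) ≤ pathEnergy R s A a x f (coeff c r) :=
    fun k => exists_le_pathEnergy hc.1 hγ htop (k + 1) (by positivity)
  choose t hlt hle' hE using hch
  have ht0 : ∀ k, 0 < t k := fun k => hγ.trans (hlt k)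
  have hfin : ∀ k, pathEnergy R s A a x f (coeff c (t k)) ≠ ∞ := fun k =>
    pathEnergy_ne_top_of_decayExponent_lt hpos hax hM hle hf hc (hlt k)
  have hpush := fun k => isPushWeight_density hpos hax (fun n => (hc.1 n).le) (ht0 k) hf hf0
    (tsum_pathWeight_single_ne_top hM hle) (hfin k)
  have hsum := fun k => (hpush k).2.summable_of_energy_ne_top hf (hfin k)
  have hin : ∀ k : ℕ, ((k : ℝ) + 1) ≤ inner ℝ (densityVec R s A a x H f c (t k))
      (densityVec R s A a x H f c (t k)) := by
    intro k
    have h1 := (hpush k).2.ofReal_inner_self hf (hsum k)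
    have h2 := hE k
    rw [pathEnergy, ← h1] at h2
    have h3 := ENNReal.toReal_mono ENNReal.ofReal_ne_top h2
    rw [ENNReal.toReal_ofReal real_inner_self_nonneg] at h3
    rw [ENNReal.toReal_natCast] at h3
    push_cast at h3
    exact h3
  refine ⟨t, ⟨hax, hf, hγ, hlt, fun k => (hle' k).trans ?_, ?_, fun k => ⟨ht0 k, (hpush k).2,
    hsum k, lt_of_lt_of_le (by positivity) (hin k)⟩, ?_⟩, fun k => (hpush k).1⟩
  · gcongr
    rw [div_le_one (by positivity)]
    linarith [Nat.cast_nonneg (α := ℝ) k]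
  · have h := (tendsto_const_nhds (x := γ)).add tendsto_one_div_add_atTop_nhds_zero_nat
    rw [add_zero] at h
    exact tendsto_of_tendsto_of_tendsto_of_le_of_le tendsto_const_nhds h (fun k => (hlt k).le) hle'
  · have h := Real.tendsto_sqrt_atTop.comp
      (tendsto_atTop_add_const_right atTop (1 : ℝ) tendsto_natCast_atTop_atTop)
    refine tendsto_atTop_mono (fun k => ?_) h
    refine Real.sqrt_le_iff.2 ⟨norm_nonneg _, ?_⟩
    rw [← real_inner_self_eq_norm_sq]
    exact hin k

end Existence

/-! ### Limit measures, matrix coefficients and the twist formula. -/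

section Limits

variable {W : Type*} {τ : W → W → Prop}

lemma pairwise_disjoint_cylinder_singleton :
    Pairwise (Function.onFun Disjoint fun b : W => cylinder τ [b]) := by
  intro b d hbd
  refine Set.disjoint_left.2 fun z hz hz' => hbd ?_
  exact (mem_cylinder_singleton.1 hz).symm.trans (mem_cylinder_singleton.1 hz')

lemma iUnion_cylinder_singleton : ⋃ b : W, cylinder τ [b] = univ :=
  eq_univ_of_forall fun _ => mem_iUnion.2 ⟨_, mem_cylinder_singleton.2 rfl⟩

lemma cylinder_subset_cylinder_head {w : List W} (hw : w ≠ []) :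
    cylinder τ w ⊆ cylinder τ [w.head hw] := by
  intro z hz
  rw [mem_cylinder_singleton]
  exact hz 0 _ (by rw [← List.head?_eq_getElem?, List.head?_eq_some_head])

variable [TopologicalSpace W]

lemma finiteOnCylinders_of_singleton {m : Measure (MarkovShift τ)}
    (h : ∀ b : W, m (cylinder τ [b]) < ∞) : FiniteOnCylinders m :=
  fun _ hw => (measure_mono (cylinder_subset_cylinder_head hw)).trans_lt (h _)

variable [DiscreteTopology W]

/-- The measure glued from measures on the one-letter cylinders. -/
noncomputable def glue (L : W → Measure (MarkovShift τ)) : Measure (MarkovShift τ) :=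
  Measure.sum fun b => (L b).restrict (cylinder τ [b])

lemma glue_restrict (L : W → Measure (MarkovShift τ)) (b : W) :
    (glue L).restrict (cylinder τ [b]) = (L b).restrict (cylinder τ [b]) := by
  ext S hS
  rw [glue, Measure.restrict_apply hS, Measure.sum_apply _ (hS.inter (measurableSet_cylinder _)),
    tsum_eq_single b, Measure.restrict_apply (hS.inter (measurableSet_cylinder _)),
    Measure.restrict_apply hS, inter_assoc, inter_self]
  intro d hd
  rw [Measure.restrict_apply (hS.inter (measurableSet_cylinder _)), inter_assoc,
    (pairwise_disjoint_cylinder_singleton hd.symm).inter_eq, inter_empty, measure_empty]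

/-- The product of a test function with the indicator function of a one-letter cylinder. -/
noncomputable def cutoff (b : W) (F : MarkovShift τ →ᵇ ℝ) : MarkovShift τ →ᵇ ℝ :=
  BoundedContinuousFunction.ofNormedAddCommGroup ((cylinder τ [b]).indicator F)
    (F.continuous.indicator fun z hz => by
      rw [(isClopen_cylinder [b]).frontier_eq] at hz; exact hz.elim) ‖F‖
    fun z => (norm_indicator_le_norm_self _ _).trans (F.norm_coe_le_norm z)

lemma integral_cutoff (m : Measure (MarkovShift τ)) (b : W) (F : MarkovShift τ →ᵇ ℝ) :
    ∫ z, cutoff b F z ∂m = ∫ z in cylinder τ [b], F z ∂m :=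
  integral_indicator (measurableSet_cylinder _)

variable [Countable W] {R : MarkovShift τ → ℝ} {A a : W} {x : MarkovShift τ}
  {G ι : Type*} [Group G] {s : W → G} {H : ι → Subgroup G} {f : QuotSum H} {c : ℕ → ℝ}
  {t : ℕ → ℝ} {K γ : ℝ}

lemma IsWeightSetting.finiteOnCylinders_approxMeasure (hw : IsWeightSetting R K c)
    (h : IsApproxSeq R s A a x f c γ t) (g : G) (k : ℕ) :
    FiniteOnCylinders (approxMeasure R s A a x H f c g (t k)) := by
  refine finiteOnCylinders_of_singleton fun b => ?_
  obtain ⟨M, hM, hle⟩ := hw.exists_tsum_massWeight_le h b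
  rw [approxMeasure_cylinder h.adm hw.pos hw.slow.1 (h.regular k).pos]
  exact (hle k g).trans_lt hM.lt_top

/-- Simultaneous convergence along a subsequence. -/
lemma IsWeightSetting.exists_weakStarTendsto [Countable G] (hw : IsWeightSetting R K c)
    (h : IsApproxSeq R s A a x f c γ t)
    (htight : ∀ (g : G) (b : W), IsTightMeasureSet (range fun k =>
      (approxMeasure R s A a x H f c g (t k)).restrict (cylinder τ [b]))) :
    ∃ φ : ℕ → ℕ, StrictMono φ ∧ ∃ μ : G → Measure (MarkovShift τ),
      ∀ g, WeakStarTendsto (fun k => approxMeasure R s A a x H f c g ((t ∘ φ) k)) (μ g) := by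
  choose M hM hle using fun b => hw.exists_tsum_massWeight_le h b
  have : Nonempty (MarkovShift τ) := ⟨x⟩
  obtain ⟨φ, hφ, L, hL, hlim⟩ := exists_subseq_tendsto_integral
    (fun (i : G × W) k => (approxMeasure R s A a x H f c i.1 (t k)).restrict (cylinder τ [i.2]))
    (fun i => M i.2) (fun i => hM i.2) (fun i k => by
      rw [Measure.restrict_apply_univ,
        approxMeasure_cylinder h.adm hw.pos hw.slow.1 (h.regular k).pos]
      exact hle i.2 k i.1) (fun i => htight i.1 i.2)
  refine ⟨φ, hφ, fun g => glue fun b => L (g, b), fun g => ⟨fun k =>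
    hw.finiteOnCylinders_approxMeasure (h.comp hφ) g k, ?_, fun b F => ?_⟩⟩
  · refine finiteOnCylinders_of_singleton fun b => ?_
    rw [← Measure.restrict_apply_univ, glue_restrict]
    exact measure_lt_top _ _
  · have := hlim (g, b) (cutoff b F)
    simp only [integral_cutoff, Measure.restrict_restrict (measurableSet_cylinder _),
      inter_self] at this
    rw [glue_restrict]
    exact this

variable {μ : G → Measure (MarkovShift τ)}

/-- The mass of `[A]` is a matrix coefficient. -/
lemma IsWeightSetting.approxMeasure_cylinder_self (hw : IsWeightSetting R K c)
    (h : IsApproxSeq R s A a x f c γ t) (g : G) (k : ℕ) :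
    approxMeasure R s A a x H f c g (t k) (cylinder τ [A]) =
      ENNReal.ofReal (inner ℝ (quotRep H g (densityVec R s A a x H f c (t k)))
              (densityVec R s A a x H f c (t k)) /
            inner ℝ (densityVec R s A a x H f c (t k)) (densityVec R s A a x H f c (t k))) := by
  have hr := h.regular k
  rw [approxMeasure_cylinder h.adm hw.pos hw.slow.1 hr.pos]
  simp only [massWeight_eq_mul_div hr, ENNReal.tsum_mul_right]
  rw [ENNReal.ofReal_div_of_pos hr.inner_pos, div_eq_mul_inv, inner_quotRep_left]
  congr 1
  -- Words in `[A]` ending in `a` are exactly those whose weighted vectors sum to `Q`.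
  have key := hr.push.tsum_inner h.nonneg hr.summable
    (P := quotRep H g⁻¹ (densityVec R s A a x H f c (t k)))
    fun y => hr.densityVec_nonneg h.nonneg _
  refine Eq.trans ?_ key
  rw [tsum_subtype (headSet A) fun v => endWeight R a x (coeff c (t k)) v *
    ENNReal.ofReal (inner ℝ (quotRep H (wordProd s v) f)
      (quotRep H g⁻¹ (densityVec R s A a x H f c (t k))))]
  refine tsum_congr fun v => ?_
  by_cases hv : v ∈ headSet A
  · rw [indicator_of_mem hv, endWeight_of_mem_headSet hv]
  · rw [indicator_of_notMem hv, pathWeight_of_notMem fun h' => hv h'.1, zero_mul]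

/-- Convergence of the matrix coefficients. -/
lemma IsWeightSetting.tendsto_inner (hw : IsWeightSetting R K c)
    (h : IsApproxSeq R s A a x f c γ t)
    (hμ : ∀ g, WeakStarTendsto (fun k => approxMeasure R s A a x H f c g (t k)) (μ g)) (g : G) :
    Tendsto (fun k => inner ℝ (quotRep H g (densityVec R s A a x H f c (t k)))
          (densityVec R s A a x H f c (t k)) /
        inner ℝ (densityVec R s A a x H f c (t k)) (densityVec R s A a x H f c (t k)))
      atTop (𝓝 (μ g (cylinder τ [A])).toReal) := by
  have h1 := (hμ g).tendsto_setLIntegral A (φ := fun _ => 1) continuous_const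
    (fun _ => zero_le_one) (C := 1) (fun _ => le_rfl)
  simp only [ENNReal.ofReal_one, lintegral_one, Measure.restrict_apply_univ] at h1
  have h2 := (ENNReal.tendsto_toReal ((hμ g).2.1 [A] (by simp)).ne).comp h1
  refine h2.congr fun k => ?_
  rw [Function.comp_apply, hw.approxMeasure_cylinder_self h, ENNReal.toReal_ofReal]
  refine div_nonneg ?_ (h.regular k).inner_pos.le
  exact inner_nonneg_of_nonneg (fun y => (h.regular k).densityVec_nonneg h.nonneg _)
    ((h.regular k).densityVec_nonneg h.nonneg)

/-- The twist formula on the cylinders `[wA]`. -/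
lemma IsWeightSetting.twist_formula (hw : IsWeightSetting R K c) (hRc : Continuous R)
    (h : IsApproxSeq R s A a x f c γ t)
    (hμ : ∀ g, WeakStarTendsto (fun k => approxMeasure R s A a x H f c g (t k)) (μ g))
    {w : List W} {b : W} (hwb : (w ++ [b]).IsChain τ) :
    IntegrableOn (fun z => (birkhoffProd R w.length z)⁻¹) (cylinder τ (w ++ [b])) (μ 1) ∧
      γ ^ w.length * ∫ z in cylinder τ (w ++ [b]), (birkhoffProd R w.length z)⁻¹ ∂(μ 1) =
        (μ (wordProd s w) (cylinder τ [b])).toReal := by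
  have hpos := fun z => birkhoffProd_pos hw.pos w.length z
  have hcont : Continuous fun z => (birkhoffProd R w.length z)⁻¹ :=
    (continuous_birkhoffProd hRc _).inv₀ fun z => (hpos z).ne'
  have hfin := (hμ 1).2.1.isFiniteMeasure_restrict (w := w ++ [b]) (by simp)
  obtain ⟨C, hC⟩ := hw.exists_inv_birkhoffProd_le w b
  have hintOn : IntegrableOn (fun z => (birkhoffProd R w.length z)⁻¹) (cylinder τ (w ++ [b]))
      (μ 1) := by
    refine Integrable.of_bound hcont.aestronglyMeasurable C ?_
    refine (ae_restrict_iff' (measurableSet_cylinder _)).2 (Eventually.of_forall fun z hz => ?_)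
    rw [Real.norm_of_nonneg (inv_pos.2 (hpos z)).le]
    exact hC z hz
  refine ⟨hintOn, ?_⟩
  -- The test function `1` at `g = 1`: the right-hand side becomes the mass of `[b]` for the twist
  -- `𝔰(w)`.
  have key := hw.transfer_identity hRc h hμ hwb 1 (φ := fun _ => 1) continuous_const
    (fun _ => zero_le_one) (C := 1) (fun _ => le_rfl)
  simp only [ENNReal.ofReal_one, mul_one, one_mul, lintegral_one,
    Measure.restrict_apply_univ] at key
  rw [← key, ENNReal.toReal_mul, ENNReal.toReal_ofReal (pow_nonneg h.pos.le _),
    integral_eq_lintegral_of_nonneg_ae (Eventually.of_forall fun z => (inv_pos.2 (hpos z)).le)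
      hcont.aestronglyMeasurable]

end Limits

end MarkovShift

namespace MarkovShift

/-! ### Absolute continuity and the cocycle under transitivity. -/

section Cocycle

variable {W : Type*} {τ : W → W → Prop}
  {R : MarkovShift τ → ℝ} {A a : W} {x : MarkovShift τ}
  {G ι : Type*} [Group G] {s : W → G} {H : ι → Subgroup G} {f : QuotSum H} {c : ℕ → ℝ}
  {t : ℕ → ℝ} {K γ : ℝ}

lemma skewProduct_iterate (z : MarkovShift τ) (g : G) (n : ℕ) :
    (skewProduct s)^[n] (z, g) = (shift^[n] z, (wordProd s (initWord z n))⁻¹ * g) := by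
  induction n with
  | zero => simp [initWord, wordProd]
  | succ n ih =>
    rw [Function.iterate_succ_apply', ih, skewProduct, Function.iterate_succ_apply',
      ← initWord_append, wordProd_append, shift_iterate_seq, zero_add]
    simp [wordProd, mul_assoc]

/-- For a word `p` joining `A` to `A`, the vector `ρ(𝔰(p)) Q` is dominated by `Q`. -/
lemma IsWeightSetting.exists_quotRep_wordProd_le (hw : IsWeightSetting R K c)
    (h : IsApproxSeq R s A a x f c γ t) {p : List W} (hp : (p ++ [A]).IsChain τ)
    (hpA : (p ++ [A]).head? = some A) :
    ∃ C : ℝ≥0∞, C ≠ ∞ ∧ ∀ k (y : Σ j : ι, G ⧸ H j),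
      ENNReal.ofReal (quotRep H (wordProd s p) (densityVec R s A a x H f c (t k)) y) ≤
        C * ENNReal.ofReal (densityVec R s A a x H f c (t k) y) := by
  obtain ⟨z, rfl⟩ := hw.mixing.exists_seq_zero_eq A
  refine ⟨ENNReal.ofReal ((γ + 1) ^ p.length) * (ENNReal.ofReal K / wordWeight R z p),
    ENNReal.mul_ne_top ENNReal.ofReal_ne_top (div_wordWeight_ne_top hw.pos hp K), fun k y => ?_⟩
  have hr := h.regular k
  rw [quotRep_apply_apply, densityVec, (hr.push.repConv_apply h.nonneg hr.summable _).2,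
    (hr.push.repConv_apply h.nonneg hr.summable _).2, weightedSum, weightedSum]
  -- Since `p` is a loop at `A`, the map `v ↦ pv` injects the words summed in `Q` into themselves,
  -- with weights comparable uniformly for `t_k ≤ γ + 1`.
  have key := ENNReal.tsum_le_mul_tsum_of_rel (S := univ)
    (f := fun v => pathWeight R (z.seq 0) a x (coeff c (t k)) v *
      ENNReal.ofReal (quotRep H (wordProd s v) f ((wordProd s p)⁻¹ • y)))
    (g := fun v => pathWeight R (z.seq 0) a x (coeff c (t k)) v *
      ENNReal.ofReal (quotRep H (wordProd s v) f y))
    (C := ENNReal.ofReal ((γ + 1) ^ p.length) * (ENNReal.ofReal K / wordWeight R z p))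
    (fun v u => u = p ++ v) ?_ ?_
  · rw [tsum_univ (fun v => pathWeight R (z.seq 0) a x (coeff c (t k)) v *
      ENNReal.ofReal (quotRep H (wordProd s v) f ((wordProd s p)⁻¹ • y)))] at key
    exact key
  · rintro v - hne
    have hv : v ∈ headSet (z.seq 0) := by
      by_contra hv
      exact hne (by rw [pathWeight_of_notMem fun h' => hv h'.1, zero_mul])
    have hpv : p ++ v ∈ headSet (z.seq 0) := by
      cases p with
      | nil => exact hv
      | cons d p => exact hpA
    refine ⟨_, rfl, ?_⟩
    rw [← endWeight_of_mem_headSet hv, ← endWeight_of_mem_headSet hpv, ← mul_assoc,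
      wordProd_append, quotRep_mul_apply, quotRep_apply_apply (wordProd s p)]
    gcongr
    refine (endWeight_le_prepend hw.distortion hw.one_le hw.pos hw.slow.2.1 hr.pos hp hv).trans ?_
    gcongr
    · exact hr.pos.le
    · exact h.le k
  · rintro v - v' - u rfl h'
    exact List.append_cancel_left h'

/-- Domination of the masses. -/
lemma IsApproxSeq.massWeight_le_mul (h : IsApproxSeq R s A a x f c γ t) {g : G} {C : ℝ≥0∞} {k : ℕ}
    (hC : ∀ y : Σ j : ι, G ⧸ H j,
      ENNReal.ofReal (quotRep H g⁻¹ (densityVec R s A a x H f c (t k)) y) ≤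
        C * ENNReal.ofReal (densityVec R s A a x H f c (t k) y)) (v : List W) :
    massWeight R s A a x f c g (t k) v ≤ C * massWeight R s A a x f c 1 (t k) v := by
  have hr := h.regular k
  have hQ := hr.densityVec_nonneg h.nonneg
  have h1 : ENNReal.ofReal (inner ℝ (quotRep H (wordProd s v) f)
        (quotRep H g⁻¹ (densityVec R s A a x H f c (t k)))) ≤
      C * ENNReal.ofReal (inner ℝ (quotRep H (wordProd s v) f)
        (quotRep H 1⁻¹ (densityVec R s A a x H f c (t k)))) := by
    have hs : ∀ y, 0 ≤ quotRep H (wordProd s v) f y := fun y => h.nonneg _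
    have hg : ∀ (g : G) y, 0 ≤ quotRep H g (densityVec R s A a x H f c (t k)) y := fun g y => hQ _
    rw [ofReal_inner_eq_tsum hs (hg _), ofReal_inner_eq_tsum hs (hg _), ← ENNReal.tsum_mul_left]
    refine ENNReal.tsum_le_tsum fun y => ?_
    rw [mul_left_comm]
    gcongr
    simpa using hC y
  rw [massWeight_eq_mul_div hr, massWeight_eq_mul_div hr, ← mul_assoc, mul_left_comm C]
  gcongr

variable [TopologicalSpace W]

lemma FiniteOnCylinders.sigmaFinite [Countable W] {m : Measure (MarkovShift τ)}
    (hm : FiniteOnCylinders m) : SigmaFinite m := by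
  refine Measure.sigmaFinite_of_countable (countable_range fun b : W => cylinder τ [b]) ?_ ?_
  · rintro _ ⟨b, rfl⟩
    exact hm [b] (by simp)
  · rw [sUnion_range, iUnion_cylinder_singleton]

variable [DiscreteTopology W]

lemma IsTransitiveExtension.exists_word (h : IsTransitiveExtension τ s) (hmix : IsMixing τ)
    (A : W) (g : G) :
    ∃ p : List W, (p ++ [A]).IsChain τ ∧ (p ++ [A]).head? = some A ∧ wordProd s p = g := by
  obtain ⟨y, hy⟩ := hmix.exists_seq_zero_eq A
  have ho := (isClopen_cylinder (τ := τ) [A]).isOpen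
  have hne : (cylinder τ [A]).Nonempty := ⟨y, mem_cylinder_singleton.2 hy⟩
  -- Going from level `g` to level `1` makes the word product equal to `g`.
  obtain ⟨n, z, hz, h1, h2⟩ := h _ _ ho ho hne hne g 1
  rw [skewProduct_iterate] at h1 h2
  rw [mem_cylinder_singleton] at hz
  have h1 : z.seq n = A := by simpa [shift_iterate_seq] using mem_cylinder_singleton.1 h1
  refine ⟨initWord z n, ?_, ?_, (inv_mul_eq_one.1 h2)⟩
  · rw [← h1, initWord_append]; exact isChain_initWord _ _
  · rw [← h1, initWord_append, head?_initWord_succ, hz, h1]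

variable [Countable W] {μ : G → Measure (MarkovShift τ)}

/-- Continuous approximations of closed sets from above transfer the inequality to closed sets, and
inner regularity extends nullity to Borel sets. -/
lemma absolutelyContinuous_of_forall_lintegral_le {m m' : Measure (MarkovShift τ)}
    [IsFiniteMeasure m] [IsFiniteMeasure m'] {C : ℝ≥0∞} (hC : C ≠ ∞)
    (h : ∀ F : MarkovShift τ →ᵇ NNReal, ∫⁻ z, F z ∂m ≤ C * ∫⁻ z, F z ∂m') : m ≪ m' := by
  refine Measure.AbsolutelyContinuous.mk fun S hS h0 => ?_
  rw [hS.measure_eq_iSup_isClosed_of_ne_top (measure_ne_top _ _)]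
  simp only [ENNReal.iSup_eq_zero]
  intro F hFS hF
  have h1 := HasOuterApproxClosed.tendsto_lintegral_apprSeq hF m
  have h2 := ENNReal.Tendsto.const_mul (HasOuterApproxClosed.tendsto_lintegral_apprSeq hF m')
    (a := C) (Or.inr hC)
  have h3 := le_of_tendsto_of_tendsto' h1 h2 fun n => h _
  rw [measure_mono_null hFS h0, mul_zero] at h3
  exact le_antisymm h3 zero_le

/-- Under transitivity of the extension the limit measures are dominated by the one at `1`. -/
lemma IsWeightSetting.absolutelyContinuous (hw : IsWeightSetting R K c)
    (h : IsApproxSeq R s A a x f c γ t)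
    (hμ : ∀ g, WeakStarTendsto (fun k => approxMeasure R s A a x H f c g (t k)) (μ g))
    (htr : IsTransitiveExtension τ s) (g : G) : μ g ≪ μ 1 := by
  -- The inverse, because the masses for `g` pair with `ρ(g)⁻¹ Q`.
  obtain ⟨p, hp, hpA, hpg⟩ := htr.exists_word hw.mixing A g⁻¹
  obtain ⟨C, hC, hle⟩ := hw.exists_quotRep_wordProd_le h hp hpA
  rw [hpg] at hle
  have hb : ∀ b : W, (μ g).restrict (cylinder τ [b]) ≪ (μ 1).restrict (cylinder τ [b]) := by
    intro b
    have := (hμ g).2.1.isFiniteMeasure_restrict (w := [b]) (by simp)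
    have := (hμ 1).2.1.isFiniteMeasure_restrict (w := [b]) (by simp)
    refine absolutelyContinuous_of_forall_lintegral_le hC fun F => ?_
    have hF : ∀ z, ((F z : NNReal) : ℝ) ≤ (nndist F 0 : NNReal) := fun z => by
      exact_mod_cast BoundedContinuousFunction.NNReal.upper_bound F z
    have hFc : Continuous fun z => ((F z : NNReal) : ℝ) := by fun_prop
    have h1 := (hμ g).tendsto_setLIntegral b hFc (fun z => NNReal.coe_nonneg _) hF
    have h2 := ENNReal.Tendsto.const_mul
      ((hμ 1).tendsto_setLIntegral b hFc (fun z => NNReal.coe_nonneg _) hF) (a := C) (Or.inr hC)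
    simp only [ENNReal.ofReal_coe_nnreal] at h1 h2
    refine le_of_tendsto_of_tendsto' h1 h2 fun k => ?_
    rw [setLIntegral_approxMeasure h.adm hw.pos hw.slow.1 (h.regular k).pos,
      setLIntegral_approxMeasure h.adm hw.pos hw.slow.1 (h.regular k).pos, ← ENNReal.tsum_mul_left]
    refine ENNReal.tsum_le_tsum fun v => ?_
    rw [← mul_assoc]
    gcongr
    exact h.massWeight_le_mul (hle k) v.1
  have hsum : ∀ m : Measure (MarkovShift τ),
      m = Measure.sum fun b => m.restrict (cylinder τ [b]) := fun m => by
    rw [← Measure.restrict_iUnion pairwise_disjoint_cylinder_singleton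
      fun b => measurableSet_cylinder _, iUnion_cylinder_singleton, Measure.restrict_univ]
  refine Measure.AbsolutelyContinuous.mk fun S hS h0 => ?_
  rw [hsum (μ g), Measure.sum_apply _ hS, ENNReal.tsum_eq_zero]
  intro b
  exact hb b (le_antisymm ((Measure.restrict_le_self S).trans h0.le) zero_le)

/-- The inverse branch on a one-letter cylinder. -/
lemma IsWeightSetting.map_prepend_restrict (hw : IsWeightSetting R K c) (hRc : Continuous R)
    (h : IsApproxSeq R s A a x f c γ t)
    (hμ : ∀ g, WeakStarTendsto (fun k => approxMeasure R s A a x H f c g (t k)) (μ g))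
    {w : List W} {b : W} (hwb : (w ++ [b]).IsChain τ) :
    ((μ 1).restrict (cylinder τ [b])).map (prepend w) =
      ((μ (wordProd s w)⁻¹).restrict (cylinder τ (w ++ [b]))).withDensity
        fun z => ENNReal.ofReal (γ ^ w.length * (birkhoffProd R w.length z)⁻¹) := by
  have hpos := fun z => birkhoffProd_pos hw.pos w.length z
  have hcont : Continuous fun z => (birkhoffProd R w.length z)⁻¹ :=
    (continuous_birkhoffProd hRc _).inv₀ fun z => (hpos z).ne'
  have hm : Measurable (prepend w : MarkovShift τ → MarkovShift τ) :=
    (continuous_prepend w).measurable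
  have := (hμ 1).2.1.isFiniteMeasure_restrict (w := [b]) (by simp)
  have := Measure.isFiniteMeasure_map ((μ 1).restrict (cylinder τ [b])) (prepend w)
  refine ext_of_forall_lintegral_eq_of_IsFiniteMeasure fun F => ?_
  have hF : ∀ z, ((F z : NNReal) : ℝ) ≤ (nndist F 0 : NNReal) := fun z => by
    exact_mod_cast BoundedContinuousFunction.NNReal.upper_bound F z
  have hFc : Continuous fun z => ((F z : NNReal) : ℝ) := by fun_prop
  have hFm : Measurable fun z => ((F z : NNReal) : ℝ≥0∞) := by
    exact F.continuous.measurable.coe_nnreal_ennreal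
  have hDm : Measurable fun z => ENNReal.ofReal (γ ^ w.length * (birkhoffProd R w.length z)⁻¹) :=
    (continuous_const.mul hcont).measurable.ennreal_ofReal
  -- The twist `𝔰(w)⁻¹` is chosen so that after prepending `w` the measure is `μ 1`.
  have key := hw.transfer_identity hRc h hμ hwb (wordProd s w)⁻¹ hFc
    (fun z => NNReal.coe_nonneg _) hF
  rw [inv_mul_cancel] at key
  simp only [ENNReal.ofReal_coe_nnreal] at key
  rw [lintegral_map hFm hm, ← key, lintegral_withDensity_eq_lintegral_mul _ hDm hFm,
    ← lintegral_const_mul' _ _ ENNReal.ofReal_ne_top]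
  refine lintegral_congr fun z => ?_
  rw [Pi.mul_apply, ENNReal.ofReal_mul (pow_nonneg h.pos.le _), mul_assoc]

/-- The inverse branches of the limit measure. -/
lemma IsWeightSetting.branchPush_eq (hw : IsWeightSetting R K c) (hRc : Continuous R)
    (h : IsApproxSeq R s A a x f c γ t)
    (hμ : ∀ g, WeakStarTendsto (fun k => approxMeasure R s A a x H f c g (t k)) (μ g))
    (w : List W) :
    branchPush w (μ 1) = ((μ (wordProd s w)⁻¹).restrict (cylinder τ w)).withDensity
      fun z => ENNReal.ofReal (γ ^ w.length * (birkhoffProd R w.length z)⁻¹) := by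
  have hm : Measurable (prepend w : MarkovShift τ → MarkovShift τ) :=
    (continuous_prepend w).measurable
  have h1 : shift^[w.length] '' cylinder τ w =
      ⋃ b : {b : W // (w ++ [b]).IsChain τ}, cylinder τ [b.1] := by
    rw [shift_iterate_image_cylinder]
    ext z
    simp only [mem_iUnion, mem_cylinder_singleton, Subtype.exists]
    exact ⟨fun hz => ⟨z.seq 0, hz, rfl⟩, fun ⟨b, hb, e⟩ => by subst e; exact hb⟩
  have h2 : cylinder τ w = ⋃ b : {b : W // (w ++ [b]).IsChain τ}, cylinder τ (w ++ [b.1]) := by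
    ext z
    simp only [mem_iUnion, Subtype.exists]
    constructor
    · intro hz
      have hwz : w = initWord z w.length := by
        refine List.ext_getElem (by simp) fun i h1 h2 => ?_
        rw [← mem_cylinder_iff.1 hz i h1]; simp [initWord]
      refine ⟨z.seq w.length, ?_, ?_⟩
      · nth_rewrite 1 [hwz]
        rw [initWord_append]; exact isChain_initWord _ _
      · rw [mem_cylinder_iff]
        intro i hi
        rcases lt_or_ge i w.length with hi' | hi'
        · rw [List.getElem_append_left hi', mem_cylinder_iff.1 hz i hi']
        · have : i = w.length := by simp at hi; omega
          subst this; simp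
    · rintro ⟨b, -, hz⟩ i d hd
      refine hz i d ?_
      rw [List.getElem?_append_left (List.getElem?_eq_some_iff.1 hd).1, hd]
  have hd1 : Pairwise (Function.onFun Disjoint
      fun b : {b : W // (w ++ [b]).IsChain τ} => cylinder τ [b.1]) :=
    fun b d hbd => pairwise_disjoint_cylinder_singleton fun e => hbd (Subtype.ext e)
  have hd2 : Pairwise (Function.onFun Disjoint
      fun b : {b : W // (w ++ [b]).IsChain τ} => cylinder τ (w ++ [b.1])) := by
    intro b d hbd
    refine Set.disjoint_left.2 fun z hz hz' => hbd (Subtype.ext ?_)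
    rw [← hz w.length b.1 (by simp), ← hz' w.length d.1 (by simp)]
  rw [branchPush, h1, Measure.restrict_iUnion hd1 fun b => measurableSet_cylinder _,
    Measure.map_sum hm.aemeasurable, h2,
    Measure.restrict_iUnion hd2 fun b => measurableSet_cylinder _, withDensity_sum]
  congr 1
  funext b
  exact hw.map_prepend_restrict hRc h hμ b.2

/-- The limit measure is twisted by a cocycle. -/
lemma IsWeightSetting.isTwistedByCocycle (hw : IsWeightSetting R K c) (hRc : Continuous R)
    (h : IsApproxSeq R s A a x f c γ t)
    (hμ : ∀ g, WeakStarTendsto (fun k => approxMeasure R s A a x H f c g (t k)) (μ g))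
    (htr : IsTransitiveExtension τ s) : IsTwistedByCocycle R s γ (μ 1) := by
  have hσ : ∀ g, SigmaFinite (μ g) := fun g => (hμ g).2.1.sigmaFinite
  -- Passing to real values is harmless: by σ-finiteness the derivative is finite almost everywhere.
  refine ⟨fun g z => ((μ g⁻¹).rnDeriv (μ 1) z).toReal,
    fun g => (Measure.measurable_rnDeriv _ _).ennreal_toReal, fun _ _ => ENNReal.toReal_nonneg,
    fun w _ _ => ?_⟩
  set g := wordProd s w with hg
  have hh : (μ 1).withDensity (fun z => ENNReal.ofReal ((μ g⁻¹).rnDeriv (μ 1) z).toReal) =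
      μ g⁻¹ := by
    rw [withDensity_congr_ae (ofReal_toReal_ae_eq (Measure.rnDeriv_lt_top _ _))]
    exact Measure.withDensity_rnDeriv_eq _ _ (hw.absolutelyContinuous h hμ htr _)
  have hcont : Continuous fun z => γ ^ w.length * (birkhoffProd R w.length z)⁻¹ :=
    continuous_const.mul ((continuous_birkhoffProd hRc _).inv₀ fun z =>
      (birkhoffProd_pos hw.pos _ z).ne')
  rw [hw.branchPush_eq hRc h hμ, ← hg, ← hh, restrict_withDensity (measurableSet_cylinder _),
    ← withDensity_mul _ (Measure.measurable_rnDeriv _ _).ennreal_toReal.ennreal_ofReal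
      hcont.measurable.ennreal_ofReal]
  congr 1
  funext z
  rw [Pi.mul_apply, mul_comm, ← ENNReal.ofReal_mul]
  exact mul_nonneg (pow_nonneg h.pos.le _) (inv_nonneg.2 (birkhoffProd_pos hw.pos _ z).le)

end Cocycle

end MarkovShift

/-! ### Assembly of the theorem. -/

open MarkovShift in
theorem mainTheorem6 {W : Type*} [Countable W] [TopologicalSpace W] [DiscreteTopology W]
    (τ : W → W → Prop) (hmix : IsMixing τ)
    (R : MarkovShift τ → ℝ) (hRpos : ∀ z, 0 < R z) (hR : IsLocallyHolder R)
    (hP : ∀ B : W, gurevicPressure R B = 0) (hSPR : IsStronglyPositiveRecurrent R)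
    {G : Type*} [Group G] [Countable G] (s : W → G)
    {ι : Type*} [Countable ι] (H : ι → Subgroup G)
    (A a : W) (x : MarkovShift τ) (hax : τ a (x.seq 0))
    (f : QuotSum H) (hf : ∀ y, 0 ≤ f y) (hf0 : f ≠ 0)
    (hcase : CompactSpace (MarkovShift τ) ∨
      (x.seq 0 = A ∧ ∃ B : W, gammaSPR R B < ENNReal.ofReal (decayExponent R s A a x H f))) :
    ∃ c : ℕ → ℝ, IsSlowlyIncreasing c ∧
    ∃ t : ℕ → ℝ, (∀ k, decayExponent R s A a x H f < t k) ∧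
      Tendsto t atTop (𝓝 (decayExponent R s A a x H f)) ∧
      (∀ k, (∀ g, Summable fun n : ℕ => densityTerm R s A a x c (t k) g (n + 1)) ∧
        (Summable fun g : G => density R s A a x c (t k) g • quotRep H g f) ∧
        densityVec R s A a x H f c (t k) ≠ 0) ∧
    ∃ Υ : G → ℝ,
      (∀ g, Tendsto (fun k =>
          inner ℝ (quotRep H g (densityVec R s A a x H f c (t k)))
              (densityVec R s A a x H f c (t k)) /
            inner ℝ (densityVec R s A a x H f c (t k)) (densityVec R s A a x H f c (t k)))
        atTop (𝓝 (Υ g))) ∧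
    ∃ ν : Measure (MarkovShift τ),
      FiniteOnCylinders ν ∧
      IsTwistedLimit R s A a x H f c t ν ∧
      (IsTransitiveExtension τ s →
        IsTwistedByCocycle R s (decayExponent R s A a x H f) ν) ∧
      ∀ (n : ℕ) (w : List W), w.length = n → (w ++ [A]).IsChain τ →
        IntegrableOn (fun z => (birkhoffProd R n z)⁻¹) (cylinder τ (w ++ [A])) ν ∧
        decayExponent R s A a x H f ^ n *
            ∫ z in cylinder τ (w ++ [A]), (birkhoffProd R n z)⁻¹ ∂ν =
          Υ (wordProd s w) := by
  obtain ⟨K, hK1, hK⟩ := hR.exists_boundedDistortion hRpos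
  have hRc : Continuous R := hR.continuous hRpos
  have hsums := exists_tsum_wordsFrom_le hmix hRpos hK hK1 hSPR.1
  obtain ⟨M, hM, hle⟩ := hsums A x
  -- Positivity comes from the minimum of `R` in the compact case, and otherwise from the exponent
  -- exceeding a non-negative rate.
  have hγ : 0 < decayExponent R s A a x H f := by
    rcases hcase with hcpt | ⟨-, B, hB⟩
    · obtain ⟨z, -, hz⟩ := isCompact_univ.exists_isMinOn ⟨x, mem_univ x⟩ hRc.continuousOn
      exact decayExponent_pos_of_le hRpos hax hmix hM hle hf hf0 (hRpos z)
        fun y => hz (mem_univ y)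
    · exact ENNReal.ofReal_pos.1 (bot_le.trans_lt hB)
  obtain ⟨c, hc, hsub, htop⟩ := exists_isSlowlyIncreasing (s := s) (a := a) hM hle hf hγ
    fun r hr0 hr => pathEnergy_eq_top_of_lt_decayExponent hRpos hax hM hle hf hr0 hr
  have hw : IsWeightSetting R K c := ⟨hRpos, hmix, hK, hK1, hsums, hc, hsub⟩
  obtain ⟨t, ht, hsum⟩ := exists_isApproxSeq hRpos hax hM hle hf hf0 hγ hc htop
  obtain ⟨φ, hφ, μ, hμ⟩ := hw.exists_weakStarTendsto ht fun g b => by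
    rcases hcase with hcpt | ⟨-, B, hB⟩
    · exact IsTightMeasureSet.of_compactSpace
    · exact hw.isTightMeasureSet ht hB g b
  have htφ := ht.comp hφ
  refine ⟨c, hc, t ∘ φ, htφ.lt, htφ.tendsto, fun k => ⟨hsum (φ k), (htφ.regular k).summable, ?_⟩,
    fun g => (μ g (cylinder τ [A])).toReal, hw.tendsto_inner htφ hμ, μ 1, (hμ 1).2.1,
    ⟨μ, rfl, hμ⟩, hw.isTwistedByCocycle hRc htφ hμ, ?_⟩
  · intro h0
    have := (htφ.regular k).inner_pos
    rw [h0, inner_zero_left] at this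
    exact lt_irrefl _ this
  · rintro n w rfl hwA
    exact hw.twist_formula hRc htφ hμ hwA
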